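/- **Setting.** Let $d,J\ge 1$, let $L^1=L^1(\mathbb R^d,\mathbb C^{2J})$, and let $\varrho>0$. Consider the integrated modal evolution equation $$u(\tau)=h+\int_0^\tau e^{\frac{i t}{\varrho}L}\,\hat F\big(e^{-\frac{i t}{\varrho}L}u(t)\big)\,dt,\qquad 0\le\tau\le\tau_*,\quad u\in C([0,\tau_*],L^1).$$ *Linear part.* $L(k)$, $k\in\mathbb R^d$, is a Hermitian $2J\times 2J$ matrix with eigenvalues $\omega_{J,+}(k)\ge\dots\ge\omega_{1,+}(k)\ge\omega_{1,-}(k)\ge\dots\ge\omega_{J,-}(k)$, orthonormal eigenvectors $g_{n,\zeta}(k)$ ($\zeta=\pm$) and the orthogonal projections $\Pi_{n,\zeta}(k)$ onto the lines spanned by them. The band-crossing set $\sigma_{bc}$ consists of the points $k$ where $\omega_{n+1,\zeta}(k)=\omega_{n,\zeta}(k)$ for some $n<J$ and $\zeta$, or $L$ is not continuous, or $\omega_{1,\zeta}(k)=0$ for some $\zeta$. It is assumed that $\sigma_{bc}$ is closed, nowhere dense and Lebesgue-null; that off $\sigma_{bc}$ one has $\omega_{n,+}\ge 0\ge\omega_{n,-}$,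 $\omega_{n,-\zeta}(-k)=-\omega_{n,\zeta}(k)$, and $L$ is $C^\infty$; and that $\|L(k)\|\le C(1+|k|^p)$ for all $k$, with some $C,p>0$. Write $\omega_n=\omega_{n,+}$. *Nonlinearity.* $\hat F=\sum_{m\in\mathfrak M_F}\hat F^{(m)}$ with a finite set $\mathfrak M_F\subset\{2,3,\dots\}$ and $$\hat F^{(m)}(u)(k)=\frac1{(2\pi)^{(m-1)d}}\int_{\mathbb R^{(m-1)d}}\chi^{(m)}(k,k',\dots,k^{(m)})\big(u(k'),\dots,u(k^{(m)})\big)\,dk'\cdots dk^{(m-1)},$$ where $k^{(m)}=k-k'-\dots-k^{(m-1)}$ and $\chi^{(m)}(k,\vec k)$ is an $m$-linear map on $\mathbb C^{2J}$ which, when no argument lies in $\sigma_{bc}$, depends smoothly on its arguments and satisfies $(2\pi)^{-(m-1)d}\|\chi^{(m)}\|\le C_\chi$. *Solution operator.* Fix $R>0$ and any $\tau_*>0$ with $\tau_*\,C_\chi\sum_{m\in\mathfrak M_F}m(2R)^{m-1}<1$. $\mathcal G(h)$ denotes the solution $u$ with $\sup_{[0,\tau_*]}\|u\|_{L^1}\le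 2R$, for $\|h\|_{L^1}\le R$. *Spectra.* An $nk$-spectrum is a finite set $S=\{(n_l,k_{*l}):l=1,\dots,N\}$ of $N$ different pairs. For a string $\lambda=((\zeta^{(1)},l_1),\dots,(\zeta^{(m)},l_m))$ of signs and indices put $\varkappa_m(\lambda)=\sum_j\zeta^{(j)}k_{*l_j}$. The output $k$-spectrum $[S]_{K,out}$ is the set of all $\varkappa_m(\lambda)$, $m\in\mathfrak M_F$. Let $P(S)$ be the set of $(m,\zeta,n,\lambda)$, $m\in\mathfrak M_F$, with $$-\zeta\,\omega_n(\zeta\varkappa_m(\lambda))+\sum_{j=1}^m\zeta^{(j)}\omega_{n_{l_j}}(k_{*l_j})=0.$$ Let $P_{int}(S)$ be the set of those solutions with $(n,\zeta\varkappa_m(\lambda))\in S$, and $P_{univ}(S)$ the set of those for which, with $\delta_l=\sum_{j:\,l_j=l}\zeta^{(j)}$, there is $I_0$ such that $\delta_{I_0}=\zeta\in\{1,-1\}$, $n=n_{I_0}$ and $\delta_l=0$ for all $l\ne I_0$. Let $\mathcal R(S)$ be the union of $S$ and of the set of all pairs $(n,\zeta\varkappa_m(\lambda))$ with $(m,\zeta,n,\lambda)\in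 P(S)$ and $\zeta\varkappa_m(\lambda)\in[S]_{K,out}$. $S$ is *universally resonance invariant* if $\mathcal R(S)=S$ and $P_{univ}(S)=P_{int}(S)$. *Wavepackets.* Fix a cutoff $\Psi\in C^\infty(\mathbb R^d)$, $\Psi\ge0$, $\Psi=1$ on $|\eta|\le\frac12$, $\Psi=0$ on $|\eta|\ge1$, and $0<\varepsilon<1$, $s>0$, $\beta_0>0$. A *particle-like wavepacket* with $nk$-pair $(n,k_*)$ and degree of regularity $s$ is a family $h(\beta,r_*;\cdot)\in L^1$, $0<\beta<\beta_0$, $r_*\in\mathbb R^d$, such that, with constants independent of $\beta$ and $r_*$: $\|h\|_{L^1}\le C$; there are $h_\zeta=h_\zeta(\beta,r_*;\cdot)\in L^1$, $\zeta=\pm$, with $h_\zeta(k)=\Psi\big(2\beta^{-(1-\varepsilon)}(k-\zeta k_*)\big)\Pi_{n,\zeta}(k)h_\zeta(k)$ and $\|h-h_+-h_-\|_{L^1}\le C'\beta^s$; and, with weak gradients, $\int|\nabla_k(e^{ir_*\cdot k}h_\zeta(\beta,r_*;k))|\,dk\le C_1\beta^{-1-\varepsilon}$. **Theorem.** For every $\varrho>0$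 and every $g$ with $\|g\|_{L^1}\le R$ the equation with $h=g$ has exactly one solution with $\sup_{[0,\tau_*]}\|u\|_{L^1}\le 2R$, so that $\mathcal G$ is well defined. Let $S=\{(n_l,k_{*l})\}_{l=1}^N$ be a universally resonance invariant $nk$-spectrum such that $\pm k_{*l}\notin\sigma_{bc}$ for all $l$, $[S]_{K,out}\cap\sigma_{bc}=\emptyset$, and the group velocities $\nabla\omega_{n_l}(k_{*l})$ are pairwise distinct. For each $l$ let $h_l$ be a particle-like wavepacket with $nk$-pair $(n_l,k_{*l})$ and degree of regularity $s$, with $N\|h_l(\beta,r_*)\|_{L^1}\le R$ for all $\beta,r_*$. Then for every $C_0$ there is a constant $C_\varepsilon$ such that for all $\beta<\beta_0$, $0<\beta\le\frac12$, $0<\varrho\le\frac12$ with $\beta^2/\varrho\le C_0$, and all positions $r_{*1},\dots,r_{*N}\in\mathbb R^d$, $$\mathcal G\Big(\sum_l h_l(\beta,r_{*l})\Big)=\sum_l\mathcal G\big(h_l(\beta,r_{*l})\big)+\tilde D,\qquad \sup_{0\le\tau\le\tau_*}\|\tilde D(\tau)\|_{L^1}\le C_\varepsilon\Big(\frac{\varrho}{\beta^{1+\varepsilon}}|\ln\beta|+\beta^s\Big).$$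 If $s\ge1-\varepsilon$, then moreover $$\sup_{0\le\tau\le\tau_*}\|\tilde D(\tau)\|_{L^1}\le C_\varepsilon\frac{\varrho}{\beta^{1+\varepsilon}}|\ln\beta|.$$ The constant $C_\varepsilon$ does not depend on $\beta$, $\varrho$ or the positions $r_{*l}$, and $\tau_*$ does not depend on $\beta$, $\varrho$, $\varepsilon$ or $r_{*l}$. -/

import Mathlib

open MeasureTheory Set
open scoped ContDiff

noncomputable section

namespace WavepacketSuperposition

/-- Wavevectors and positions: `ℝ^d` with its Euclidean norm. -/
abbrev Wave (d : ℕ) : Type := EuclideanSpace ℝ (Fin d)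

/-- Values of the fields: `ℂ^{2J}` with its Euclidean norm. -/
abbrev Val (J : ℕ) : Type := EuclideanSpace ℂ (Fin (2 * J))

/-- The Lebesgue space `L¹(ℝ^d, ℂ^{2J})`. -/
abbrev L1 (d J : ℕ) : Type := Lp (Val J) 1 (volume : Measure (Wave d))

/-- A sign `ζ = ±` as a real number; the group `ℤˣ = {1, -1}` is used as the set of signs. -/
def sgn (ζ : ℤˣ) : ℝ := ((ζ : ℤ) : ℝ)

/-! ### Linear part -/

/-- The symbol `L(k)`, a Hermitian `2J × 2J` matrix (as a self-adjoint operator on `ℂ^{2J}`), with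
its `2J` eigenvalues `ω_{n,ζ}(k) = freq n ζ k`, counted with multiplicity and ordered by
`ω_{J,+} ≥ … ≥ ω_{1,+} ≥ ω_{1,-} ≥ … ≥ ω_{J,-}`, and an orthonormal basis of
eigenvectors `g_{n,ζ}(k)`. The band number `n ∈ {1, …, J}` is encoded by `Fin J`
(so that band `1` has value `0`). -/
structure LinearPart (d J : ℕ) where
  L : Wave d → Val J →L[ℂ] Val J
  freq : Fin J → ℤˣ → Wave d → ℝ
  g : Fin J → ℤˣ → Wave d → Val J
  selfAdjoint : ∀ k, IsSelfAdjoint (L k)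
  eigen : ∀ n ζ k, L k (g n ζ k) = (freq n ζ k : ℂ) • g n ζ k
  orthonormal : ∀ k, Orthonormal ℂ (fun p : Fin J × ℤˣ => g p.1 p.2 k)
  mono_plus : ∀ k, Monotone (fun n => freq n 1 k)
  anti_minus : ∀ k, Antitone (fun n => freq n (-1) k)
  minus_le_plus : ∀ n n' k, freq n (-1) k ≤ freq n' 1 k

namespace LinearPart

variable {d J : ℕ}

/-- The set `σ_bc` of band-crossing points. -/
def bandCrossing (A : LinearPart d J) : Set (Wave d) :=
  {k | (∃ (n n' : Fin J) (ζ : ℤˣ), (n' : ℕ) = n + 1 ∧ A.freq n' ζ k = A.freq n ζ k) ∨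
    ¬ ContinuousAt A.L k ∨
    ∃ (n : Fin J) (ζ : ℤˣ), (n : ℕ) = 0 ∧ A.freq n ζ k = 0}

/-- The conditions imposed on the linear part. -/
structure Admissible (A : LinearPart d J) : Prop where
  plus_nonneg : ∀ n, ∀ k ∉ A.bandCrossing, 0 ≤ A.freq n 1 k
  minus_nonpos : ∀ n, ∀ k ∉ A.bandCrossing, A.freq n (-1) k ≤ 0
  symm : ∀ n ζ, ∀ k ∉ A.bandCrossing, A.freq n (-ζ) (-k) = -A.freq n ζ k
  isClosed : IsClosed A.bandCrossing
  nowhereDense : IsNowhereDense A.bandCrossing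
  null : volume A.bandCrossing = 0
  smooth : ContDiffOn ℝ ∞ A.L A.bandCrossingᶜ
  polyBound : ∃ C > 0, ∃ p > (0 : ℝ), ∀ k, ‖A.L k‖ ≤ C * (1 + ‖k‖ ^ p)

/-- The orthogonal projection `Π_{n,ζ}(k)` onto the line spanned by `g_{n,ζ}(k)`. -/
def proj (A : LinearPart d J) (n : Fin J) (ζ : ℤˣ) (k : Wave d) (u : Val J) : Val J :=
  inner ℂ (A.g n ζ k) u • A.g n ζ k

/-- The operator `exp(i t L(k) / ϱ)`. -/
def propagator (A : LinearPart d J) (ϱ t : ℝ) (k : Wave d) : Val J →L[ℂ] Val J :=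
  NormedSpace.exp ((Complex.I * ((t / ϱ : ℝ) : ℂ)) • A.L k)

end LinearPart

/-! ### Nonlinear part -/

/-- The data of a polynomial nonlinearity: the finite set `𝔐_F ⊆ {2, 3, …}` of the degrees of
homogeneity and the susceptibilities `χ^{(m)}(k, k', …, k^{(m)})`. -/
structure Nonlinearity (d J : ℕ) where
  degrees : Finset ℕ
  two_le : ∀ m ∈ degrees, 2 ≤ m
  χ : (m : ℕ) → Wave d → (Fin m → Wave d) →
    ContinuousMultilinearMap ℂ (fun _ : Fin m => Val J) (Val J)

/-- The string `(k', …, k^{(m-1)}, k - k' - … - k^{(m-1)})`. -/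
def convString {d : ℕ} (m : ℕ) (k : Wave d) (q : Fin (m - 1) → Wave d) : Fin m → Wave d :=
  fun j => if h : (j : ℕ) < m - 1 then q ⟨j, h⟩ else k - ∑ i, q i

namespace Nonlinearity

variable {d J : ℕ}

/-- The conditions imposed on the nonlinearity: the susceptibilities are smooth off the
band-crossing points, and bounded there by `Cχ` (with the normalization
`(2π)^{-(m-1)d}` of the norm). -/
structure Admissible (B : Nonlinearity d J) (A : LinearPart d J) (Cχ : ℝ) : Prop where
  smooth : ∀ m ∈ B.degrees,
    ContDiffOn ℝ ∞ (fun p : Wave d × (Fin m → Wave d) => B.χ m p.1 p.2)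
      {p | p.1 ∉ A.bandCrossing ∧ ∀ j, p.2 j ∉ A.bandCrossing}
  bound : ∀ m ∈ B.degrees, ∀ (k : Wave d) (q : Fin m → Wave d),
    k ∉ A.bandCrossing → (∀ j, q j ∉ A.bandCrossing) →
      ((2 * Real.pi) ^ ((m - 1) * d))⁻¹ * ‖B.χ m k q‖ ≤ Cχ

/-- The `m`-homogeneous term `F̂^{(m)}(U, …, U)(k)`. -/
def term (B : Nonlinearity d J) (m : ℕ) (U : Wave d → Val J) (k : Wave d) : Val J :=
  ((2 * Real.pi) ^ ((m - 1) * d))⁻¹ •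
    ∫ q : Fin (m - 1) → Wave d,
      B.χ m k (convString m k q) (fun j => U (convString m k q j))

/-- The nonlinearity `F̂(U)(k) = ∑_{m ∈ 𝔐_F} F̂^{(m)}(U, …, U)(k)`. -/
def eval (B : Nonlinearity d J) (U : Wave d → Val J) (k : Wave d) : Val J :=
  ∑ m ∈ B.degrees, B.term m U k

/-- `e^{i t L(k) / ϱ} F̂(e^{-i t L / ϱ} u)(k)`. -/
def slow (B : Nonlinearity d J) (A : LinearPart d J) (ϱ t : ℝ) (u : Wave d → Val J)
    (k : Wave d) : Val J :=
  A.propagator ϱ t k (B.eval (fun k' => A.propagator ϱ (-t) k' (u k')) k)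

open Classical in
/-- `e^{i t L / ϱ} F̂(e^{-i t L / ϱ} u)` as an element of `L¹`. For admissible `A`, `B`
this function is integrable for every `u ∈ L¹` (Young's inequality), so that the second
alternative is void. -/
def slowL1 (B : Nonlinearity d J) (A : LinearPart d J) (ϱ t : ℝ) (u : L1 d J) : L1 d J :=
  if hf : Integrable (B.slow A ϱ t u) volume then hf.toL1 _ else 0

end Nonlinearity

/-! ### Integrated evolution equation -/

section Evolution

variable {d J : ℕ}

/-- `u ∈ C([0, τs], L¹)` solves the integrated modal evolution equation
`u(τ) = h + ∫_0^τ e^{i t L / ϱ} F̂(e^{-i t L / ϱ} u(t)) dt` on `[0, τs]` and lies in the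
ball of radius `2R` of `C([0, τs], L¹)`. -/
structure IsSolution (A : LinearPart d J) (B : Nonlinearity d J) (ϱ τs R : ℝ) (h : L1 d J)
    (u : ℝ → L1 d J) : Prop where
  continuousOn : ContinuousOn u (Icc 0 τs)
  bound : ∀ τ ∈ Icc 0 τs, ‖u τ‖ ≤ 2 * R
  equation : ∀ τ ∈ Icc 0 τs, u τ = h + ∫ t in (0 : ℝ)..τ, B.slowL1 A ϱ t (u t)

open Classical in
/-- The solution operator `𝒢`, sending the initial datum `h`, `‖h‖ ≤ R`, to the solution of the
integrated evolution equation on `[0, τs]`. -/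
def solutionOperator (A : LinearPart d J) (B : Nonlinearity d J) (ϱ τs R : ℝ) (h : L1 d J) :
    ℝ → L1 d J :=
  if H : ∃ u, IsSolution A B ϱ τs R h u then H.choose else 0

/-- The constant `C_F`: a Lipschitz constant of the nonlinearity on the ball of radius `2R`
of `L¹`. -/
def lipConst (B : Nonlinearity d J) (Cχ R : ℝ) : ℝ :=
  Cχ * ∑ m ∈ B.degrees, (m : ℝ) * (2 * R) ^ (m - 1)

end Evolution

/-! ### Resonance invariance of `nk`-spectra -/

section Resonance

variable {d J N : ℕ}

/-- `ϰ_m(λ) = ∑_j ζ^{(j)} k_{*l_j}` for a string `λ = ((ζ^{(1)}, l_1), …, (ζ^{(m)}, l_m))`; the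
`nk`-spectrum is given by its enumeration `S l = (n_l, k_{*l})`. -/
def kappa (S : Fin N → Fin J × Wave d) {m : ℕ} (lam : Fin m → ℤˣ × Fin N) : Wave d :=
  ∑ j, sgn (lam j).1 • (S (lam j).2).2

/-- The output `k`-spectrum `[S]_{K,out}`. -/
def outputKSpectrum (B : Nonlinearity d J) (S : Fin N → Fin J × Wave d) : Set (Wave d) :=
  {k | ∃ m ∈ B.degrees, ∃ lam : Fin m → ℤˣ × Fin N, k = kappa S lam}

/-- The output `nk`-spectrum `[S]_out`. -/
def outputSpectrum (B : Nonlinearity d J) (S : Fin N → Fin J × Wave d) :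
    Set (Fin J × Wave d) :=
  {p | p.2 ∈ outputKSpectrum B S}

/-- Tuples `(m, ζ, n, λ)`, the unknowns of the resonance equation. -/
abbrev ResIndex (J N : ℕ) : Type :=
  Σ m : ℕ, ℤˣ × Fin J × (Fin m → ℤˣ × Fin N)

/-- `ζ ϰ_m(λ)`. -/
def ResIndex.out (S : Fin N → Fin J × Wave d) (p : ResIndex J N) : Wave d :=
  sgn p.2.1 • kappa S p.2.2.2

/-- The set `P(S)` of solutions `(m, ζ, n, λ)`, `m ∈ 𝔐_F`, of the resonance equation
`-ζ ω_n(ζ ϰ_m(λ)) + ∑_j ζ^{(j)} ω_{n_{l_j}}(k_{*l_j}) = 0`, where `ω_n = ω_{n,+}`. -/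
def resSolutions (A : LinearPart d J) (B : Nonlinearity d J) (S : Fin N → Fin J × Wave d) :
    Set (ResIndex J N) :=
  {p | p.1 ∈ B.degrees ∧
    -sgn p.2.1 * A.freq p.2.2.1 1 (p.out S) +
      ∑ j, sgn (p.2.2.2 j).1 * A.freq (S (p.2.2.2 j).2).1 1 (S (p.2.2.2 j).2).2 = 0}

/-- The set `P_int(S)` of `S`-internal solutions. -/
def resInternal (A : LinearPart d J) (B : Nonlinearity d J) (S : Fin N → Fin J × Wave d) :
    Set (ResIndex J N) :=
  {p | p ∈ resSolutions A B S ∧ (p.2.2.1, p.out S) ∈ range S}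

/-- `δ_l`, the sum of the signs `ζ^{(j)}` over the positions `j` with `l_j = l`. -/
def delta {m : ℕ} (lam : Fin m → ℤˣ × Fin N) (l : Fin N) : ℤ :=
  ∑ j, if (lam j).2 = l then ((lam j).1 : ℤ) else 0

/-- The set `P_univ(S)` of universal solutions. -/
def resUniversal (A : LinearPart d J) (B : Nonlinearity d J) (S : Fin N → Fin J × Wave d) :
    Set (ResIndex J N) :=
  {p | p ∈ resSolutions A B S ∧ ∃ I₀ : Fin N,
    (delta p.2.2.2 I₀ = 1 ∨ delta p.2.2.2 I₀ = -1) ∧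
    (∀ l, l ≠ I₀ → delta p.2.2.2 l = 0) ∧
    p.2.2.1 = (S I₀).1 ∧ (p.2.1 : ℤ) = delta p.2.2.2 I₀}

/-- The resonant output spectrum `[S]_out^res`. -/
def resonantOutput (A : LinearPart d J) (B : Nonlinearity d J) (S : Fin N → Fin J × Wave d) :
    Set (Fin J × Wave d) :=
  {q | q ∈ outputSpectrum B S ∧ ∃ p ∈ resSolutions A B S, q = (p.2.2.1, p.out S)}

/-- The resonance selection operation `ℛ(S) = S ∪ [S]_out^res`. -/
def resonanceSelection (A : LinearPart d J) (B : Nonlinearity d J)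
    (S : Fin N → Fin J × Wave d) : Set (Fin J × Wave d) :=
  range S ∪ resonantOutput A B S

/-- Universal resonance invariance of an `nk`-spectrum. -/
def UniversallyResonanceInvariant (A : LinearPart d J) (B : Nonlinearity d J)
    (S : Fin N → Fin J × Wave d) : Prop :=
  resonanceSelection A B S = range S ∧ resUniversal A B S = resInternal A B S

end Resonance

/-! ### Particle-like wavepackets -/

section Wavepackets

variable {d J : ℕ}

/-- A cutoff function: smooth, nonnegative, `1` on `|η| ≤ 1/2`, and `0` on `|η| ≥ 1`. -/
structure IsCutoff (Ψ : Wave d → ℝ) : Prop where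
  smooth : ContDiff ℝ ∞ Ψ
  nonneg : ∀ η, 0 ≤ Ψ η
  eq_one : ∀ η, ‖η‖ ≤ 1 / 2 → Ψ η = 1
  eq_zero : ∀ η, 1 ≤ ‖η‖ → Ψ η = 0

/-- The shifted and rescaled cutoff `Ψ(δ, k_*; k) = Ψ((k - k_*) / δ)`. -/
def cutoffAt (Ψ : Wave d → ℝ) (δ : ℝ) (kstar k : Wave d) : ℝ :=
  Ψ (δ⁻¹ • (k - kstar))

/-- `G` is the weak (distributional) gradient of the locally integrable function `f`. -/
structure HasWeakGradient (f : Wave d → Val J) (G : Wave d → Wave d →L[ℝ] Val J) : Prop where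
  locInt : LocallyIntegrable f volume
  locIntGrad : LocallyIntegrable G volume
  byParts : ∀ φ : Wave d → ℝ, ContDiff ℝ ∞ φ → HasCompactSupport φ → ∀ v : Wave d,
    ∫ k, fderiv ℝ φ k v • f k = -∫ k, φ k • G k v

/-- The requirements on a wavepacket with `nk`-pair `(n, k_*)` and degree of regularity `s`, with
constants `C`, `C'`, at one value of `β`: the function `h` is `L¹`-bounded, and
`h = h_+ + h_- + D_h` where `h_ζ = Ψ(β^{1-ε}/2, ζ k_*; ·) Π_{n,ζ} h_ζ` and
`‖D_h‖ ≤ C' β^s`. -/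
structure IsWavepacketAt (A : LinearPart d J) (Ψ : Wave d → ℝ) (ε s : ℝ) (n : Fin J)
    (kstar : Wave d) (C C' β : ℝ) (h : L1 d J) (hc : ℤˣ → L1 d J) : Prop where
  bound : ‖h‖ ≤ C
  localized : ∀ ζ : ℤˣ, ∀ᵐ k ∂(volume : Measure (Wave d)),
    hc ζ k = cutoffAt Ψ (β ^ (1 - ε) / 2) (sgn ζ • kstar) k • A.proj n ζ k (hc ζ k)
  remainder : ‖h - (hc 1 + hc (-1))‖ ≤ C' * β ^ s

/-- A particle-like wavepacket `h(β, r_*; k)`, `0 < β < β₀`, `r_* ∈ ℝ^d`, with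
`nk`-pair `(n, k_*)` and degree of regularity `s`: for every `r_*` it is a wavepacket, with
constants independent of `r_*`, and its components satisfy
`∫ |∇_k (e^{i r_* · k} h_ζ(β, r_*; k))| dk ≤ C₁ β^{-1-ε}`. -/
def IsParticleWavepacket (A : LinearPart d J) (Ψ : Wave d → ℝ) (ε s β₀ : ℝ) (n : Fin J)
    (kstar : Wave d) (h : ℝ → Wave d → L1 d J) : Prop :=
  ∃ (C C' C₁ : ℝ) (hc : ℝ → Wave d → ℤˣ → L1 d J),
    ∀ β, 0 < β → β < β₀ → ∀ r : Wave d,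
      IsWavepacketAt A Ψ ε s n kstar C C' β (h β r) (hc β r) ∧
      ∀ ζ : ℤˣ, ∃ G : Wave d → Wave d →L[ℝ] Val J,
        HasWeakGradient
          (fun k => Complex.exp (Complex.I * ((inner ℝ r k : ℝ) : ℂ)) • hc β r ζ k) G ∧
        Integrable G volume ∧ ∫ k, ‖G k‖ ≤ C₁ * β ^ (-1 - ε)

end Wavepackets

end WavepacketSuperposition

end

open WavepacketSuperposition

/-! Waves with different group velocities interact only for a short time around their closest
approach. The proof makes this quantitative in `L¹`, using shifts in `k`-space and comparison of
phases. Write `μ ~ β^{1-ε}` for the width of a wavepacket, `b = β^{-1-ε}` for the size of its weak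
gradient and `α = ϱ b`.

One wavepacket. The truncated distance to the group `ℤ k_*` is subadditive, so its moment is
controlled by Grönwall and the solution stays concentrated near the harmonics of `k_*`
(`IsSolution.wmom_le`). The susceptibility may then be frozen at the centres with error `O(μ)`
(`exists_norm_sub_osc_le`), and every interaction becomes an operator `osc` whose phase is `s/ϱ`
times a frequency mismatch. If the mismatch at the centres is nonzero, the time integral is `O(ϱ +
μ)`, because values half a period apart nearly cancel (`exists_norm_integral_osc_le`). Universal
resonance invariance leaves only outputs in the band `(n, ζ)` at `ζ k_*`. Hence, up to `O(ϱ + μ)`,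
the solution is the sum of two components that satisfy a closed effective equation
(`exists_wave_estimate`).

Positions. A packet located at `r` is nearly invariant under `f ↦ e^{i r·y} f(· + y)`, the defect
being at most of order `|y| b`. The two components of a wave have the same group velocity, so a
resonant term commutes with such shifts up to second order in the phase. Grönwall keeps the
components nearly invariant at all later times, with the initial `r` (`exists_wave_shift_estimate`).

Mixed interactions. Shift an argument from one wave by `η` and an argument from another wave by
`-η`. The output is not moved, but the term acquires the factor `e^{i(r₁-r₂)·η}` on one side and
`e^{-i(s/ϱ)p·η}` on the other, where `p ≠ 0` is the difference of the group velocities. If `η` makes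
these factors opposite, the term equals its own negative up to a small error. This requires `|η| ~
ϱ/|s - t₀|` with `t₀` the time of closest approach, and gives the bound `α/(α + |s - t₀|) + α`
(`exists_norm_osc_mixed_le`). Its time integral is of order `α(1 + log(1 + τs/α))`, which produces
the factor `|ln β|`.

Only mixed interactions enter the defect of additivity (`slowL1_sum_sub`), and stability of the
evolution equation (`norm_sub_le_of_residual`) turns their smallness into that of the difference of
solutions. The condition `β² ≤ C₀ϱ` is what makes `μ` and the quadratic phase errors at most of the
order of the main term. -/

noncomputable section

namespace WavepacketSuperposition

/-! ### Perturbation theory of the eigenvalues and eigenprojections of `L(k)`. -/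

namespace LinearPart

variable {d J : ℕ} (A : LinearPart d J)

/-- The eigenvalue with index `i = (n, ζ)`. -/
def om (i : Fin J × ℤˣ) (k : Wave d) : ℝ := A.freq i.1 i.2 k

/-- The eigenvector with index `i = (n, ζ)`. -/
def eig (i : Fin J × ℤˣ) (k : Wave d) : Val J := A.g i.1 i.2 k

lemma orthonormal_eig (k : Wave d) : Orthonormal ℂ (fun i => A.eig i k) := A.orthonormal k

/-- The eigenvectors as an orthonormal basis. -/
def eigBasis (k : Wave d) : OrthonormalBasis (Fin J × ℤˣ) ℂ (Val J) :=
  OrthonormalBasis.mk (A.orthonormal_eig k) (by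
    refine ((A.orthonormal_eig k).linearIndependent.span_eq_top_of_card_eq_finrank' ?_).ge
    simp [mul_comm])

@[simp] lemma eigBasis_apply (k : Wave d) (i : Fin J × ℤˣ) : A.eigBasis k i = A.eig i k := by
  rw [eigBasis, OrthonormalBasis.coe_mk]

lemma norm_eig (i : Fin J × ℤˣ) (k : Wave d) : ‖A.eig i k‖ = 1 := by
  rw [← eigBasis_apply]; exact (A.eigBasis k).orthonormal.1 i

lemma inner_eig_eig (i j : Fin J × ℤˣ) (k : Wave d) :
    inner ℂ (A.eig i k) (A.eig j k) = if i = j then (1 : ℂ) else 0 := by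
  simp_rw [← eigBasis_apply]
  exact orthonormal_iff_ite.1 (A.eigBasis k).orthonormal i j

lemma L_eig (i : Fin J × ℤˣ) (k : Wave d) : A.L k (A.eig i k) = (A.om i k : ℂ) • A.eig i k :=
  A.eigen i.1 i.2 k

lemma inner_L (k : Wave d) (x y : Val J) : inner ℂ (A.L k x) y = inner ℂ x (A.L k y) := by
  have := ContinuousLinearMap.isSelfAdjoint_iff_isSymmetric.1 (A.selfAdjoint k)
  exact this x y

lemma inner_eig_L (i : Fin J × ℤˣ) (k : Wave d) (x : Val J) :
    inner ℂ (A.eig i k) (A.L k x) = (A.om i k : ℂ) * inner ℂ (A.eig i k) x := by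
  rw [← inner_L, L_eig, inner_smul_left, Complex.conj_ofReal]

lemma quadratic_form (k : Wave d) (x : Val J) :
    (inner ℂ x (A.L k x) : ℂ).re = ∑ i, A.om i k * ‖inner ℂ (A.eig i k) x‖ ^ 2 := by
  rw [← (A.eigBasis k).sum_inner_mul_inner x (A.L k x), Complex.re_sum]
  refine Finset.sum_congr rfl fun i _ => ?_
  rw [eigBasis_apply, inner_eig_L, ← inner_conj_symm x, mul_left_comm,
    ← Complex.normSq_eq_conj_mul_self, ← Complex.ofReal_mul, Complex.ofReal_re, Complex.normSq_eq_norm_sq]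

lemma sum_sq_inner (k : Wave d) (x : Val J) :
    ∑ i, ‖inner ℂ (A.eig i k) x‖ ^ 2 = ‖x‖ ^ 2 := by
  simpa using (A.eigBasis k).sum_sq_norm_inner_right x

/-- Any two eigenvalue branches are comparable, globally in `k`. -/
lemma om_comparable (i j : Fin J × ℤˣ) :
    (∀ k, A.om i k ≤ A.om j k) ∨ (∀ k, A.om j k ≤ A.om i k) := by
  obtain ⟨n, ζ⟩ := i
  obtain ⟨n', ζ'⟩ := j
  rcases Int.units_eq_one_or ζ with rfl | rfl <;> rcases Int.units_eq_one_or ζ' with rfl | rfl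
  · rcases le_total n n' with h | h
    · exact Or.inl fun k => A.mono_plus k h
    · exact Or.inr fun k => A.mono_plus k h
  · exact Or.inr fun k => A.minus_le_plus _ _ k
  · exact Or.inl fun k => A.minus_le_plus _ _ k
  · rcases le_total n n' with h | h
    · exact Or.inr fun k => A.anti_minus k h
    · exact Or.inl fun k => A.anti_minus k h

/-- Weyl's inequality, one-sided. -/
lemma om_le_add (i : Fin J × ℤˣ) (k k' : Wave d) :
    A.om i k ≤ A.om i k' + ‖A.L k - A.L k'‖ := by
  classical
  -- One linear condition for each branch `j ≠ i`, hence `2J - 1` conditions in dimension `2J`. A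
  -- nonzero common solution `x` is a test vector whose quadratic form is bounded below by `ω_i(k)`
  -- for `L(k)` and above by `ω_i(k')` for `L(k')`.
  let f : Val J →ₗ[ℂ] ({j : Fin J × ℤˣ // j ≠ i} → ℂ) := LinearMap.pi fun j =>
    if A.om i k ≤ A.om j k then ((innerSL ℂ (A.eig j k')).toLinearMap)
      else ((innerSL ℂ (A.eig j k)).toLinearMap)
  have hpos : 0 < Fintype.card (Fin J × ℤˣ) := Fintype.card_pos_iff.2 ⟨i⟩
  have hker : LinearMap.ker f ≠ ⊥ := by
    apply LinearMap.ker_ne_bot_of_finrank_lt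
    have h1 : Module.finrank ℂ (Val J) = Fintype.card (Fin J × ℤˣ) := by
      simp [mul_comm]
    rw [Module.finrank_fintype_fun_eq_card, h1, Fintype.card_subtype_compl,
      Fintype.card_subtype_eq]
    omega
  obtain ⟨x, hx, hx0⟩ := (Submodule.ne_bot_iff _).1 hker
  have hfx : ∀ j (hj : j ≠ i), f x ⟨j, hj⟩ = 0 := fun j hj => by
    rw [LinearMap.mem_ker.1 hx]; rfl
  have h1 : ∀ j, A.om j k < A.om i k → inner ℂ (A.eig j k) x = 0 := fun j hj => by
    have hne : j ≠ i := fun h => by simp [h] at hj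
    have := hfx j hne
    simpa [f, hj.not_ge] using this
  -- A branch strictly above `i` at `k'` is above it at every point by comparability, in particular
  -- at `k`, so the condition imposed for `j` is the one at `k'`.
  have h2 : ∀ j, A.om i k' < A.om j k' → inner ℂ (A.eig j k') x = 0 := fun j hj => by
    have hne : j ≠ i := fun h => by simp [h] at hj
    have hc : A.om i k ≤ A.om j k := by
      rcases A.om_comparable i j with h | h
      · exact h k
      · exact absurd (h k') hj.not_ge
    have := hfx j hne
    simpa [f, hc] using this
  have e1 : A.om i k * ‖x‖ ^ 2 ≤ (inner ℂ x (A.L k x) : ℂ).re := by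
    rw [quadratic_form, ← A.sum_sq_inner k x, Finset.mul_sum]
    refine Finset.sum_le_sum fun j _ => ?_
    rcases lt_or_ge (A.om j k) (A.om i k) with h | h
    · simp [h1 j h]
    · exact mul_le_mul_of_nonneg_right h (by positivity)
  have e2 : (inner ℂ x (A.L k' x) : ℂ).re ≤ A.om i k' * ‖x‖ ^ 2 := by
    rw [quadratic_form, ← A.sum_sq_inner k' x, Finset.mul_sum]
    refine Finset.sum_le_sum fun j _ => ?_
    rcases lt_or_ge (A.om i k') (A.om j k') with h | h
    · simp [h2 j h]
    · exact mul_le_mul_of_nonneg_right h (by positivity)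
  have e3 : (inner ℂ x (A.L k x) : ℂ).re - (inner ℂ x (A.L k' x) : ℂ).re
      ≤ ‖A.L k - A.L k'‖ * ‖x‖ ^ 2 := by
    rw [← Complex.sub_re, ← inner_sub_right, ← sub_apply]
    refine (Complex.re_le_norm _).trans ((norm_inner_le_norm _ _).trans ?_)
    calc ‖x‖ * ‖(A.L k - A.L k') x‖ ≤ ‖x‖ * (‖A.L k - A.L k'‖ * ‖x‖) := by
          gcongr; exact ContinuousLinearMap.le_opNorm _ _
      _ = _ := by ring
  have hx2 : 0 < ‖x‖ ^ 2 := by positivity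
  have : A.om i k * ‖x‖ ^ 2 ≤ (A.om i k' + ‖A.L k - A.L k'‖) * ‖x‖ ^ 2 := by
    rw [add_mul]; linarith
  exact le_of_mul_le_mul_right this hx2

lemma abs_om_sub_le (i : Fin J × ℤˣ) (k k' : Wave d) :
    |A.om i k - A.om i k'| ≤ ‖A.L k - A.L k'‖ := by
  rw [abs_le]
  have h1 := A.om_le_add i k k'
  have h2 := A.om_le_add i k' k
  rw [norm_sub_rev] at h2
  constructor <;> linarith

/-- The orthogonal projection onto the eigenline, as a continuous linear map. -/
def projL (i : Fin J × ℤˣ) (k : Wave d) : Val J →L[ℂ] Val J :=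
  (innerSL ℂ (A.eig i k)).smulRight (A.eig i k)

lemma projL_apply (i : Fin J × ℤˣ) (k : Wave d) (u : Val J) :
    A.projL i k u = inner ℂ (A.eig i k) u • A.eig i k := rfl

lemma norm_projL_apply_le (i : Fin J × ℤˣ) (k : Wave d) (u : Val J) :
    ‖A.projL i k u‖ ≤ ‖u‖ := by
  rw [projL_apply, norm_smul, norm_eig, mul_one]
  simpa [norm_eig] using norm_inner_le_norm (𝕜 := ℂ) (A.eig i k) u

lemma sum_projL (k : Wave d) (u : Val J) : ∑ i, A.projL i k u = u := by
  have := (A.eigBasis k).sum_repr' u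
  simpa [projL_apply] using this

lemma projL_projL (i j : Fin J × ℤˣ) (k : Wave d) (u : Val J) :
    A.projL i k (A.projL j k u) = if i = j then A.projL j k u else 0 := by
  rw [projL_apply, projL_apply, inner_smul_right, inner_eig_eig]
  split_ifs with h
  · subst h; simp
  · simp

/-- Equality of two eigenvalues of the same sign forces, by monotonicity in the band number,
equality of two adjacent ones. Eigenvalues of opposite signs are separated by zero, because
`ω_{1,+}` is nonnegative and does not vanish. -/
lemma om_injective {A : LinearPart d J} (hA : A.Admissible) {k : Wave d} (hk : k ∉ A.bandCrossing)
    {i j : Fin J × ℤˣ} (hij : i ≠ j) : A.om i k ≠ A.om j k := by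
  have hk' := hk
  simp only [bandCrossing, mem_ofPred_eq, not_or, not_exists, not_and] at hk
  obtain ⟨hadj, -, hzero⟩ := hk
  have same : ∀ ζ (n n' : Fin J), n < n' → A.freq n ζ k ≠ A.freq n' ζ k := by
    intro ζ n n' hn heq
    have hlt : (n : ℕ) + 1 < J := by have := n'.2; have : (n : ℕ) < n' := hn; omega
    have hle : (⟨n + 1, hlt⟩ : Fin J) ≤ n' := by
      have : (n : ℕ) < n' := hn
      exact Fin.mk_le_of_le_val (by omega)
    have hle0 : n ≤ (⟨n + 1, hlt⟩ : Fin J) := Fin.le_def.2 (by simp)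
    have := hadj n ⟨n + 1, hlt⟩ ζ rfl
    rcases Int.units_eq_one_or ζ with rfl | rfl
    · exact this (le_antisymm (heq ▸ A.mono_plus k hle) (A.mono_plus k hle0))
    · exact this (le_antisymm (A.anti_minus k hle0) (heq ▸ A.anti_minus k hle))
  have opp : ∀ n n' : Fin J, A.freq n' (-1) k < A.freq n 1 k := by
    intro n n'
    have hJ : 0 < J := n.pos
    have h0 : (⟨0, hJ⟩ : Fin J) ≤ n := Fin.le_def.2 (by simp)
    have h0' : (⟨0, hJ⟩ : Fin J) ≤ n' := Fin.le_def.2 (by simp)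
    have h1 := A.mono_plus k h0
    have h2 := A.anti_minus k h0'
    have h3 := hA.plus_nonneg ⟨0, hJ⟩ k hk'
    have h4 := hA.minus_nonpos ⟨0, hJ⟩ k hk'
    have h5 := hzero ⟨0, hJ⟩ 1 rfl
    have h6 : 0 < A.freq ⟨0, hJ⟩ 1 k := lt_of_le_of_ne h3 (Ne.symm h5)
    simp only at h1 h2
    linarith
  obtain ⟨n, ζ⟩ := i
  obtain ⟨n', ζ'⟩ := j
  simp only [om]
  by_cases hζ : ζ = ζ'
  · subst hζ
    have hne : n ≠ n' := fun h => hij (by rw [h])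
    rcases lt_or_gt_of_ne hne with h | h
    · exact same ζ n n' h
    · exact (same ζ n' n h).symm
  · rcases Int.units_eq_one_or ζ with rfl | rfl <;> rcases Int.units_eq_one_or ζ' with rfl | rfl
    · exact absurd rfl hζ
    · exact (opp n n').ne'
    · exact (opp n' n).ne
    · exact absurd rfl hζ

/-- Expand `g_i(k')` in the eigenbasis at `k`. The coefficient along `g_j(k)`, multiplied by `ω_j(k)
- ω_i(k')`, is a matrix element of `L(k) - L(k')`, and the gap bounds it. Neither continuity nor any
choice of phase of the eigenvectors is involved. -/
lemma norm_eig_sub_projL_le (i : Fin J × ℤˣ) (k k' : Wave d) {γ : ℝ} (hγ : 0 < γ)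
    (hgap : ∀ j, j ≠ i → γ ≤ |A.om j k - A.om i k'|) :
    ‖A.eig i k' - A.projL i k (A.eig i k')‖
      ≤ Fintype.card (Fin J × ℤˣ) * (‖A.L k - A.L k'‖ / γ) := by
  have h1 : A.eig i k' - A.projL i k (A.eig i k')
      = ∑ j ∈ Finset.univ.erase i, A.projL j k (A.eig i k') := by
    rw [sub_eq_iff_eq_add, Finset.sum_erase_add _ _ (Finset.mem_univ i), sum_projL]
  rw [h1]
  refine (norm_sum_le _ _).trans ?_
  have h2 : ∀ j ∈ Finset.univ.erase i, ‖A.projL j k (A.eig i k')‖ ≤ ‖A.L k - A.L k'‖ / γ := by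
    intro j hj
    have hji := (Finset.mem_erase.1 hj).1
    have e : (((A.om j k - A.om i k' : ℝ)) : ℂ) * inner ℂ (A.eig j k) (A.eig i k')
        = inner ℂ (A.eig j k) ((A.L k - A.L k') (A.eig i k')) := by
      rw [sub_apply, inner_sub_right, inner_eig_L, L_eig, inner_smul_right]
      push_cast; ring
    have hb : |A.om j k - A.om i k'| * ‖inner ℂ (A.eig j k) (A.eig i k')‖ ≤ ‖A.L k - A.L k'‖ := by
      rw [← Real.norm_eq_abs, ← Complex.norm_real, ← norm_mul, e]
      refine (norm_inner_le_norm _ _).trans ?_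
      rw [norm_eig, one_mul]
      simpa [norm_eig] using (A.L k - A.L k').le_opNorm (A.eig i k')
    rw [projL_apply, norm_smul, norm_eig, mul_one, le_div_iff₀ hγ, mul_comm]
    exact (mul_le_mul_of_nonneg_right (hgap j hji) (norm_nonneg _)).trans hb
  refine (Finset.sum_le_card_nsmul _ _ _ h2).trans ?_
  rw [nsmul_eq_mul]
  have : 0 ≤ ‖A.L k - A.L k'‖ / γ := by positivity
  gcongr
  exact Finset.card_le_univ _

/-- The phases of eigenvectors are arbitrary, so the vectors themselves need not be close. The
difference of projections is expressed through the two defects `g - Π'g` and `g' - Πg'`, whose norms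
do not depend on these phases. -/
lemma norm_projL_sub_le (i : Fin J × ℤˣ) (k k' : Wave d) {e : ℝ}
    (h1 : ‖A.eig i k' - A.projL i k (A.eig i k')‖ ≤ e)
    (h2 : ‖A.eig i k - A.projL i k' (A.eig i k)‖ ≤ e) :
    ‖A.projL i k - A.projL i k'‖ ≤ 2 * e := by
  have he : 0 ≤ e := (norm_nonneg _).trans h1
  refine ContinuousLinearMap.opNorm_le_bound _ (by positivity) fun u => ?_
  have hd : (A.projL i k - A.projL i k') u
      = inner ℂ (A.eig i k) u • (A.eig i k - A.projL i k' (A.eig i k))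
        - inner ℂ (A.eig i k' - A.projL i k (A.eig i k')) u • A.eig i k' := by
    have : A.projL i k' (inner ℂ (A.eig i k) u • A.eig i k)
        = inner ℂ (A.projL i k (A.eig i k')) u • A.eig i k' := by
      rw [map_smul, projL_apply, projL_apply, inner_smul_left, smul_smul, inner_conj_symm,
        mul_comm (inner ℂ (A.eig i k) u)]
    rw [sub_apply, smul_sub, ← map_smul, this, inner_sub_left, sub_smul]
    simp only [projL_apply]
    abel
  rw [hd]
  have b1 : ‖inner ℂ (A.eig i k) u‖ ≤ ‖u‖ := by
    simpa [norm_eig] using norm_inner_le_norm (𝕜 := ℂ) (A.eig i k) u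
  have b2 : ‖inner ℂ (A.eig i k' - A.projL i k (A.eig i k')) u‖ ≤ e * ‖u‖ :=
    (norm_inner_le_norm _ _).trans (by gcongr)
  refine (norm_sub_le _ _).trans ?_
  rw [norm_smul, norm_smul, norm_eig, mul_one]
  have : ‖inner ℂ (A.eig i k) u‖ * ‖A.eig i k - A.projL i k' (A.eig i k)‖ ≤ ‖u‖ * e := by gcongr
  linarith

variable {A}

lemma Admissible.contDiffAt (hA : A.Admissible) {c : Wave d} (hc : c ∉ A.bandCrossing) :
    ContDiffAt ℝ ∞ A.L c :=
  hA.smooth.contDiffAt (hA.isClosed.isOpen_compl.mem_nhds hc)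

lemma Admissible.exists_lipschitz_near (hA : A.Admissible) {c : Wave d} (hc : c ∉ A.bandCrossing) :
    ∃ C > 0, ∃ ρ > 0, ∀ k k', ‖k - c‖ < ρ → ‖k' - c‖ < ρ →
      ‖A.L k - A.L k'‖ ≤ C * ‖k - k'‖ := by
  obtain ⟨K, t, ht, hK⟩ := ((hA.contDiffAt hc).of_le (m := 1)
    (by exact_mod_cast le_top)).exists_lipschitzOnWith
  obtain ⟨ρ, hρ, hb⟩ := Metric.mem_nhds_iff.1 ht
  refine ⟨K + 1, by positivity, ρ, hρ, fun k k' hk hk' => ?_⟩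
  have h1 := hK.norm_sub_le (hb (mem_ball_iff_norm.2 hk)) (hb (mem_ball_iff_norm.2 hk'))
  refine h1.trans ?_
  gcongr
  simp

/-- The derivative is frozen at the centre `c` and not taken at the base point `k`, since the group
velocities to be compared are those at the centres. The price is the term `‖k - c‖`; the bound is
the mean value inequality on the ball of radius `‖η‖ + ‖k - c‖`. -/
lemma Admissible.exists_second_order (hA : A.Admissible) {c : Wave d} (hc : c ∉ A.bandCrossing) :
    ∃ C > 0, ∃ ρ > 0, ∀ k η, ‖k - c‖ < ρ → ‖η‖ < ρ →
      ‖A.L (k + η) - A.L k - fderiv ℝ A.L c η‖ ≤ C * ‖η‖ * (‖η‖ + ‖k - c‖) := by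
  have h2 : ContDiffAt ℝ 2 A.L c := by
    exact_mod_cast contDiffAt_infty.1 (hA.contDiffAt hc) 2
  have h1 : ContDiffAt ℝ 1 (fderiv ℝ A.L) c := h2.fderiv_right (by norm_num)
  obtain ⟨K, t, ht, hK⟩ := h1.exists_lipschitzOnWith
  have hd : ∀ᶠ k in nhds c, DifferentiableAt ℝ A.L k := by
    filter_upwards [h2.eventually (by simp)] with k hk
    exact hk.differentiableAt (by norm_num)
  obtain ⟨ρ, hρ, hb⟩ := Metric.mem_nhds_iff.1 (Filter.inter_mem ht hd)
  refine ⟨K + 1, by positivity, ρ / 2, by positivity, fun k η hk hη => ?_⟩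
  have hsub : Metric.closedBall c (‖η‖ + ‖k - c‖) ⊆ Metric.ball c ρ :=
    Metric.closedBall_subset_ball (by linarith)
  have key := (convex_closedBall c (‖η‖ + ‖k - c‖)).norm_image_sub_le_of_norm_hasFDerivWithin_le'
    (f := A.L) (f' := fderiv ℝ A.L) (φ := fderiv ℝ A.L c) (x := k) (y := k + η)
    (C := K * (‖η‖ + ‖k - c‖))
    (fun x hx => ((hb (hsub hx)).2 : DifferentiableAt ℝ A.L x).hasFDerivAt.hasFDerivWithinAt)
    (fun x hx => (hK.norm_sub_le (hb (hsub hx)).1 (mem_of_mem_nhds ht)).trans (by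
      gcongr; exact mem_closedBall_iff_norm.1 hx))
    (mem_closedBall_iff_norm.2 (by linarith [norm_nonneg η]))
    (mem_closedBall_iff_norm.2 (by
      have := norm_add_le (k - c) η
      rw [add_sub_right_comm]; linarith))
  rw [add_sub_cancel_left] at key
  refine key.trans ?_
  have : 0 ≤ ‖η‖ * (‖η‖ + ‖k - c‖) := by positivity
  nlinarith

lemma Admissible.exists_perturbation (hA : A.Admissible) {c : Wave d} (hc : c ∉ A.bandCrossing) :
    ∃ C > 0, ∃ ρ > 0, ∀ k, ‖k - c‖ < ρ → ∀ i,
      ‖A.eig i c - A.projL i k (A.eig i c)‖ ≤ C * ‖k - c‖ ∧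
      ‖A.projL i k - A.projL i c‖ ≤ C * ‖k - c‖ ∧ |A.om i k - A.om i c| ≤ C * ‖k - c‖ := by
  obtain ⟨K, hK, ρ, hρ, hL⟩ := hA.exists_lipschitz_near hc
  have hgap : ∃ γ : ℝ, 0 < γ ∧ ∀ i j, i ≠ j → γ ≤ |A.om i c - A.om j c| := by
    -- Every small enough `γ > 0` is a lower bound for the finitely many gaps; this form also covers
    -- the case without any pair of branches.
    have : ∀ᶠ γ : ℝ in nhdsWithin 0 (Ioi 0), ∀ i j, i ≠ j → γ ≤ |A.om i c - A.om j c| := by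
      refine Filter.eventually_all.2 fun i => Filter.eventually_all.2 fun j => ?_
      by_cases hij : i = j
      · exact Filter.Eventually.of_forall fun _ h => absurd hij h
      · have : 0 < |A.om i c - A.om j c| := abs_pos.2 (sub_ne_zero.2 (om_injective hA hc hij))
        filter_upwards [Ioo_mem_nhdsGT this] with γ hγ _ using hγ.2.le
    obtain ⟨γ, h1, h2⟩ := (this.and self_mem_nhdsWithin).exists
    exact ⟨γ, h2, h1⟩
  obtain ⟨γ, hγ, hgap⟩ := hgap
  set N : ℝ := (Fintype.card (Fin J × ℤˣ) : ℝ) with hN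
  have hN0 : 0 ≤ N := Nat.cast_nonneg _
  -- The radius `γ/(2K)` makes `‖L(k) - L(c)‖ ≤ γ/2`, so by Weyl's inequality half of the gap at `c`
  -- survives at `k`.
  refine ⟨2 * (N * (K / (γ / 2))) + K, by positivity, min ρ (γ / (2 * K)), by positivity,
    fun k hk i => ?_⟩
  have hk1 : ‖k - c‖ < ρ := hk.trans_le (min_le_left _ _)
  have hk2 : ‖k - c‖ < γ / (2 * K) := hk.trans_le (min_le_right _ _)
  have hLk : ‖A.L k - A.L c‖ ≤ K * ‖k - c‖ := hL k c hk1 (by simpa using hρ)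
  have hsmall : ‖A.L k - A.L c‖ ≤ γ / 2 := by
    refine hLk.trans ?_
    rw [lt_div_iff₀ (by positivity)] at hk2
    linarith
  have g1 : ∀ j, j ≠ i → γ / 2 ≤ |A.om j k - A.om i c| := fun j hj => by
    have h1 := hgap j i hj
    have h2 := A.abs_om_sub_le j k c
    have h3 := abs_sub_abs_le_abs_sub (A.om j c - A.om i c) (A.om j c - A.om j k)
    rw [sub_sub_sub_cancel_left, abs_sub_comm (A.om j c) (A.om j k)] at h3
    linarith
  have g2 : ∀ j, j ≠ i → γ / 2 ≤ |A.om j c - A.om i k| := fun j hj => by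
    have h1 := hgap j i hj
    have h2 := A.abs_om_sub_le i k c
    have h3 := abs_sub_abs_le_abs_sub (A.om j c - A.om i c) (A.om i k - A.om i c)
    rw [sub_sub_sub_cancel_right] at h3
    linarith
  have e1 := A.norm_eig_sub_projL_le i k c (by positivity) g1
  have e2 := A.norm_eig_sub_projL_le i c k (by positivity) g2
  have hb : N * (‖A.L k - A.L c‖ / (γ / 2)) ≤ N * (K / (γ / 2)) * ‖k - c‖ := by
    rw [mul_assoc, div_mul_eq_mul_div]
    gcongr
  have e1' := e1.trans hb
  have e2' := (norm_sub_rev (A.L c) (A.L k) ▸ e2).trans hb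
  have hnn : 0 ≤ N * (K / (γ / 2)) * ‖k - c‖ := by positivity
  have hnn' : 0 ≤ K * ‖k - c‖ := by positivity
  refine ⟨by nlinarith, ?_, ?_⟩
  · have := A.norm_projL_sub_le i k c e1' e2'
    nlinarith
  · have := A.abs_om_sub_le i k c
    nlinarith

/-- A Hellmann–Feynman argument: the increment of the eigenvalue is the increment of `L` tested on
the fixed eigenvector `g` at `c`, up to the defects of `g` at `k` and `k + η`. Smoothness of the
eigenvalue is not presupposed. -/
lemma Admissible.exists_om_expansion (hA : A.Admissible) {c : Wave d} (hc : c ∉ A.bandCrossing)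
    (i : Fin J × ℤˣ) :
    ∃ C > 0, ∃ ρ > 0, ∀ k η, ‖k - c‖ < ρ → ‖η‖ < ρ →
      |A.om i (k + η) - A.om i k - inner ℝ (gradient (A.om i) c) η|
        ≤ C * ‖η‖ * (‖η‖ + ‖k - c‖) := by
  obtain ⟨K₁, hK₁, ρ₁, hρ₁, h1⟩ := hA.exists_lipschitz_near hc
  obtain ⟨K₂, hK₂, ρ₂, hρ₂, h2⟩ := hA.exists_second_order hc
  obtain ⟨K₃, hK₃, ρ₃, hρ₃, h3⟩ := hA.exists_perturbation hc
  set g := A.eig i c with hg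
  have hg1 : ‖g‖ = 1 := A.norm_eig i c
  let ev : (Val J →L[ℂ] Val J) →L[ℝ] ℝ :=
    Complex.reCLM.comp (((innerSL ℂ g).restrictScalars ℝ).comp
      ((ContinuousLinearMap.apply ℂ (Val J) g).restrictScalars ℝ))
  have hev : ∀ X, ev X = (inner ℂ g (X g) : ℂ).re := fun X => rfl
  let ℓ : Wave d →L[ℝ] ℝ := ev.comp (fderiv ℝ A.L c)
  set C := 4 * K₁ * K₃ + K₂ with hC
  set ρ := min ρ₁ (min ρ₂ ρ₃) / 2 with hρ
  have hρ0 : 0 < ρ := by positivity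
  have main : ∀ k η, ‖k - c‖ < ρ → ‖η‖ < ρ →
      |A.om i (k + η) - A.om i k - ℓ η| ≤ C * ‖η‖ * (‖η‖ + ‖k - c‖) := by
    intro k η hk hη
    have hmin : 2 * ρ = min ρ₁ (min ρ₂ ρ₃) := by rw [hρ]; ring
    have m1 : 2 * ρ ≤ ρ₁ := hmin.trans_le (min_le_left _ _)
    have m2 : 2 * ρ ≤ ρ₂ := hmin.trans_le ((min_le_right _ _).trans (min_le_left _ _))
    have m3 : 2 * ρ ≤ ρ₃ := hmin.trans_le ((min_le_right _ _).trans (min_le_right _ _))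
    have hk' : ‖k + η - c‖ ≤ ‖k - c‖ + ‖η‖ := by
      rw [add_sub_right_comm]; exact norm_add_le _ _
    have hL : ‖A.L (k + η) - A.L k‖ ≤ K₁ * ‖η‖ := by
      have := h1 (k + η) k (by linarith) (by linarith)
      rwa [add_sub_cancel_left] at this
    have hL2 := h2 k η (by linarith) (by linarith)
    obtain ⟨a1, -, -⟩ := h3 (k + η) (by linarith) i
    obtain ⟨b1, -, -⟩ := h3 k (by linarith) i
    rw [← hg] at a1 b1
    set u := A.projL i (k + η) g with hu
    set w := A.projL i k g with hw
    set D := A.L (k + η) - A.L k with hD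
    set Δ := A.om i (k + η) - A.om i k with hΔ
    have hΔb : |Δ| ≤ K₁ * ‖η‖ := (A.abs_om_sub_le i (k + η) k).trans hL
    have hu1 : ‖u‖ ≤ 1 := (A.norm_projL_apply_le _ _ _).trans hg1.le
    have hw1 : ‖w‖ ≤ 1 := (A.norm_projL_apply_le _ _ _).trans hg1.le
    -- `u` and `w` are eigenvectors (or zero) at `k + η` and `k`, so the identity holds exactly.
    -- Replacing both by `g` costs products of `O(‖η‖)` and `O(‖η‖ + ‖k - c‖)`.
    have e0 : (Δ : ℂ) * inner ℂ u w = inner ℂ u (D w) := by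
      rw [hD, sub_apply, inner_sub_right, ← inner_L, hu, hw, projL_apply, projL_apply, map_smul,
        map_smul, L_eig, L_eig, smul_comm _ (A.om i (k + η) : ℂ), smul_comm _ (A.om i k : ℂ),
        inner_smul_left _ _ (A.om i (k + η) : ℂ), inner_smul_right _ _ (A.om i k : ℂ),
        Complex.conj_ofReal, hΔ]
      push_cast; ring
    have e1 : (Δ : ℂ) - inner ℂ g (fderiv ℝ A.L c η g)
        = (Δ : ℂ) * (inner ℂ (g - u) g + inner ℂ u (g - w)) - inner ℂ (g - u) (D w)
          - inner ℂ g (D (g - w)) + inner ℂ g ((D - fderiv ℝ A.L c η) g) := by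
      have hgg : inner ℂ g g = (1 : ℂ) := by
        rw [inner_self_eq_norm_sq_to_K, hg1]; simp
      simp only [inner_sub_left, inner_sub_right, sub_apply, map_sub, hgg]
      rw [← e0]; ring
    have bnd : ‖(Δ : ℂ) - inner ℂ g (fderiv ℝ A.L c η g)‖
        ≤ K₁ * ‖η‖ * (‖g - u‖ + ‖g - w‖) + ‖g - u‖ * (K₁ * ‖η‖) + K₁ * ‖η‖ * ‖g - w‖
          + K₂ * ‖η‖ * (‖η‖ + ‖k - c‖) := by
      rw [e1]
      refine (norm_add_le _ _).trans (add_le_add ((norm_sub_le _ _).trans (add_le_add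
        ((norm_sub_le _ _).trans (add_le_add ?_ ?_)) ?_)) ?_)
      · rw [norm_mul, Complex.norm_real, Real.norm_eq_abs]
        refine mul_le_mul hΔb ((norm_add_le _ _).trans (add_le_add ?_ ?_)) (norm_nonneg _)
          (by positivity)
        · exact (norm_inner_le_norm (𝕜 := ℂ) (g - u) g).trans (by rw [hg1, mul_one])
        · refine (norm_inner_le_norm _ _).trans ?_
          exact mul_le_of_le_one_left (norm_nonneg _) hu1
      · refine (norm_inner_le_norm _ _).trans ?_
        gcongr
        exact ((D.le_opNorm _).trans (mul_le_of_le_one_right (norm_nonneg _) hw1)).trans hL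
      · refine (norm_inner_le_norm _ _).trans ?_
        rw [hg1, one_mul]
        exact (D.le_opNorm _).trans (by gcongr)
      · refine (norm_inner_le_norm _ _).trans ?_
        rw [hg1, one_mul]
        refine ((D - fderiv ℝ A.L c η).le_opNorm _).trans ?_
        rwa [hg1, mul_one]
    have hre : |Δ - ℓ η| ≤ ‖(Δ : ℂ) - inner ℂ g (fderiv ℝ A.L c η g)‖ := by
      refine le_trans (le_of_eq ?_) (Complex.abs_re_le_norm _)
      simp [ℓ, hev]
    refine hre.trans (bnd.trans ?_)
    have ha : ‖g - u‖ ≤ K₃ * (‖η‖ + ‖k - c‖) := a1.trans (by gcongr; linarith)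
    have hb : ‖g - w‖ ≤ K₃ * (‖η‖ + ‖k - c‖) := b1.trans (by gcongr; linarith [norm_nonneg η])
    calc _ ≤ K₁ * ‖η‖ * (K₃ * (‖η‖ + ‖k - c‖) + K₃ * (‖η‖ + ‖k - c‖))
          + K₃ * (‖η‖ + ‖k - c‖) * (K₁ * ‖η‖) + K₁ * ‖η‖ * (K₃ * (‖η‖ + ‖k - c‖))
          + K₂ * ‖η‖ * (‖η‖ + ‖k - c‖) := by gcongr
      _ = _ := by rw [hC]; ring
  have hC0 : 0 < C := by positivity
  -- At `k = c` the error is quadratic in `η`, so the expansion itself proves differentiability and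
  -- identifies `ℓ` with the gradient.
  have hder : HasFDerivAt (A.om i) ℓ c := by
    rw [hasFDerivAt_iff_isLittleO_nhds_zero]
    have hO : (fun η => A.om i (c + η) - A.om i c - ℓ η) =O[nhds 0] fun η => ‖η‖ ^ 2 := by
      refine Asymptotics.IsBigO.of_bound C ?_
      filter_upwards [Metric.ball_mem_nhds (0 : Wave d) hρ0] with η hη
      have := main c η (by simpa using hρ0) (by simpa using hη)
      simp only [sub_self, norm_zero, add_zero] at this
      rw [Real.norm_eq_abs, norm_pow, norm_norm]
      linarith
    refine hO.trans_isLittleO ?_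
    simpa using (Asymptotics.isLittleO_norm_pow_id (E' := Wave d) (n := 2) (by norm_num))
  refine ⟨C, hC0, ρ, hρ0, fun k η hk hη => ?_⟩
  have hgrad : inner ℝ (gradient (A.om i) c) η = ℓ η := by
    rw [gradient, InnerProductSpace.toDual_symm_apply, hder.fderiv]
  rw [hgrad]
  exact main k η hk hη

end LinearPart

/-! ### Spectral form of the propagator, and measurability off the band-crossing set. -/

namespace LinearPart
variable {d J : ℕ} (A : LinearPart d J)

lemma exp_smul_L_eig (z : ℂ) (i : Fin J × ℤˣ) (k : Wave d) :
    NormedSpace.exp (z • A.L k) (A.eig i k) = Complex.exp (z * A.om i k) • A.eig i k := by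
  have hpow : ∀ n : ℕ, ((z • A.L k) ^ n) (A.eig i k) = (z * A.om i k) ^ n • A.eig i k := by
    intro n
    induction n with
    | zero => simp
    | succ n ih =>
      rw [pow_succ, mul_apply_eq_comp, smul_apply, L_eig, smul_smul, map_smul, ih,
        smul_smul, pow_succ, mul_comm (z * (A.om i k : ℂ))]
  have h1 := (NormedSpace.exp_series_hasSum_exp' (𝕂 := ℂ) (z • A.L k)).mapL
    (ContinuousLinearMap.apply ℂ (Val J) (A.eig i k))
  have h2 := (NormedSpace.exp_series_hasSum_exp' (𝕂 := ℂ) (z * A.om i k)).smul_const (A.eig i k)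
  have h3 : (fun n : ℕ => (ContinuousLinearMap.apply ℂ (Val J) (A.eig i k))
        ((n.factorial : ℂ)⁻¹ • (z • A.L k) ^ n))
      = fun n : ℕ => ((n.factorial : ℂ)⁻¹ • (z * A.om i k) ^ n) • A.eig i k := by
    funext n
    simp [hpow, smul_smul]
  rw [h3] at h1
  rw [Complex.exp_eq_exp_ℂ]
  exact h1.unique h2

lemma propagator_apply (ϱ t : ℝ) (k : Wave d) (u : Val J) :
    A.propagator ϱ t k u
      = ∑ i, Complex.exp (((t / ϱ * A.om i k : ℝ) : ℂ) * Complex.I) • A.projL i k u := by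
  conv_lhs => rw [← A.sum_projL k u]
  rw [map_sum]
  refine Finset.sum_congr rfl fun i _ => ?_
  have h : Complex.I * ((t / ϱ : ℝ) : ℂ) * (A.om i k : ℂ)
      = ((t / ϱ * A.om i k : ℝ) : ℂ) * Complex.I := by push_cast; ring
  rw [projL_apply, map_smul, propagator, exp_smul_L_eig, smul_comm, h]

lemma norm_sq_eq_sum_projL (k : Wave d) (u : Val J) : ‖u‖ ^ 2 = ∑ i, ‖A.projL i k u‖ ^ 2 := by
  rw [← A.sum_sq_inner k u]
  simp [projL_apply, norm_smul, norm_eig]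

lemma norm_sum_smul_projL (k : Wave d) (u : Val J) (z : Fin J × ℤˣ → ℂ) :
    ‖∑ i, z i • A.projL i k u‖ ^ 2 = ∑ i, ‖z i‖ ^ 2 * ‖A.projL i k u‖ ^ 2 := by
  rw [A.norm_sq_eq_sum_projL k]
  refine Finset.sum_congr rfl fun i _ => ?_
  have : A.projL i k (∑ j, z j • A.projL j k u) = z i • A.projL i k u := by
    rw [map_sum, Finset.sum_eq_single i]
    · rw [map_smul, projL_projL, if_pos rfl]
    · intro j _ hj
      rw [map_smul, projL_projL, if_neg hj.symm, smul_zero]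
    · simp
  rw [this, norm_smul, mul_pow]

lemma norm_propagator_apply (ϱ t : ℝ) (k : Wave d) (u : Val J) :
    ‖A.propagator ϱ t k u‖ = ‖u‖ := by
  rw [← sq_eq_sq₀ (norm_nonneg _) (norm_nonneg _), propagator_apply, norm_sum_smul_projL,
    A.norm_sq_eq_sum_projL k]
  simp only [Complex.norm_exp_ofReal_mul_I, one_pow, one_mul]

variable {A}

/-- Nothing is known about the spectral data on `σ_bc`. As this set is closed and null, continuity
at all other points is enough. -/
lemma Admissible.aestronglyMeasurable {E : Type*} [TopologicalSpace E]
    [TopologicalSpace.PseudoMetrizableSpace E] (hA : A.Admissible)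
    {f : Wave d → E} (hf : ∀ c ∉ A.bandCrossing, ContinuousAt f c) :
    AEStronglyMeasurable f volume := by
  have h1 : ContinuousOn f A.bandCrossingᶜ := fun c hc => (hf c hc).continuousWithinAt
  have h2 := h1.aestronglyMeasurable (μ := volume) hA.isClosed.isOpen_compl.measurableSet
  have h3 : (volume : Measure (Wave d)).restrict A.bandCrossingᶜ = volume := by
    rw [Measure.restrict_eq_self_of_ae_mem]
    exact measure_eq_zero_iff_ae_notMem.1 hA.null
  rwa [h3] at h2

lemma Admissible.ae_notMem (hA : A.Admissible) : ∀ᵐ k : Wave d, k ∉ A.bandCrossing :=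
  measure_eq_zero_iff_ae_notMem.1 hA.null

lemma continuousAt_of_norm_sub_le {E F : Type*} [SeminormedAddCommGroup E]
    [SeminormedAddCommGroup F] {f : E → F} {c : E} {C ρ : ℝ} (hρ : 0 < ρ)
    (h : ∀ k, ‖k - c‖ < ρ → ‖f k - f c‖ ≤ C * ‖k - c‖) : ContinuousAt f c := by
  rw [ContinuousAt, tendsto_iff_norm_sub_tendsto_zero]
  have h0 : Filter.Tendsto (fun k => C * ‖k - c‖) (nhds c) (nhds 0) := by
    have : Continuous fun k => C * ‖k - c‖ := by fun_prop
    simpa using this.tendsto c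
  refine squeeze_zero' (Filter.Eventually.of_forall fun _ => norm_nonneg _) ?_ h0
  filter_upwards [Metric.ball_mem_nhds c hρ] with k hk
  exact h k (mem_ball_iff_norm.1 hk)

lemma Admissible.continuousAt_om (hA : A.Admissible) (i : Fin J × ℤˣ) {c : Wave d}
    (hc : c ∉ A.bandCrossing) : ContinuousAt (A.om i) c := by
  obtain ⟨C, -, ρ, hρ, h⟩ := hA.exists_perturbation hc
  exact continuousAt_of_norm_sub_le hρ fun k hk => (h k hk i).2.2

lemma Admissible.continuousAt_projL (hA : A.Admissible) (i : Fin J × ℤˣ) {c : Wave d}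
    (hc : c ∉ A.bandCrossing) : ContinuousAt (A.projL i) c := by
  obtain ⟨C, -, ρ, hρ, h⟩ := hA.exists_perturbation hc
  exact continuousAt_of_norm_sub_le hρ fun k hk => (h k hk i).2.1

lemma Admissible.aestronglyMeasurable_om (hA : A.Admissible) (i : Fin J × ℤˣ) :
    AEStronglyMeasurable (A.om i) volume :=
  hA.aestronglyMeasurable fun _ hc => hA.continuousAt_om i hc

lemma Admissible.aestronglyMeasurable_projL (hA : A.Admissible) (i : Fin J × ℤˣ) :
    AEStronglyMeasurable (A.projL i) volume :=
  hA.aestronglyMeasurable fun _ hc => hA.continuousAt_projL i hc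

end LinearPart

/-! ### Pointwise multipliers on `L¹` -/

section Multipliers

variable {d J : ℕ}

/-- A multiplier of norm at most one. -/
structure IsMult (M : Wave d → Val J →L[ℂ] Val J) : Prop where
  aesm : AEStronglyMeasurable M volume
  bound : ∀ᵐ k, ‖M k‖ ≤ 1

lemma IsMult.integrable {M : Wave d → Val J →L[ℂ] Val J} (hM : IsMult M) (f : L1 d J) :
    Integrable (fun k => M k (f k)) volume := by
  have hf := L1.integrable_coeFn f
  refine hf.norm.mono' ?_ ?_
  · exact (continuous_fst.clm_apply continuous_snd).comp_aestronglyMeasurable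
      (hM.aesm.prodMk hf.aestronglyMeasurable)
  · filter_upwards [hM.bound] with k hk
    exact ((M k).le_opNorm _).trans (mul_le_of_le_one_left (norm_nonneg _) hk)

open Classical in
/-- The operator of pointwise multiplication by `M`. -/
def mulOp (M : Wave d → Val J →L[ℂ] Val J) : L1 d J →L[ℂ] L1 d J :=
  if hM : IsMult M then
    LinearMap.mkContinuous
      { toFun := fun f => (hM.integrable f).toL1 _
        map_add' := fun f g => by
          rw [← Integrable.toL1_add, Integrable.toL1_eq_toL1_iff]
          filter_upwards [Lp.coeFn_add f g] with k hk
          rw [hk, Pi.add_apply, map_add, Pi.add_apply]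
        map_smul' := fun c f => by
          rw [RingHom.id_apply, ← Integrable.toL1_smul', Integrable.toL1_eq_toL1_iff]
          filter_upwards [Lp.coeFn_smul c f] with k hk
          rw [hk, Pi.smul_apply, map_smul, Pi.smul_apply] } 1 (fun f => by
        rw [one_mul, LinearMap.coe_mk, AddHom.coe_mk, L1.norm_of_fun_eq_integral_norm,
          L1.norm_eq_integral_norm]
        refine integral_mono_ae (hM.integrable f).norm (L1.integrable_coeFn f).norm ?_
        filter_upwards [hM.bound] with k hk
        exact ((M k).le_opNorm _).trans (mul_le_of_le_one_left (norm_nonneg _) hk))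
  else 0

lemma mulOp_coeFn {M : Wave d → Val J →L[ℂ] Val J} (hM : IsMult M) (f : L1 d J) :
    mulOp M f =ᵐ[volume] fun k => M k (f k) := by
  rw [mulOp, dif_pos hM]
  exact (hM.integrable f).coeFn_toL1

lemma norm_mulOp_apply_le (M : Wave d → Val J →L[ℂ] Val J) (f : L1 d J) :
    ‖mulOp M f‖ ≤ ‖f‖ := by
  by_cases hM : IsMult M
  · rw [L1.norm_eq_integral_norm, L1.norm_eq_integral_norm]
    refine integral_mono_ae (L1.integrable_coeFn _).norm (L1.integrable_coeFn f).norm ?_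
    filter_upwards [hM.bound, mulOp_coeFn hM f] with k hk hk'
    simp only [hk']
    exact ((M k).le_opNorm _).trans (mul_le_of_le_one_left (norm_nonneg _) hk)
  · simp [mulOp, hM]

lemma norm_mulOp_apply {M : Wave d → Val J →L[ℂ] Val J} (hM : IsMult M) (f : L1 d J) :
    ‖mulOp M f‖ = ∫ k, ‖M k (f k)‖ := by
  rw [L1.norm_eq_integral_norm]
  refine integral_congr_ae ?_
  filter_upwards [mulOp_coeFn hM f] with k hk
  rw [hk]

/-- The multiplier `e^{iθ}`. -/
def phase (θ : Wave d → ℝ) (k : Wave d) : Val J →L[ℂ] Val J :=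
  Complex.exp ((θ k : ℂ) * Complex.I) • ContinuousLinearMap.id ℂ (Val J)

@[simp] lemma phase_apply (θ : Wave d → ℝ) (k : Wave d) (u : Val J) :
    phase θ k u = Complex.exp ((θ k : ℂ) * Complex.I) • u := rfl

lemma isMult_of_norm_apply_le {M : Wave d → Val J →L[ℂ] Val J}
    (h : AEStronglyMeasurable M volume) (hb : ∀ k u, ‖M k u‖ ≤ ‖u‖) : IsMult M :=
  ⟨h, Filter.Eventually.of_forall fun k =>
    ContinuousLinearMap.opNorm_le_bound _ zero_le_one fun u => by simpa using hb k u⟩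

lemma norm_phase_apply (θ : Wave d → ℝ) (k : Wave d) (u : Val J) : ‖phase θ k u‖ = ‖u‖ := by
  rw [phase_apply, norm_smul, Complex.norm_exp_ofReal_mul_I, one_mul]

lemma isMult_phase {θ : Wave d → ℝ} (hθ : AEStronglyMeasurable θ volume) :
    IsMult (phase θ : Wave d → Val J →L[ℂ] Val J) := by
  refine isMult_of_norm_apply_le ?_ fun k u => (norm_phase_apply θ k u).le
  have : Continuous fun x : ℝ =>
      Complex.exp ((x : ℂ) * Complex.I) • ContinuousLinearMap.id ℂ (Val J) := by fun_prop
  exact this.comp_aestronglyMeasurable hθ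

lemma isMult_projL {A : LinearPart d J} (hA : A.Admissible) (i : Fin J × ℤˣ) :
    IsMult (A.projL i) :=
  isMult_of_norm_apply_le (hA.aestronglyMeasurable_projL i) fun k u => A.norm_projL_apply_le i k u

lemma LinearPart.propagator_eq (A : LinearPart d J) (ϱ t : ℝ) (k : Wave d) :
    A.propagator ϱ t k
      = ∑ i, Complex.exp (((t / ϱ * A.om i k : ℝ) : ℂ) * Complex.I) • A.projL i k := by
  ext1 u
  rw [A.propagator_apply]
  simp

lemma isMult_propagator {A : LinearPart d J} (hA : A.Admissible) (ϱ t : ℝ) :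
    IsMult (A.propagator ϱ t) := by
  refine isMult_of_norm_apply_le (hA.aestronglyMeasurable fun c hc => ?_)
    fun k u => (A.norm_propagator_apply ϱ t k u).le
  simp_rw [funext (A.propagator_eq ϱ t)]
  refine tendsto_finsetSum _ fun i _ => ?_
  have h1 := hA.continuousAt_om i hc
  have h2 := hA.continuousAt_projL i hc
  have h3 : Continuous fun p : ℝ × (Val J →L[ℂ] Val J) =>
      Complex.exp (((t / ϱ * p.1 : ℝ) : ℂ) * Complex.I) • p.2 := by fun_prop
  exact h3.continuousAt.comp (f := fun k => (A.om i k, A.projL i k)) (h1.prodMk h2)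

lemma norm_mulOp_of_isometry {M : Wave d → Val J →L[ℂ] Val J} (hM : IsMult M)
    (h : ∀ k u, ‖M k u‖ = ‖u‖) (f : L1 d J) : ‖mulOp M f‖ = ‖f‖ := by
  rw [norm_mulOp_apply hM, L1.norm_eq_integral_norm]
  simp [h]

/-- Strong continuity of a family of multipliers. -/
lemma continuous_mulOp {T : Type*} [TopologicalSpace T] [FirstCountableTopology T]
    {M : T → Wave d → Val J →L[ℂ] Val J} (hM : ∀ t, IsMult (M t))
    (hc : ∀ᵐ k, Continuous fun t => M t k) (f : L1 d J) : Continuous fun t => mulOp (M t) f := by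
  rw [continuous_iff_continuousAt]
  intro t₀
  rw [ContinuousAt, tendsto_iff_norm_sub_tendsto_zero]
  have h1 : ∀ t, ‖mulOp (M t) f - mulOp (M t₀) f‖ = ∫ k, ‖M t k (f k) - M t₀ k (f k)‖ := by
    intro t
    rw [L1.norm_eq_integral_norm]
    refine integral_congr_ae ?_
    filter_upwards [Lp.coeFn_sub (mulOp (M t) f) (mulOp (M t₀) f), mulOp_coeFn (hM t) f,
      mulOp_coeFn (hM t₀) f] with k h1 h2 h3
    rw [h1, Pi.sub_apply, h2, h3]
  simp_rw [h1]
  have h0 : (0 : ℝ) = ∫ _ : Wave d, (0 : ℝ) := by simp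
  rw [h0]
  -- Norm continuity in `t` can fail when the frequencies are unbounded, so continuity is obtained
  -- vector by vector, with `2‖f‖` as majorant.
  refine tendsto_integral_filter_of_dominated_convergence (fun k => 2 * ‖f k‖) ?_ ?_ ?_ ?_
  · refine Filter.Eventually.of_forall fun t => ?_
    exact (((hM t).integrable f).sub ((hM t₀).integrable f)).norm.aestronglyMeasurable
  · refine Filter.Eventually.of_forall fun t => ?_
    filter_upwards [(hM t).bound, (hM t₀).bound] with k h2 h3
    rw [norm_norm, two_mul ‖f k‖]
    refine (norm_sub_le _ _).trans (add_le_add ?_ ?_)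
    · exact ((M t k).le_opNorm _).trans (mul_le_of_le_one_left (norm_nonneg _) h2)
    · exact ((M t₀ k).le_opNorm _).trans (mul_le_of_le_one_left (norm_nonneg _) h3)
  · exact (L1.integrable_coeFn f).norm.const_mul 2
  · filter_upwards [hc] with k hk
    have : Continuous fun t => ‖M t k (f k) - M t₀ k (f k)‖ := by fun_prop
    simpa using this.tendsto t₀

/-- Joint continuity. -/
lemma continuousOn_mulOp_apply {T : Type*} [TopologicalSpace T] [FirstCountableTopology T]
    {M : T → Wave d → Val J →L[ℂ] Val J} (hM : ∀ t, IsMult (M t))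
    (hc : ∀ᵐ k, Continuous fun t => M t k) {s : Set T} {u : T → L1 d J} (hu : ContinuousOn u s) :
    ContinuousOn (fun t => mulOp (M t) (u t)) s := by
  intro t₀ ht₀
  have h1 : Filter.Tendsto (fun t => mulOp (M t) (u t - u t₀)) (nhdsWithin t₀ s) (nhds 0) := by
    refine squeeze_zero_norm (fun t => norm_mulOp_apply_le _ _) ?_
    exact tendsto_iff_norm_sub_tendsto_zero.1 (hu t₀ ht₀)
  have h2 := (((continuous_mulOp hM hc (u t₀)).tendsto t₀).mono_left
    (nhdsWithin_le_nhds (s := s)))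
  refine (h1.add h2).congr' ?_ |>.trans (by rw [zero_add])
  exact Filter.Eventually.of_forall fun t => by simp

end Multipliers

/-! ### Fibre integrals over `κ_1 + … + κ_m = k`. -/

section Convolution

variable {d J m : ℕ}

lemma sum_convString (hm : 0 < m) (k : Wave d) (q : Fin (m - 1) → Wave d) :
    ∑ j, convString m k q j = k := by
  obtain ⟨M, rfl⟩ : ∃ M, m = M + 1 := ⟨m - 1, by omega⟩
  rw [Fin.sum_univ_castSucc]
  simp only [convString, Fin.val_castSucc, Fin.val_last, Nat.add_sub_cancel, lt_irrefl, dif_neg,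
    not_false_eq_true, Fin.is_lt, dif_pos]
  exact add_sub_cancel _ _

lemma convString_add (hm : 0 < m) (k : Wave d) (q : Fin (m - 1) → Wave d) (y : Fin m → Wave d) :
    (fun j => convString m k q j + y j)
      = convString m (k + ∑ j, y j) (fun i => q i + y ⟨i, by omega⟩) := by
  obtain ⟨M, rfl⟩ : ∃ M, m = M + 1 := ⟨m - 1, by omega⟩
  funext j
  simp only [convString]
  split_ifs with h
  · rfl
  · have hj : j = Fin.last M := by
      apply Fin.ext; simp only [Fin.val_last]; have := j.2; simp at h; omega
    subst hj
    rw [Fin.sum_univ_castSucc, Finset.sum_add_distrib]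
    have : ∑ i : Fin M, y i.castSucc = ∑ i : Fin (M + 1 - 1), y ⟨i, by omega⟩ := rfl
    rw [this]
    abel

/-- A shear of unit Jacobian followed by insertion of the last coordinate. Through it Fubini turns
an integral over all `m` arguments into one over the output `k` and the free variables, which is the
source of the `L¹` bounds. -/
lemma measurePreserving_convString (hm : 0 < m) :
    MeasurePreserving (fun p : Wave d × (Fin (m - 1) → Wave d) => convString m p.1 p.2)
      volume volume := by
  obtain ⟨M, rfl⟩ : ∃ M, m = M + 1 := ⟨m - 1, by omega⟩
  change MeasurePreserving (fun p : Wave d × (Fin M → Wave d) => convString (M + 1) p.1 p.2)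
      volume volume
  have h1 : MeasurePreserving (fun p : (Fin M → Wave d) × Wave d => (p.1, p.2 - ∑ i, p.1 i))
      (volume.prod volume) (volume.prod volume) := by
    refine (MeasurePreserving.id volume).skew_product
      (g := fun (q : Fin M → Wave d) (k : Wave d) => k - ∑ i, q i) ?_ ?_
    · exact measurable_snd.sub (Finset.measurable_sum _ fun i _ =>
        (measurable_pi_apply i).comp measurable_fst)
    · exact Filter.Eventually.of_forall fun q => (measurePreserving_sub_right volume _).map_eq
  have h2 := ((volume_preserving_piFinSuccAbove (fun _ : Fin (M + 1) => Wave d)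
    (Fin.last M)).symm).comp ((Measure.measurePreserving_swap).comp
      (h1.comp (Measure.measurePreserving_swap (μ := (volume : Measure (Wave d)))
        (ν := (volume : Measure (Fin M → Wave d))))))
  refine (iff_of_eq ?_).1 h2
  congr 1
  funext p j
  simp only [Function.comp, Prod.swap, MeasurableEquiv.piFinSuccAbove_symm_apply,
    Fin.insertNthEquiv, Equiv.coe_fn_mk, convString, Nat.add_sub_cancel]
  refine Fin.lastCases ?_ (fun i => ?_) j
  · simp
  · simp

/-- In the coordinates `(k, q)` the preimage of `s` is `s × univ`. Hence almost every tuple has its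
sum, and not only its entries, off a given null set. -/
lemma quasiMeasurePreserving_sum (hm : 0 < m) :
    Measure.QuasiMeasurePreserving (fun κ : Fin m → Wave d => ∑ j, κ j) volume volume := by
  have hmeas : Measurable (fun κ : Fin m → Wave d => ∑ j, κ j) :=
    Finset.measurable_sum _ fun i _ => measurable_pi_apply i
  refine ⟨hmeas, Measure.AbsolutelyContinuous.mk fun s hs hs0 => ?_⟩
  rw [Measure.map_apply hmeas hs,
    ← (measurePreserving_convString hm).measure_preimage (hmeas hs).nullMeasurableSet]
  have : (fun p : Wave d × (Fin (m - 1) → Wave d) => convString m p.1 p.2) ⁻¹'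
      ((fun κ : Fin m → Wave d => ∑ j, κ j) ⁻¹' s) = s ×ˢ univ := by
    ext p
    simp only [mem_preimage, sum_convString hm, mem_prod, mem_univ, and_true]
  rw [this, Measure.volume_eq_prod, Measure.prod_prod, hs0, zero_mul]

lemma ae_eval {P : Wave d → Prop} (h : ∀ᵐ k, P k) (j : Fin m) :
    ∀ᵐ κ : Fin m → Wave d, P (κ j) :=
  (Measure.quasiMeasurePreserving_eval (fun _ : Fin m => (volume : Measure (Wave d))) j).ae h

lemma ae_eval_all {P : Fin m → Wave d → Prop} (h : ∀ j, ∀ᵐ k, P j k) :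
    ∀ᵐ κ : Fin m → Wave d, ∀ j, P j (κ j) :=
  ae_all_iff.2 fun j => ae_eval (h j) j

lemma ae_sum (hm : 0 < m) {P : Wave d → Prop} (h : ∀ᵐ k, P k) :
    ∀ᵐ κ : Fin m → Wave d, P (∑ j, κ j) :=
  (quasiMeasurePreserving_sum hm).ae h

/-- The fibre integral of `E` over `{κ : κ_1 + … + κ_m = k}`. -/
def fiberInt (m : ℕ) (E : (Fin m → Wave d) → Val J) (k : Wave d) : Val J :=
  ∫ q : Fin (m - 1) → Wave d, E (convString m k q)

lemma integrable_comp_convString (hm : 0 < m) {F : Type*} [NormedAddCommGroup F]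
    {E : (Fin m → Wave d) → F} (hE : Integrable E) :
    Integrable (fun p : Wave d × (Fin (m - 1) → Wave d) => E (convString m p.1 p.2))
      (volume.prod volume) :=
  (measurePreserving_convString hm).integrable_comp_of_integrable hE

lemma integrable_fiberInt (hm : 0 < m) {E : (Fin m → Wave d) → Val J} (hE : Integrable E) :
    Integrable (fiberInt m E) volume :=
  (integrable_comp_convString hm hE).integral_prod_left

lemma integral_norm_fiberInt_le (hm : 0 < m) {E : (Fin m → Wave d) → Val J} (hE : Integrable E) :
    ∫ k, ‖fiberInt m E k‖ ≤ ∫ κ, ‖E κ‖ := by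
  have h1 := integrable_comp_convString hm hE.norm
  have h2 : ∫ κ, ‖E κ‖ = ∫ k, ∫ q, ‖E (convString m k q)‖ := by
    rw [← integral_prod _ h1, ← Measure.volume_eq_prod]
    conv_lhs => rw [← (measurePreserving_convString (d := d) hm).map_eq]
    rw [integral_map (measurePreserving_convString hm).measurable.aemeasurable]
    rw [(measurePreserving_convString hm).map_eq]
    exact hE.norm.aestronglyMeasurable
  rw [h2]
  refine integral_mono (integrable_fiberInt hm hE).norm h1.integral_prod_left fun k => ?_
  exact norm_integral_le_integral_norm _

lemma ae_ae_convString (hm : 0 < m) {P : (Fin m → Wave d) → Prop} (h : ∀ᵐ κ, P κ) :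
    ∀ᵐ k : Wave d, ∀ᵐ q : Fin (m - 1) → Wave d, P (convString m k q) := by
  have := (measurePreserving_convString (d := d) hm).quasiMeasurePreserving.ae h
  rw [Measure.volume_eq_prod] at this
  exact Measure.ae_ae_of_ae_prod this

lemma fiberInt_congr (hm : 0 < m) {E E' : (Fin m → Wave d) → Val J} (h : E =ᵐ[volume] E') :
    fiberInt m E =ᵐ[volume] fiberInt m E' := by
  filter_upwards [ae_ae_convString hm h] with k hk
  exact integral_congr_ae hk

open Classical in
/-- The class in `L¹` of an integrable function. -/
def classL1 (f : Wave d → Val J) : L1 d J := if hf : Integrable f volume then hf.toL1 f else 0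

lemma classL1_coeFn {f : Wave d → Val J} (hf : Integrable f volume) : classL1 f =ᵐ[volume] f := by
  rw [classL1, dif_pos hf]; exact hf.coeFn_toL1

lemma L1_ext {f g : L1 d J} (h : f =ᵐ[volume] g) : f = g := Lp.ext h

/-- The class in `L¹` of the fibre integral. -/
def cv (E : (Fin m → Wave d) → Val J) : L1 d J := classL1 (fiberInt m E)

lemma cv_coeFn (hm : 0 < m) {E : (Fin m → Wave d) → Val J} (hE : Integrable E) :
    cv E =ᵐ[volume] fiberInt m E := classL1_coeFn (integrable_fiberInt hm hE)

lemma norm_cv_le (hm : 0 < m) {E : (Fin m → Wave d) → Val J} (hE : Integrable E) :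
    ‖cv E‖ ≤ ∫ κ, ‖E κ‖ := by
  rw [L1.norm_eq_integral_norm]
  refine le_trans (le_of_eq (integral_congr_ae ?_)) (integral_norm_fiberInt_le hm hE)
  filter_upwards [cv_coeFn hm hE] with k hk
  rw [hk]

lemma cv_congr (hm : 0 < m) {E E' : (Fin m → Wave d) → Val J} (hE : Integrable E)
    (h : E =ᵐ[volume] E') : cv E = cv E' := by
  refine L1_ext ?_
  filter_upwards [cv_coeFn hm hE, cv_coeFn hm (hE.congr h), fiberInt_congr hm h] with k h1 h2 h3
  rw [h1, h2, h3]

lemma cv_add (hm : 0 < m) {E E' : (Fin m → Wave d) → Val J} (hE : Integrable E)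
    (hE' : Integrable E') : cv (fun κ => E κ + E' κ) = cv E + cv E' := by
  refine L1_ext ?_
  filter_upwards [cv_coeFn hm hE, cv_coeFn hm hE', cv_coeFn hm (hE.add hE'),
    Lp.coeFn_add (cv E) (cv E'), (integrable_comp_convString hm hE).prod_right_ae,
    (integrable_comp_convString hm hE').prod_right_ae] with k h1 h2 h3 h4 h5 h6
  rw [h4, Pi.add_apply, h1, h2]
  exact h3.trans (integral_add h5 h6)

lemma cv_smul (hm : 0 < m) (z : ℂ) {E : (Fin m → Wave d) → Val J} (hE : Integrable E) :
    cv (fun κ => z • E κ) = z • cv E := by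
  refine L1_ext ?_
  filter_upwards [cv_coeFn hm hE, cv_coeFn hm (hE.smul z), Lp.coeFn_smul z (cv E)] with k h1 h3 h4
  rw [h4, Pi.smul_apply, h1]
  refine h3.trans ?_
  simp only [fiberInt, Pi.smul_apply]
  exact integral_smul z _

lemma cv_sub (hm : 0 < m) {E E' : (Fin m → Wave d) → Val J} (hE : Integrable E)
    (hE' : Integrable E') : cv (fun κ => E κ - E' κ) = cv E - cv E' := by
  have h := cv_add hm hE (hE'.smul (-1 : ℂ))
  have h2 := cv_smul hm (-1 : ℂ) hE'
  simp only [neg_smul, one_smul] at h2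
  simp only [Pi.smul_apply, neg_smul, one_smul] at h
  change _ = _ + cv (fun κ => -E' κ) at h
  rw [h2] at h
  simpa [sub_eq_add_neg] using h

lemma aesm_comp_sum (hm : 0 < m) {F : Type*} [TopologicalSpace F] {g : Wave d → F}
    (hg : AEStronglyMeasurable g volume) :
    AEStronglyMeasurable (fun κ : Fin m → Wave d => g (∑ j, κ j)) volume :=
  hg.comp_quasiMeasurePreserving (quasiMeasurePreserving_sum hm)

lemma aesm_comp_eval {F : Type*} [TopologicalSpace F] {g : Wave d → F}
    (hg : AEStronglyMeasurable g volume) (j : Fin m) :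
    AEStronglyMeasurable (fun κ : Fin m → Wave d => g (κ j)) volume :=
  hg.comp_quasiMeasurePreserving
    (Measure.quasiMeasurePreserving_eval (fun _ : Fin m => (volume : Measure (Wave d))) j)

lemma integrable_mult_sum (hm : 0 < m) {M : Wave d → Val J →L[ℂ] Val J} (hM : IsMult M)
    {E : (Fin m → Wave d) → Val J} (hE : Integrable E) :
    Integrable (fun κ => M (∑ j, κ j) (E κ)) := by
  refine hE.norm.mono' ?_ ?_
  · exact (continuous_fst.clm_apply continuous_snd).comp_aestronglyMeasurable
      ((aesm_comp_sum hm hM.aesm).prodMk hE.aestronglyMeasurable)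
  · filter_upwards [ae_sum hm hM.bound] with κ hκ
    exact (ContinuousLinearMap.le_opNorm _ _).trans (mul_le_of_le_one_left (norm_nonneg _) hκ)

lemma mulOp_cv (hm : 0 < m) {M : Wave d → Val J →L[ℂ] Val J} (hM : IsMult M)
    {E : (Fin m → Wave d) → Val J} (hE : Integrable E) :
    mulOp M (cv E) = cv (fun κ => M (∑ j, κ j) (E κ)) := by
  refine L1_ext ?_
  filter_upwards [mulOp_coeFn hM (cv E), cv_coeFn hm hE, cv_coeFn hm (integrable_mult_sum hm hM hE),
    (integrable_comp_convString hm hE).prod_right_ae] with k h1 h2 h3 h4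
  rw [h1, h2, h3, fiberInt, fiberInt, ← ContinuousLinearMap.integral_comp_comm _ h4]
  simp only [sum_convString hm]

/-- Translation on `L¹`: `(translate y f)(k) = f (k + y)`. -/
def translate (y : Wave d) : L1 d J →ₗᵢ[ℂ] L1 d J :=
  Lp.compMeasurePreservingₗᵢ ℂ (fun k => k + y) (measurePreserving_add_right volume y)

lemma translate_coeFn (y : Wave d) (f : L1 d J) : translate y f =ᵐ[volume] fun k => f (k + y) :=
  Lp.coeFn_compMeasurePreserving f (measurePreserving_add_right volume y)

lemma integrable_comp_add {F : Type*} [NormedAddCommGroup F] {E : (Fin m → Wave d) → F}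
    (hE : Integrable E) (y : Fin m → Wave d) :
    Integrable (fun κ : Fin m → Wave d => E (fun j => κ j + y j)) volume :=
  hE.comp_add_right y

/-- Shifting the arguments moves the output only by the sum of the shifts; the free variables are
absorbed by invariance of Lebesgue measure. In particular opposite shifts of two arguments leave the
output in place. -/
lemma translate_cv (hm : 0 < m) {E : (Fin m → Wave d) → Val J} (hE : Integrable E)
    (y : Fin m → Wave d) :
    translate (∑ j, y j) (cv E) = cv (fun κ => E (fun j => κ j + y j)) := by
  refine L1_ext ?_
  have h0 := (measurePreserving_add_right volume (∑ j, y j)).quasiMeasurePreserving.ae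
    (cv_coeFn hm hE)
  filter_upwards [translate_coeFn (∑ j, y j) (cv E), cv_coeFn hm (integrable_comp_add hE y), h0]
    with k h1 h2 h3
  rw [h1, h2, h3, fiberInt, fiberInt]
  simp only [convString_add hm]
  exact (integral_add_right_eq_self (μ := (volume : Measure (Fin (m - 1) → Wave d)))
    (fun q => E (convString m (k + ∑ j, y j) q)) (fun i => y ⟨i, by omega⟩)).symm

end Convolution

/-! ### Multilinear operators on `L¹` with essentially bounded kernels. -/

section Kernels

variable {d J m : ℕ}

/-- Multilinear maps on the space of values. -/
abbrev MMap (J m : ℕ) : Type := ContinuousMultilinearMap ℂ (fun _ : Fin m => Val J) (Val J)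

/-- An essentially bounded kernel. -/
structure IsKer (a : (Fin m → Wave d) → MMap J m) (K : ℝ) : Prop where
  nonneg : 0 ≤ K
  aesm : AEStronglyMeasurable a volume
  bound : ∀ᵐ κ, ‖a κ‖ ≤ K

/-- The integrand `a(κ)(f_1(κ_1), …, f_m(κ_m))`. -/
def integrand (a : (Fin m → Wave d) → MMap J m) (f : Fin m → L1 d J) (κ : Fin m → Wave d) :
    Val J :=
  a κ (fun j => f j (κ j))

lemma integrable_prod_norm (f : Fin m → L1 d J) :
    Integrable (fun κ : Fin m → Wave d => ∏ j, ‖f j (κ j)‖) volume :=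
  Integrable.fintype_prod (𝕜 := ℝ) (f := fun j k => ‖f j k‖)
    fun j => (L1.integrable_coeFn (f j)).norm

lemma integral_prod_norm (f : Fin m → L1 d J) :
    ∫ κ : Fin m → Wave d, ∏ j, ‖f j (κ j)‖ = ∏ j, ‖f j‖ := by
  rw [integral_fintype_prod_volume_eq_prod (𝕜 := ℝ) (fun j k => ‖f j k‖)]
  simp_rw [L1.norm_eq_integral_norm]

lemma aesm_args (f : Fin m → L1 d J) :
    AEStronglyMeasurable (fun κ : Fin m → Wave d => fun j => f j (κ j)) volume :=
  (aemeasurable_pi_lambda _ fun j => (aesm_comp_eval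
    (L1.integrable_coeFn (f j)).aestronglyMeasurable j).aemeasurable).aestronglyMeasurable

lemma IsKer.norm_integrand_le {a : (Fin m → Wave d) → MMap J m} {K : ℝ} (ha : IsKer a K)
    (f : Fin m → L1 d J) : ∀ᵐ κ, ‖integrand a f κ‖ ≤ K * ∏ j, ‖f j (κ j)‖ := by
  filter_upwards [ha.bound] with κ hκ
  refine ((a κ).le_opNorm _).trans ?_
  gcongr

lemma IsKer.integrable {a : (Fin m → Wave d) → MMap J m} {K : ℝ} (ha : IsKer a K)
    (f : Fin m → L1 d J) : Integrable (integrand a f) volume := by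
  refine ((integrable_prod_norm f).const_mul K).mono' ?_ (ha.norm_integrand_le f)
  have : Continuous fun p : MMap J m × (Fin m → Val J) => p.1 p.2 := continuous_eval
  exact this.comp_aestronglyMeasurable (ha.aesm.prodMk (aesm_args f))

lemma integrand_update_coe [DecidableEq (Fin m)] (f : Fin m → L1 d J) (i : Fin m) (x : L1 d J)
    (κ : Fin m → Wave d) : (fun j => Function.update f i x j (κ j))
      = Function.update (fun j => f j (κ j)) i (x (κ i)) := by
  funext j
  by_cases h : j = i
  · subst h; simp
  · simp [h]

open Classical in
/-- The multilinear operator on `L¹` with kernel `a`. -/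
def kop (a : (Fin m → Wave d) → MMap J m) :
    ContinuousMultilinearMap ℂ (fun _ : Fin m => L1 d J) (L1 d J) :=
  if h : 0 < m ∧ ∃ K, IsKer a K then
    MultilinearMap.mkContinuous
      { toFun := fun f => cv (integrand a f)
        map_update_add' := fun f i x y => by
          obtain ⟨hm, K, ha⟩ := h
          rw [← cv_add hm (ha.integrable _) (ha.integrable _)]
          refine cv_congr hm (ha.integrable _) ?_
          filter_upwards [ae_eval (Lp.coeFn_add x y) i] with κ hκ
          simp only [integrand, integrand_update_coe, hκ, Pi.add_apply]
          exact (a κ).map_update_add _ _ _ _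
        map_update_smul' := fun f i z x => by
          obtain ⟨hm, K, ha⟩ := h
          rw [← cv_smul hm z (ha.integrable _)]
          refine cv_congr hm (ha.integrable _) ?_
          filter_upwards [ae_eval (Lp.coeFn_smul z x) i] with κ hκ
          simp only [integrand, integrand_update_coe, hκ, Pi.smul_apply]
          exact (a κ).map_update_smul _ _ _ _ } h.2.choose (fun f => by
        have ha := h.2.choose_spec
        refine (norm_cv_le h.1 (ha.integrable f)).trans ?_
        rw [← integral_prod_norm, ← integral_const_mul]
        exact integral_mono_ae (ha.integrable f).norm ((integrable_prod_norm f).const_mul _)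
          (ha.norm_integrand_le f))
  else 0

lemma kop_apply (hm : 0 < m) {a : (Fin m → Wave d) → MMap J m} {K : ℝ} (ha : IsKer a K)
    (f : Fin m → L1 d J) : kop a f = cv (integrand a f) := by
  rw [kop, dif_pos ⟨hm, K, ha⟩]
  rfl

lemma norm_kop_le (hm : 0 < m) {a : (Fin m → Wave d) → MMap J m} {K : ℝ} (ha : IsKer a K) :
    ‖kop a‖ ≤ K := by
  refine ContinuousMultilinearMap.opNorm_le_bound ha.nonneg fun f => ?_
  rw [kop_apply hm ha]
  refine (norm_cv_le hm (ha.integrable f)).trans ?_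
  rw [← integral_prod_norm, ← integral_const_mul]
  exact integral_mono_ae (ha.integrable f).norm ((integrable_prod_norm f).const_mul _)
    (ha.norm_integrand_le f)

lemma isKer_const (a₀ : MMap J m) : IsKer (fun _ : Fin m → Wave d => a₀) ‖a₀‖ :=
  ⟨norm_nonneg _, aestronglyMeasurable_const, Filter.Eventually.of_forall fun _ => le_rfl⟩

/-! ### Weighted estimates -/

/-- The weighted norm `∫ w |f|`. -/
def wmom (w : Wave d → ℝ) (f : L1 d J) : ℝ := ∫ k, w k * ‖f k‖

/-- A measurable weight with values in `[0, 1]`. -/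
structure IsWeight (w : Wave d → ℝ) : Prop where
  aesm : AEStronglyMeasurable w volume
  nonneg : ∀ k, 0 ≤ w k
  le_one : ∀ k, w k ≤ 1

lemma IsWeight.integrable {w : Wave d → ℝ} (hw : IsWeight w) (f : L1 d J) :
    Integrable (fun k => w k * ‖f k‖) volume := by
  have hf := (L1.integrable_coeFn f).norm
  refine hf.mono' (hw.aesm.mul hf.aestronglyMeasurable) (Filter.Eventually.of_forall fun k => ?_)
  rw [Real.norm_eq_abs, abs_of_nonneg (mul_nonneg (hw.nonneg k) (norm_nonneg _))]
  exact mul_le_of_le_one_left (norm_nonneg _) (hw.le_one k)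

lemma IsWeight.wmom_nonneg {w : Wave d → ℝ} (hw : IsWeight w) (f : L1 d J) : 0 ≤ wmom w f :=
  integral_nonneg fun k => mul_nonneg (hw.nonneg k) (norm_nonneg _)

lemma prod_norm_le_pow {ι X : Type*} [SeminormedAddCommGroup X] (s : Finset ι) (f : ι → X) {R : ℝ}
    (hR : ∀ j, ‖f j‖ ≤ R) : ∏ j ∈ s, ‖f j‖ ≤ R ^ s.card := by
  rw [← Finset.prod_const]
  exact Finset.prod_le_prod (fun _ _ => norm_nonneg _) fun j _ => hR j

/-- Moves the weight into the factor of its own variable, so that the integral over all arguments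
splits into a product. -/
lemma mul_prod_eq_prod_ite (w : Fin m → ℝ) (x : Fin m → ℝ) (i : Fin m) :
    w i * ∏ j, x j = ∏ j, (if j = i then w j else 1) * x j := by
  rw [Finset.prod_mul_distrib, Finset.prod_ite_eq' Finset.univ i w, if_pos (Finset.mem_univ i)]

lemma integrable_weight_prod {w : Fin m → Wave d → ℝ} (hw : ∀ j, IsWeight (w j))
    (f : Fin m → L1 d J) (i : Fin m) :
    Integrable (fun κ : Fin m → Wave d => w i (κ i) * ∏ j, ‖f j (κ j)‖) volume := by
  simp_rw [fun κ : Fin m → Wave d =>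
    mul_prod_eq_prod_ite (fun j => w j (κ j)) (fun j => ‖f j (κ j)‖) i]
  refine Integrable.fintype_prod (𝕜 := ℝ)
    (f := fun j k => (if j = i then w j k else 1) * ‖f j k‖) fun j => ?_
  by_cases h : j = i
  · simpa [h] using (hw i).integrable (f i)
  · simpa [h] using (L1.integrable_coeFn (f j)).norm

lemma integral_weight_prod_le {w : Fin m → Wave d → ℝ} (hw : ∀ j, IsWeight (w j))
    (f : Fin m → L1 d J) {R μ : ℝ} (hR : ∀ j, ‖f j‖ ≤ R)
    (hμ : ∀ j, wmom (w j) (f j) ≤ μ) (i : Fin m) :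
    ∫ κ : Fin m → Wave d, w i (κ i) * ∏ j, ‖f j (κ j)‖ ≤ μ * R ^ (m - 1) := by
  simp_rw [fun κ : Fin m → Wave d =>
    mul_prod_eq_prod_ite (fun j => w j (κ j)) (fun j => ‖f j (κ j)‖) i]
  rw [integral_fintype_prod_volume_eq_prod (𝕜 := ℝ)
    (fun j k => (if j = i then w j k else 1) * ‖f j k‖),
    ← Finset.mul_prod_erase _ _ (Finset.mem_univ i)]
  have h1 : ∫ k, (if i = i then w i k else 1) * ‖f i k‖ ≤ μ := by simpa [wmom] using hμ i
  have h2 : ∏ j ∈ Finset.univ.erase i, ∫ k, (if j = i then w j k else 1) * ‖f j k‖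
      ≤ R ^ (m - 1) := by
    have : ∀ j ∈ Finset.univ.erase i, ∫ k, (if j = i then w j k else 1) * ‖f j k‖ = ‖f j‖ := by
      intro j hj
      rw [L1.norm_eq_integral_norm]
      simp [(Finset.mem_erase.1 hj).1]
    rw [Finset.prod_congr rfl this]
    refine (prod_norm_le_pow _ f hR).trans_eq ?_
    rw [Finset.card_erase_of_mem (Finset.mem_univ i), Finset.card_univ, Fintype.card_fin]
  have h3 : 0 ≤ ∏ j ∈ Finset.univ.erase i, ∫ k, (if j = i then w j k else 1) * ‖f j k‖ := by
    refine Finset.prod_nonneg fun j _ => integral_nonneg fun k => mul_nonneg ?_ (norm_nonneg _)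
    split_ifs
    · exact (hw j).nonneg k
    · exact zero_le_one
  exact mul_le_mul h1 h2 h3 (((hw i).wmom_nonneg (f i)).trans (hμ i))

/-- The basic weighted estimate of a fibre integral. -/
lemma norm_cv_le_of_weight (hm : 0 < m) {E : (Fin m → Wave d) → Val J} (hE : Integrable E)
    {w : Fin m → Wave d → ℝ} (hw : ∀ j, IsWeight (w j)) (f : Fin m → L1 d J) {R μ K b : ℝ}
    (hK : 0 ≤ K) (hb : 0 ≤ b) (hR : ∀ j, ‖f j‖ ≤ R) (hμ : ∀ j, wmom (w j) (f j) ≤ μ)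
    (h : ∀ᵐ κ, ‖E κ‖ ≤ (K * ∑ j, w j (κ j) + b) * ∏ j, ‖f j (κ j)‖) :
    ‖cv E‖ ≤ K * (m * (μ * R ^ (m - 1))) + b * R ^ m := by
  refine (norm_cv_le hm hE).trans ?_
  have hi : ∀ i ∈ (Finset.univ : Finset (Fin m)),
      Integrable (fun κ : Fin m → Wave d => w i (κ i) * ∏ j, ‖f j (κ j)‖) volume :=
    fun i _ => integrable_weight_prod hw f i
  have hs := (integrable_finsetSum _ hi).const_mul K
  have hp := (integrable_prod_norm f).const_mul b
  have h1 : ∫ κ, ‖E κ‖ ≤ ∫ κ : Fin m → Wave d,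
      (K * ∑ i, w i (κ i) * ∏ j, ‖f j (κ j)‖) + b * ∏ j, ‖f j (κ j)‖ := by
    refine integral_mono_ae hE.norm (hs.add hp) ?_
    filter_upwards [h] with κ hκ
    refine hκ.trans (le_of_eq ?_)
    rw [add_mul, mul_assoc, Finset.sum_mul]
  refine h1.trans ?_
  rw [integral_add hs hp, integral_const_mul, integral_const_mul, integral_finsetSum _ hi,
    integral_prod_norm]
  refine add_le_add (mul_le_mul_of_nonneg_left ?_ hK) (mul_le_mul_of_nonneg_left ?_ hb)
  · refine (Finset.sum_le_card_nsmul _ _ _ fun i _ =>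
      integral_weight_prod_le hw f hR hμ i).trans_eq ?_
    rw [Finset.card_univ, Fintype.card_fin, nsmul_eq_mul]
  · refine (prod_norm_le_pow _ f hR).trans_eq ?_
    rw [Finset.card_univ, Fintype.card_fin]

lemma norm_apply_sub_le {X Y : Type*} [NormedAddCommGroup X] [NormedSpace ℂ X]
    [NormedAddCommGroup Y] [NormedSpace ℂ Y]
    (F : ContinuousMultilinearMap ℂ (fun _ : Fin m => X) Y) {K : ℝ} (hK : ‖F‖ ≤ K)
    {x y : Fin m → X} {r e : ℝ} (hr : 0 ≤ r) (he : 0 ≤ e) (hx : ∀ j, ‖x j‖ ≤ r)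
    (hy : ∀ j, ‖y j‖ ≤ r) (hxy : ∀ j, ‖x j - y j‖ ≤ e) :
    ‖F x - F y‖ ≤ K * m * r ^ (m - 1) * e := by
  refine (F.norm_image_sub_le x y).trans ?_
  have hK0 : 0 ≤ K := (norm_nonneg F).trans hK
  have h1 : max ‖x‖ ‖y‖ ≤ r :=
    max_le ((pi_norm_le_iff_of_nonneg hr).2 hx) ((pi_norm_le_iff_of_nonneg hr).2 hy)
  have h2 : ‖x - y‖ ≤ e := (pi_norm_le_iff_of_nonneg he).2 hxy
  rw [Fintype.card_fin]
  gcongr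

lemma norm_apply_le_pow {X Y : Type*} [NormedAddCommGroup X] [NormedSpace ℂ X]
    [NormedAddCommGroup Y] [NormedSpace ℂ Y]
    (F : ContinuousMultilinearMap ℂ (fun _ : Fin m => X) Y) {K : ℝ} (hK : ‖F‖ ≤ K)
    {x : Fin m → X} {r : ℝ} (hr : 0 ≤ r) (hx : ∀ j, ‖x j‖ ≤ r) : ‖F x‖ ≤ K * r ^ m := by
  refine (F.le_opNorm_mul_pow_of_le ((pi_norm_le_iff_of_nonneg hr).2 hx)).trans ?_
  gcongr

end Kernels

/-! ### The nonlinearity as an operator on `L¹` -/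

section Slow

variable {d J : ℕ} {A : LinearPart d J} {B : Nonlinearity d J} {Cχ : ℝ}

/-- The normalized susceptibility as a kernel. -/
def Nonlinearity.ker (B : Nonlinearity d J) (m : ℕ) (κ : Fin m → Wave d) : MMap J m :=
  ((2 * Real.pi) ^ ((m - 1) * d))⁻¹ • B.χ m (∑ j, κ j) κ

lemma ae_off_bandCrossing (hA : A.Admissible) {m : ℕ} (hm : 0 < m) :
    ∀ᵐ κ : Fin m → Wave d, (∑ j, κ j) ∉ A.bandCrossing ∧ ∀ j, κ j ∉ A.bandCrossing :=
  (ae_sum hm hA.ae_notMem).and (ae_eval_all fun _ => hA.ae_notMem)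

lemma norm_ker_le (hB : B.Admissible A Cχ) {m : ℕ} (hm : m ∈ B.degrees) {κ : Fin m → Wave d}
    (h0 : (∑ j, κ j) ∉ A.bandCrossing) (h1 : ∀ j, κ j ∉ A.bandCrossing) : ‖B.ker m κ‖ ≤ Cχ := by
  refine le_trans (le_of_eq ?_) (hB.bound m hm _ κ h0 h1)
  rw [Nonlinearity.ker, norm_smul, Real.norm_eq_abs, abs_of_nonneg (by positivity)]

lemma isKer_ker (hA : A.Admissible) (hB : B.Admissible A Cχ) {m : ℕ} (hm : m ∈ B.degrees) :
    IsKer (B.ker m) Cχ := by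
  have hm0 : 0 < m := by have := B.two_le m hm; omega
  have hae := ae_off_bandCrossing hA hm0
  have hb : ∀ᵐ κ, ‖B.ker m κ‖ ≤ Cχ := by
    filter_upwards [hae] with κ hκ
    exact norm_ker_le hB hm hκ.1 hκ.2
  refine ⟨?_, ?_, hb⟩
  · obtain ⟨κ, hκ⟩ := hb.exists
    exact (norm_nonneg _).trans hκ
  · set s : Set (Fin m → Wave d) := {κ | (∑ j, κ j) ∉ A.bandCrossing ∧ ∀ j, κ j ∉ A.bandCrossing}
    have hcont : ContinuousOn (B.ker m) s := by
      have h1 := (hB.smooth m hm).continuousOn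
      have h2 : Continuous fun κ : Fin m → Wave d => (∑ j, κ j, κ) := by fun_prop
      exact (h1.comp h2.continuousOn fun κ hκ => hκ).const_smul (((2 * Real.pi) ^ ((m - 1) * d))⁻¹)
    have hopen : IsOpen s := by
      have e : s = (fun κ : Fin m → Wave d => ∑ j, κ j) ⁻¹' A.bandCrossingᶜ ∩
          ⋂ j, (fun κ : Fin m → Wave d => κ j) ⁻¹' A.bandCrossingᶜ := by
        ext κ; simp [s]
      rw [e]
      refine (hA.isClosed.isOpen_compl.preimage (by fun_prop)).inter
        (isOpen_iInter_of_finite fun j => hA.isClosed.isOpen_compl.preimage (by fun_prop))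
    have h2 := hcont.aestronglyMeasurable (μ := volume) hopen.measurableSet
    rwa [Measure.restrict_eq_self_of_ae_mem (s := s) hae] at h2

/-- The propagator on `L¹`. -/
def prop (A : LinearPart d J) (ϱ t : ℝ) : L1 d J →L[ℂ] L1 d J := mulOp (A.propagator ϱ t)

lemma norm_prop (hA : A.Admissible) (ϱ t : ℝ) (u : L1 d J) : ‖prop A ϱ t u‖ = ‖u‖ :=
  norm_mulOp_of_isometry (isMult_propagator hA ϱ t) (A.norm_propagator_apply ϱ t) u

lemma continuousOn_prop_apply (hA : A.Admissible) (ϱ : ℝ) {s : Set ℝ} {f : ℝ → ℝ}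
    (hf : Continuous f) {u : ℝ → L1 d J} (hu : ContinuousOn u s) :
    ContinuousOn (fun t => prop A ϱ (f t) (u t)) s := by
  refine continuousOn_mulOp_apply (fun t => isMult_propagator hA ϱ (f t))
    (Filter.Eventually.of_forall fun k => ?_) hu
  simp_rw [A.propagator_eq]
  fun_prop

/-- The right-hand side is a genuine element of `L¹`, so the default value `0` in `slowL1` never
occurs. From here on the nonlinearity is a finite sum of bounded multilinear operators placed
between isometries. -/
lemma slowL1_eq (hA : A.Admissible) (hB : B.Admissible A Cχ) (ϱ t : ℝ) (u : L1 d J) :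
    B.slowL1 A ϱ t u
      = prop A ϱ t (∑ m ∈ B.degrees, kop (B.ker m) fun _ => prop A ϱ (-t) u) := by
  have hterm : ∀ m ∈ B.degrees,
      B.term m (fun k' => A.propagator ϱ (-t) k' (u k'))
        =ᵐ[volume] kop (B.ker m) fun _ => prop A ϱ (-t) u := by
    intro m hm
    have hm0 : 0 < m := by have := B.two_le m hm; omega
    have hK := isKer_ker hA hB hm
    rw [kop_apply hm0 hK]
    have h1 : integrand (B.ker m) (fun _ => prop A ϱ (-t) u) =ᵐ[volume]
        fun κ => B.ker m κ (fun j => A.propagator ϱ (-t) (κ j) (u (κ j))) := by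
      filter_upwards [ae_eval_all fun _ : Fin m =>
        mulOp_coeFn (isMult_propagator hA ϱ (-t)) u] with κ hκ
      simp only [integrand, prop, hκ]
    filter_upwards [cv_coeFn hm0 (hK.integrable fun _ => prop A ϱ (-t) u),
      fiberInt_congr hm0 h1] with k h2 h3
    rw [h2, h3, fiberInt, Nonlinearity.term, ← integral_smul]
    simp only [Nonlinearity.ker, sum_convString hm0]
    rfl
  have hall : B.slow A ϱ t u
      =ᵐ[volume] prop A ϱ t (∑ m ∈ B.degrees, kop (B.ker m) fun _ => prop A ϱ (-t) u) := by
    have h2 : ∀ᵐ k, ∀ m ∈ B.degrees, B.term m (fun k' => A.propagator ϱ (-t) k' (u k')) k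
        = (kop (B.ker m) fun _ => prop A ϱ (-t) u : L1 d J) k :=
      (Finset.eventually_all B.degrees).2 fun m hm => hterm m hm
    filter_upwards [mulOp_coeFn (isMult_propagator hA ϱ t)
      (∑ m ∈ B.degrees, kop (B.ker m) fun _ => prop A ϱ (-t) u), h2,
      Lp.coeFn_fun_finsetSum B.degrees (fun m => (kop (B.ker m) fun _ => prop A ϱ (-t) u : L1 d J))]
      with k h3 h4 h5
    rw [prop, h3, h5, Nonlinearity.slow, Nonlinearity.eval]
    congr 1
    exact Finset.sum_congr rfl h4
  have hint : Integrable (B.slow A ϱ t u) volume := (L1.integrable_coeFn _).congr hall.symm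
  rw [Nonlinearity.slowL1, dif_pos hint]
  exact L1_ext (hint.coeFn_toL1.trans hall)

lemma norm_slowL1_le (hA : A.Admissible) (hB : B.Admissible A Cχ) (ϱ t : ℝ) {u : L1 d J} {r : ℝ}
    (hu : ‖u‖ ≤ r) : ‖B.slowL1 A ϱ t u‖ ≤ Cχ * ∑ m ∈ B.degrees, r ^ m := by
  rw [slowL1_eq hA hB, norm_prop hA, Finset.mul_sum]
  refine (norm_sum_le _ _).trans (Finset.sum_le_sum fun m hm => ?_)
  have hm0 : 0 < m := by have := B.two_le m hm; omega
  exact norm_apply_le_pow _ (norm_kop_le hm0 (isKer_ker hA hB hm)) ((norm_nonneg u).trans hu)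
    fun _ => (norm_prop hA ϱ (-t) u).trans_le hu

lemma norm_slowL1_sub_le (hA : A.Admissible) (hB : B.Admissible A Cχ) (ϱ t : ℝ) {u v : L1 d J}
    {r : ℝ} (hu : ‖u‖ ≤ r) (hv : ‖v‖ ≤ r) :
    ‖B.slowL1 A ϱ t u - B.slowL1 A ϱ t v‖
      ≤ (Cχ * ∑ m ∈ B.degrees, (m : ℝ) * r ^ (m - 1)) * ‖u - v‖ := by
  rw [slowL1_eq hA hB, slowL1_eq hA hB, ← map_sub, norm_prop hA, ← Finset.sum_sub_distrib,
    Finset.mul_sum, Finset.sum_mul]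
  refine (norm_sum_le _ _).trans (Finset.sum_le_sum fun m hm => ?_)
  have hm0 : 0 < m := by have := B.two_le m hm; omega
  refine (norm_apply_sub_le _ (norm_kop_le hm0 (isKer_ker hA hB hm)) ((norm_nonneg u).trans hu)
    (norm_nonneg (u - v)) (fun _ => (norm_prop hA ϱ (-t) u).trans_le hu)
    (fun _ => (norm_prop hA ϱ (-t) v).trans_le hv) (fun _ => ?_)).trans_eq (by ring)
  rw [← map_sub, norm_prop hA]

lemma continuousOn_slowL1 (hA : A.Admissible) (hB : B.Admissible A Cχ) (ϱ : ℝ) {s : Set ℝ}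
    {u : ℝ → L1 d J} (hu : ContinuousOn u s) :
    ContinuousOn (fun t => B.slowL1 A ϱ t (u t)) s := by
  simp_rw [slowL1_eq hA hB]
  refine continuousOn_prop_apply hA ϱ continuous_id (continuousOn_finsetSum _ fun m _ => ?_)
  refine (kop (B.ker m)).cont.comp_continuousOn (continuousOn_pi.2 fun _ => ?_)
  exact continuousOn_prop_apply hA ϱ continuous_neg hu

end Slow

/-! ### Grönwall's inequality for integral inequalities. -/

section Gronwall

lemma Icc_subset_of_mem {τ t : ℝ} (ht : t ∈ Icc 0 τ) : Icc 0 t ⊆ Icc 0 τ :=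
  Icc_subset_Icc_right ht.2

lemma intervalIntegrable_of_continuousOn {E : Type*} [NormedAddCommGroup E] {f : ℝ → E} {τ t : ℝ}
    (hf : ContinuousOn f (Icc 0 τ)) (ht : t ∈ Icc 0 τ) : IntervalIntegrable f volume 0 t :=
  (hf.mono (Icc_subset_of_mem ht)).intervalIntegrable_of_Icc ht.1

/-- Grönwall's inequality in integral form. -/
lemma gronwall_integral {φ : ℝ → ℝ} {τ K Λ : ℝ} (hK : 0 ≤ K) (hΛ : 0 ≤ Λ)
    (hφ : ContinuousOn φ (Icc 0 τ)) (h0 : ∀ t ∈ Icc 0 τ, 0 ≤ φ t)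
    (h : ∀ t ∈ Icc 0 τ, φ t ≤ K + Λ * ∫ s in (0 : ℝ)..t, φ s) :
    ∀ t ∈ Icc 0 τ, φ t ≤ K * Real.exp (Λ * τ) := by
  intro t ht
  have hτ : 0 ≤ τ := ht.1.trans ht.2
  -- The constant extension is continuous on the whole line, so its primitive is differentiable
  -- everywhere and the differential form of Grönwall's inequality applies to the right-hand side
  -- `Φ`.
  let ψ : ℝ → ℝ := IccExtend hτ ((Icc 0 τ).domRestrict φ)
  have hψc : Continuous ψ := (continuousOn_iff_continuous_domRestrict.1 hφ).Icc_extend'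
  have hψ : ∀ s ∈ Icc 0 τ, ψ s = φ s := fun s hs => IccExtend_of_mem hτ _ hs
  have hint : ∀ t ∈ Icc 0 τ, ∫ s in (0 : ℝ)..t, φ s = ∫ s in (0 : ℝ)..t, ψ s := by
    intro t ht
    refine intervalIntegral.integral_congr fun s hs => ?_
    rw [uIcc_of_le ht.1] at hs
    exact (hψ s (Icc_subset_of_mem ht hs)).symm
  let Φ : ℝ → ℝ := fun t => K + Λ * ∫ s in (0 : ℝ)..t, ψ s
  have hΦd : ∀ t, HasDerivAt Φ (Λ * ψ t) t := fun t =>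
    ((hψc.integral_hasStrictDerivAt 0 t).hasDerivAt.const_mul Λ).const_add K
  have hle : ∀ t ∈ Icc 0 τ, φ t ≤ Φ t := fun t ht => by
    simpa only [Φ, ← hint t ht] using h t ht
  have hΦ0 : ∀ t ∈ Icc 0 τ, 0 ≤ Φ t := fun t ht => (h0 t ht).trans (hle t ht)
  have key := norm_le_gronwallBound_of_norm_deriv_right_le (f := Φ) (f' := fun t => Λ * ψ t)
    (δ := K) (K := Λ) (ε := 0) (a := 0) (b := τ)
    (fun t _ => (hΦd t).continuousAt.continuousWithinAt)
    (fun t _ => (hΦd t).hasDerivWithinAt)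
    (by simp [Φ, abs_of_nonneg hK])
    (fun t ht => by
      have ht' := Ico_subset_Icc_self ht
      rw [hψ t ht', Real.norm_eq_abs, Real.norm_eq_abs, abs_of_nonneg (hΦ0 t ht'),
        abs_of_nonneg (mul_nonneg hΛ (h0 t ht')), add_zero]
      exact mul_le_mul_of_nonneg_left (hle t ht') hΛ) t ht
  rw [gronwallBound_ε0, sub_zero, Real.norm_eq_abs] at key
  refine (hle t ht).trans ((le_abs_self _).trans (key.trans ?_))
  have := ht.2
  gcongr

end Gronwall

/-! ### Well-posedness and stability of the evolution equation. -/

section Solutions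

variable {d J : ℕ} {A : LinearPart d J} {B : Nonlinearity d J} {Cχ : ℝ}

lemma mul_sum_nonneg (hA : A.Admissible) (hB : B.Admissible A Cχ) {f : ℕ → ℝ}
    (hf : ∀ m ∈ B.degrees, 0 ≤ f m) : 0 ≤ Cχ * ∑ m ∈ B.degrees, f m := by
  rw [Finset.mul_sum]
  exact Finset.sum_nonneg fun m hm => mul_nonneg (isKer_ker hA hB hm).nonneg (hf m hm)

/-- Lipschitz constant of the nonlinearity on the ball of radius `r`. -/
def lip (B : Nonlinearity d J) (Cχ r : ℝ) : ℝ := Cχ * ∑ m ∈ B.degrees, (m : ℝ) * r ^ (m - 1)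

lemma lip_nonneg (hA : A.Admissible) (hB : B.Admissible A Cχ) {r : ℝ} (hr : 0 ≤ r) :
    0 ≤ lip B Cχ r :=
  mul_sum_nonneg hA hB fun m _ => by positivity

/-- Bound of the nonlinearity on the ball of radius `r`. -/
def bnd (B : Nonlinearity d J) (Cχ r : ℝ) : ℝ := Cχ * ∑ m ∈ B.degrees, r ^ m

lemma bnd_nonneg (hA : A.Admissible) (hB : B.Admissible A Cχ) {r : ℝ} (hr : 0 ≤ r) :
    0 ≤ bnd B Cχ r :=
  mul_sum_nonneg hA hB fun m _ => by positivity

/-- All degrees satisfy `m ≥ 2`, whence `(2R)^m ≤ m (2R)^{m-1} R`. The Lipschitz condition on `τs`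
therefore also keeps the integral term below `R`, and the solution within distance `R` of its datum.
-/
lemma bnd_mul_le (hA : A.Admissible) (hB : B.Admissible A Cχ) {R τs : ℝ} (hR : 0 < R)
    (hτs : 0 < τs) (hτs' : τs * lipConst B Cχ R < 1) : bnd B Cχ (2 * R) * τs ≤ R := by
  have h1 : bnd B Cχ (2 * R) ≤ lipConst B Cχ R * R := by
    rw [bnd, lipConst, Finset.mul_sum, Finset.mul_sum, Finset.sum_mul]
    refine Finset.sum_le_sum fun m hm => ?_
    have hC := (isKer_ker hA hB hm).nonneg
    have h2 := B.two_le m hm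
    have h3 : (2 : ℝ) ≤ m := by exact_mod_cast h2
    obtain ⟨p, rfl⟩ : ∃ p, m = p + 1 := ⟨m - 1, by omega⟩
    rw [Nat.add_sub_cancel, mul_assoc, pow_succ]
    refine mul_le_mul_of_nonneg_left ?_ hC
    have : 0 ≤ (2 * R) ^ p * R := by positivity
    nlinarith
  nlinarith

theorem exists_isSolution (hA : A.Admissible) (hB : B.Admissible A Cχ) {R τs : ℝ} (hR : 0 < R)
    (hτs : 0 < τs) (hτs' : τs * lipConst B Cχ R < 1) (ϱ : ℝ) {g : L1 d J} (hg : ‖g‖ ≤ R) :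
    ∃ u, IsSolution A B ϱ τs R g u := by
  have h2R : (0 : ℝ) ≤ 2 * R := by positivity
  have hball : ∀ u ∈ Metric.closedBall g R, ‖u‖ ≤ 2 * R := fun u hu => by
    have := norm_le_of_mem_closedBall hu
    linarith
  -- Picard–Lindelöf on the closed ball of radius `R` around `g`, which lies in the ball of radius
  -- `2R` around zero where the bounds hold; the initial value is not varied, hence the inner radius
  -- `0`.
  have hPL : IsPicardLindelof (fun t u => B.slowL1 A ϱ t u) (tmin := 0) (tmax := τs)
      ⟨0, left_mem_Icc.2 hτs.le⟩ g (NNReal.mk R hR.le) 0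
      (NNReal.mk (bnd B Cχ (2 * R)) (bnd_nonneg hA hB h2R))
      (NNReal.mk (lip B Cχ (2 * R)) (lip_nonneg hA hB h2R)) := by
    refine ⟨fun t _ => LipschitzOnWith.of_dist_le_mul fun u hu v hv => ?_, fun u _ => ?_,
      fun t _ u hu => ?_, ?_⟩
    · rw [dist_eq_norm, dist_eq_norm]
      exact norm_slowL1_sub_le hA hB ϱ t (hball u hu) (hball v hv)
    · exact continuousOn_slowL1 hA hB ϱ continuousOn_const
    · exact norm_slowL1_le hA hB ϱ t (hball u hu)
    · simp only [sub_zero, NNReal.coe_mk, sub_self, NNReal.coe_zero]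
      rw [max_eq_left hτs.le]
      exact bnd_mul_le hA hB hR hτs hτs'
  have hx : g ∈ Metric.closedBall g ((0 : NNReal) : ℝ) := by simp
  obtain ⟨α, hα⟩ := ODE.FunSpace.exists_isFixedPt_next hPL hx
  replace hα := (ODE.FunSpace.isFixedPt_next_iff hPL hx).1 hα
  refine ⟨α.compProj, α.continuous_compProj.continuousOn, fun τ _ => ?_, fun τ hτ => ?_⟩
  · exact hball _ (α.compProj_mem_closedBall hPL.mul_max_le)
  · rw [ODE.FunSpace.compProj_of_mem hτ, hα]
    rfl

/-- Stability of the evolution equation. -/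
lemma norm_sub_le_of_residual (hA : A.Admissible) (hB : B.Admissible A Cχ) {ϱ τs r e : ℝ}
    (hr : 0 ≤ r) (he : 0 ≤ e) {x y : ℝ → L1 d J}
    (hx : ContinuousOn x (Icc 0 τs)) (hy : ContinuousOn y (Icc 0 τs))
    (hxr : ∀ t ∈ Icc 0 τs, ‖x t‖ ≤ r) (hyr : ∀ t ∈ Icc 0 τs, ‖y t‖ ≤ r)
    (h : ∀ t ∈ Icc 0 τs, ‖x t - y t - ((∫ s in (0 : ℝ)..t, B.slowL1 A ϱ s (x s))
      - ∫ s in (0 : ℝ)..t, B.slowL1 A ϱ s (y s))‖ ≤ e) :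
    ∀ t ∈ Icc 0 τs, ‖x t - y t‖ ≤ e * Real.exp (lip B Cχ r * τs) := by
  refine gronwall_integral (φ := fun t => ‖x t - y t‖) he (lip_nonneg hA hB hr) (hx.sub hy).norm
    (fun _ _ => norm_nonneg _) fun t ht => ?_
  have i1 := intervalIntegrable_of_continuousOn (continuousOn_slowL1 hA hB ϱ hx) ht
  have i2 := intervalIntegrable_of_continuousOn (continuousOn_slowL1 hA hB ϱ hy) ht
  have h1 := h t ht
  rw [← intervalIntegral.integral_sub i1 i2] at h1
  have h2 : ‖∫ s in (0 : ℝ)..t, (B.slowL1 A ϱ s (x s) - B.slowL1 A ϱ s (y s))‖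
      ≤ lip B Cχ r * ∫ s in (0 : ℝ)..t, ‖x s - y s‖ := by
    rw [← intervalIntegral.integral_const_mul]
    refine intervalIntegral.norm_integral_le_of_norm_le ht.1 ?_ ?_
    · refine Filter.Eventually.of_forall fun s hs => ?_
      have hs' := Icc_subset_of_mem ht (Ioc_subset_Icc_self hs)
      exact norm_slowL1_sub_le hA hB ϱ s (hxr s hs') (hyr s hs')
    · exact (intervalIntegrable_of_continuousOn (hx.sub hy).norm ht).const_mul _
  have h3 := norm_le_norm_add_norm_sub' (x t - y t)
    (∫ s in (0 : ℝ)..t, (B.slowL1 A ϱ s (x s) - B.slowL1 A ϱ s (y s)))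
  linarith

/-- Continuous dependence of solutions on the initial data. -/
lemma IsSolution.norm_sub_le (hA : A.Admissible) (hB : B.Admissible A Cχ) {ϱ τs R : ℝ}
    (hR : 0 < R) {g g' : L1 d J} {u u' : ℝ → L1 d J} (hu : IsSolution A B ϱ τs R g u)
    (hu' : IsSolution A B ϱ τs R g' u') :
    ∀ t ∈ Icc 0 τs, ‖u t - u' t‖ ≤ ‖g - g'‖ * Real.exp (lip B Cχ (2 * R) * τs) := by
  refine norm_sub_le_of_residual hA hB (ϱ := ϱ) (by positivity) (norm_nonneg _) hu.continuousOn
    hu'.continuousOn hu.bound hu'.bound fun t ht => le_of_eq ?_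
  congr 1
  conv_lhs => rw [hu.equation t ht, hu'.equation t ht]
  abel

theorem IsSolution.eqOn (hA : A.Admissible) (hB : B.Admissible A Cχ) {ϱ τs R : ℝ}
    (hR : 0 < R) {g : L1 d J} {u u' : ℝ → L1 d J} (hu : IsSolution A B ϱ τs R g u)
    (hu' : IsSolution A B ϱ τs R g u') : EqOn u u' (Icc 0 τs) := by
  intro t ht
  have := hu.norm_sub_le hA hB hR hu' t ht
  rw [sub_self, norm_zero, zero_mul] at this
  exact sub_eq_zero.1 (norm_le_zero_iff.1 this)

lemma isSolution_solutionOperator (hA : A.Admissible) (hB : B.Admissible A Cχ) {R τs : ℝ}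
    (hR : 0 < R) (hτs : 0 < τs) (hτs' : τs * lipConst B Cχ R < 1) (ϱ : ℝ) {g : L1 d J}
    (hg : ‖g‖ ≤ R) : IsSolution A B ϱ τs R g (solutionOperator A B ϱ τs R g) := by
  have H := exists_isSolution hA hB hR hτs hτs' ϱ hg
  rw [solutionOperator, dif_pos H]
  exact H.choose_spec

lemma IsSolution.norm_sub_le_time (hA : A.Admissible) (hB : B.Admissible A Cχ) {ϱ τs R : ℝ}
    {g : L1 d J} {u : ℝ → L1 d J} (hu : IsSolution A B ϱ τs R g u) {s t : ℝ}
    (hs : s ∈ Icc 0 τs) (ht : t ∈ Icc 0 τs) :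
    ‖u t - u s‖ ≤ bnd B Cχ (2 * R) * |t - s| := by
  have hc := continuousOn_slowL1 hA hB ϱ hu.continuousOn
  rw [hu.equation t ht, hu.equation s hs, add_sub_add_left_eq_sub,
    intervalIntegral.integral_interval_sub_left (intervalIntegrable_of_continuousOn hc ht)
      (intervalIntegrable_of_continuousOn hc hs)]
  refine intervalIntegral.norm_integral_le_of_norm_le_const fun x hx => ?_
  have hx' : x ∈ Icc 0 τs := (uIoc_subset_uIcc.trans (uIcc_subset_Icc hs ht)) hx
  exact norm_slowL1_le hA hB ϱ x (hu.bound x hx')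

end Solutions

/-! ### Half-period cancellation in time -/

section HalfPeriod

variable {X : Type*} [NormedAddCommGroup X] [NormedSpace ℝ X]

/-- Twice the integral of `Y` is the integral of `Y(s + h) + Y(s)` plus two end pieces of length
`h`. If a shift by `h` nearly reverses the sign of `Y`, all these terms are small. This takes the
place of integration by parts and needs no derivative in time. -/
lemma norm_integral_le_of_half_period {Y : ℝ → X} {τ K h e : ℝ} (hh : 0 < h) (hK : 0 ≤ K)
    (he : 0 ≤ e)
    (hY : ContinuousOn Y (Icc 0 τ)) (hb : ∀ s ∈ Icc 0 τ, ‖Y s‖ ≤ K)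
    (hc : ∀ s ∈ Icc 0 τ, s + h ∈ Icc 0 τ → ‖Y (s + h) + Y s‖ ≤ e) :
    ∀ t ∈ Icc 0 τ, ‖∫ s in (0 : ℝ)..t, Y s‖ ≤ K * h + e * τ := by
  intro t ht
  have hτ : 0 ≤ τ := ht.1.trans ht.2
  have hle : ∀ a b, 0 ≤ a → a ≤ b → b ≤ τ → ‖∫ s in a..b, Y s‖ ≤ K * (b - a) := by
    intro a b ha hab hbτ
    have := intervalIntegral.norm_integral_le_of_norm_le_const (a := a) (b := b) (f := Y) (C := K)
      fun x hx => by
        rw [uIoc_of_le hab] at hx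
        exact hb x ⟨ha.trans hx.1.le, hx.2.trans hbτ⟩
    rwa [abs_of_nonneg (by linarith)] at this
  rcases le_or_gt t h with hth | hth
  · have := hle 0 t le_rfl ht.1 ht.2
    nlinarith
  · have hI : ∀ a b, 0 ≤ a → a ≤ b → b ≤ τ → IntervalIntegrable Y volume a b :=
      fun a b ha hab hbτ => (hY.mono (Icc_subset_Icc ha hbτ)).intervalIntegrable_of_Icc hab
    have hth' : 0 ≤ t - h := by linarith
    have e1 : ∫ s in (0 : ℝ)..t, Y s = (∫ s in (0 : ℝ)..(t - h), Y s) + ∫ s in (t - h)..t, Y s :=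
      (intervalIntegral.integral_add_adjacent_intervals
        (hI 0 (t - h) le_rfl hth' (by linarith [ht.2]))
        (hI (t - h) t hth' (by linarith) ht.2)).symm
    have e2 : ∫ s in (0 : ℝ)..t, Y s = (∫ s in (0 : ℝ)..h, Y s) + ∫ s in h..t, Y s :=
      (intervalIntegral.integral_add_adjacent_intervals
        (hI 0 h le_rfl hh.le (by linarith [ht.2])) (hI h t hh.le hth.le ht.2)).symm
    have e3 : ∫ s in (0 : ℝ)..(t - h), Y (s + h) = ∫ s in h..t, Y s := by
      rw [intervalIntegral.integral_comp_add_right]; simp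
    have i1 := hI 0 (t - h) le_rfl hth' (by linarith [ht.2])
    have i2 : IntervalIntegrable (fun s => Y (s + h)) volume 0 (t - h) := by
      have hc2 : ContinuousOn (fun s => Y (s + h)) (Icc 0 (t - h)) := by
        refine hY.comp (by fun_prop) fun s hs => ?_
        exact ⟨by linarith [hs.1], by linarith [hs.2, ht.2]⟩
      exact hc2.intervalIntegrable_of_Icc hth'
    have e4 : (∫ s in (0 : ℝ)..t, Y s) + ∫ s in (0 : ℝ)..t, Y s
        = (∫ s in (0 : ℝ)..(t - h), (Y (s + h) + Y s)) + (∫ s in (0 : ℝ)..h, Y s)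
          + ∫ s in (t - h)..t, Y s := by
      rw [intervalIntegral.integral_add i2 i1, e3]
      nth_rewrite 1 [e1]
      rw [e2]
      abel
    have b1 : ‖∫ s in (0 : ℝ)..(t - h), (Y (s + h) + Y s)‖ ≤ e * (t - h) := by
      have := intervalIntegral.norm_integral_le_of_norm_le_const (a := 0) (b := t - h)
        (f := fun s => Y (s + h) + Y s) (C := e) fun x hx => by
          rw [uIoc_of_le hth'] at hx
          exact hc x ⟨hx.1.le, by linarith [hx.2, ht.2]⟩
            ⟨by linarith [hx.1], by linarith [hx.2, ht.2]⟩
      rwa [sub_zero, abs_of_nonneg hth'] at this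
    have b2 := hle 0 h le_rfl hh.le (by linarith [ht.2])
    have b3 := hle (t - h) t hth' (by linarith) ht.2
    have b4 : ‖(∫ s in (0 : ℝ)..t, Y s) + ∫ s in (0 : ℝ)..t, Y s‖
        ≤ e * (t - h) + K * (h - 0) + K * (t - (t - h)) := by
      rw [e4]
      exact (norm_add₃_le).trans (by linarith)
    rw [← two_smul ℝ, norm_smul, Real.norm_ofNat] at b4
    have : e * (t - h) ≤ e * τ := by gcongr; linarith [ht.2]
    have : 0 ≤ e * τ := by positivity
    nlinarith

end HalfPeriod

/-! ### A logarithmic integral -/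

section LogIntegral

lemma integral_inv_add_abs_le {τ t₀ a : ℝ} (hτ : 0 ≤ τ) (ha : 0 < a) :
    ∫ s in (0 : ℝ)..τ, a / (a + |s - t₀|) ≤ 2 * (a * Real.log (1 + τ / a)) := by
  -- The centre `t₀` may lie outside `[0, τ]`. Its nearest point in the interval is closer to every
  -- `s`, so the replacement can only increase the integrand.
  set t₁ := max 0 (min τ t₀) with ht₁
  have h0 : 0 ≤ t₁ := le_max_left _ _
  have h1 : t₁ ≤ τ := max_le hτ (min_le_left _ _)
  have hdist : ∀ s ∈ Icc 0 τ, |s - t₁| ≤ |s - t₀| := by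
    intro s hs
    rcases le_total t₀ 0 with h | h
    · have : t₁ = 0 := max_eq_left (by rw [min_eq_right (h.trans hτ)]; exact h)
      rw [this, sub_zero, abs_of_nonneg hs.1, abs_of_nonneg (by linarith [hs.1])]
      linarith
    · rcases le_total τ t₀ with h' | h'
      · have : t₁ = τ := by rw [ht₁, min_eq_left h', max_eq_right hτ]
        rw [this, abs_of_nonpos (by linarith [hs.2]), abs_of_nonpos (by linarith [hs.2])]
        linarith
      · have : t₁ = t₀ := by rw [ht₁, min_eq_right h', max_eq_right h]
        rw [this]
  have hcont : ∀ c : ℝ, Continuous fun s : ℝ => a / (a + |s - c|) := fun c => by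
    refine continuous_const.div (by fun_prop) fun s => ?_
    positivity
  have hstep : ∫ s in (0 : ℝ)..τ, a / (a + |s - t₀|) ≤ ∫ s in (0 : ℝ)..τ, a / (a + |s - t₁|) := by
    refine intervalIntegral.integral_mono_on hτ ((hcont _).intervalIntegrable _ _)
      ((hcont _).intervalIntegrable _ _) fun s hs => ?_
    have := hdist s hs
    gcongr
  have hlog : ∀ c, 0 ≤ c → c ≤ τ → ∫ s in (0 : ℝ)..c, a / (a + s) ≤ a * Real.log (1 + τ / a) := by
    intro c hc hcτ
    have : ∫ s in (0 : ℝ)..c, a / (a + s) = a * Real.log (1 + c / a) := by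
      simp_rw [div_eq_mul_inv a]
      rw [intervalIntegral.integral_const_mul,
        intervalIntegral.integral_comp_add_left (fun x => x⁻¹), add_zero,
        integral_inv_of_pos ha (by linarith), add_div, div_self ha.ne', div_eq_mul_inv]
    rw [this]
    gcongr
  refine hstep.trans ?_
  rw [← intervalIntegral.integral_add_adjacent_intervals ((hcont t₁).intervalIntegrable 0 t₁)
    ((hcont t₁).intervalIntegrable t₁ τ)]
  have p1 : ∫ s in (0 : ℝ)..t₁, a / (a + |s - t₁|) = ∫ s in (0 : ℝ)..t₁, a / (a + s) := by
    have := intervalIntegral.integral_comp_sub_left (a := 0) (b := t₁)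
      (fun s : ℝ => a / (a + s)) t₁
    simp only [sub_self, sub_zero] at this
    rw [← this]
    refine intervalIntegral.integral_congr fun s hs => ?_
    rw [uIcc_of_le h0] at hs
    rw [abs_of_nonpos (by linarith [hs.2]), neg_sub]
  have p2 : ∫ s in t₁..τ, a / (a + |s - t₁|) = ∫ s in (0 : ℝ)..(τ - t₁), a / (a + s) := by
    have := intervalIntegral.integral_comp_sub_right (a := t₁) (b := τ)
      (fun s : ℝ => a / (a + s)) t₁
    simp only [sub_self] at this
    rw [← this]
    refine intervalIntegral.integral_congr fun s hs => ?_
    rw [uIcc_of_le h1] at hs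
    rw [abs_of_nonneg (by linarith [hs.1])]
  rw [p1, p2]
  have := hlog t₁ h0 h1
  have := hlog (τ - t₁) (by linarith) (by linarith)
  linarith

end LogIntegral

/-! ### Increments of functions with an integrable weak gradient. -/

section WeakGradient

variable {d J : ℕ}

lemma measurePreserving_shear (η : Wave d) :
    MeasurePreserving (fun p : ℝ × Wave d => (p.1, p.2 + p.1 • η))
      (((volume : Measure ℝ).restrict (Ioc 0 1)).prod volume)
      (((volume : Measure ℝ).restrict (Ioc 0 1)).prod volume) := by
  refine (MeasurePreserving.id _).skew_product (g := fun (s : ℝ) (k : Wave d) => k + s • η) ?_ ?_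
  · exact measurable_snd.add (measurable_fst.smul_const η)
  · exact Filter.Eventually.of_forall fun s => (measurePreserving_add_right volume _).map_eq

lemma integrable_shear {F : Type*} [NormedAddCommGroup F] {g : Wave d → F}
    (hg : Integrable g volume) (η : Wave d) :
    Integrable (fun p : ℝ × Wave d => g (p.2 + p.1 • η))
      (((volume : Measure ℝ).restrict (Ioc 0 1)).prod volume) :=
  (measurePreserving_shear η).integrable_comp_of_integrable (hg.comp_snd _)

/-- The increments of a function with a weak gradient. -/
lemma HasWeakGradient.ae_sub_eq {f : Wave d → Val J} {G : Wave d → Wave d →L[ℝ] Val J}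
    (h : HasWeakGradient f G) (hf : Integrable f volume) (hG : Integrable G volume) (η : Wave d) :
    ∀ᵐ k, (∫ s in Ioc (0 : ℝ) 1, G (k + s • η) η) = f (k + η) - f k := by
  have hGη : Integrable (fun k => G k η) volume :=
    (ContinuousLinearMap.apply ℝ (Val J) η).integrable_comp hG
  have hsh := integrable_shear hGη η
  -- Both sides are tested against `φ`. Fubini and the definition of the weak gradient move the
  -- derivative to the translated test function, and the fundamental theorem of calculus along the
  -- segment is applied to `φ` alone, so that `f` is never regularized.
  refine ae_eq_of_integral_contDiff_smul_eq (μ := volume) ?_ ?_ fun φ hφ hφc => ?_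
  · exact hsh.swap.integral_prod_left.locallyIntegrable
  · exact ((hf.comp_add_right η).sub hf).locallyIntegrable
  · obtain ⟨Cφ, hCφ⟩ := hφc.exists_bound_of_continuous hφ.continuous
    have hφ1 : ContDiff ℝ 1 φ := hφ.of_le (by exact_mod_cast le_top)
    have hdφ : Continuous (fderiv ℝ φ) := hφ1.continuous_fderiv one_ne_zero
    obtain ⟨Dφ, hDφ⟩ := (hφc.fderiv ℝ).exists_bound_of_continuous hdφ
    have e1 : ∫ k, φ k • ∫ s in Ioc (0 : ℝ) 1, G (k + s • η) η
        = ∫ s in Ioc (0 : ℝ) 1, ∫ k, φ k • G (k + s • η) η := by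
      simp_rw [← integral_smul]
      refine integral_integral_swap ?_
      refine (hsh.swap).bdd_smul (φ := fun p : Wave d × ℝ => φ p.1) Cφ ?_ ?_
      · exact (hφ.continuous.comp continuous_fst).aestronglyMeasurable
      · exact Filter.Eventually.of_forall fun p => hCφ _
    have e2 : ∀ s : ℝ, ∫ k, φ k • G (k + s • η) η
        = -∫ k, fderiv ℝ φ (k - s • η) η • f k := by
      intro s
      have h1 := h.byParts (fun k => φ (k - s • η)) (hφ.comp (contDiff_id.sub contDiff_const))
        (hφc.comp_homeomorph (Homeomorph.subRight (s • η))) η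
      have h2 : ∀ k, fderiv ℝ (fun k => φ (k - s • η)) k = fderiv ℝ φ (k - s • η) := fun k => by
        rw [fderiv_comp_sub]
      simp_rw [h2] at h1
      rw [h1, neg_neg, ← integral_add_right_eq_self (fun k => φ (k - s • η) • G k η) (s • η)]
      simp only [add_sub_cancel_right]
    have e3 : ∫ s in Ioc (0 : ℝ) 1, ∫ k, fderiv ℝ φ (k - s • η) η • f k
        = ∫ k, ∫ s in Ioc (0 : ℝ) 1, fderiv ℝ φ (k - s • η) η • f k := by
      refine integral_integral_swap ?_
      refine (hf.comp_snd _).bdd_smul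
        (φ := fun p : ℝ × Wave d => fderiv ℝ φ (p.2 - p.1 • η) η) (Dφ * ‖η‖) ?_ ?_
      · have : Continuous fun p : ℝ × Wave d => fderiv ℝ φ (p.2 - p.1 • η) η := by fun_prop
        exact this.aestronglyMeasurable
      · exact Filter.Eventually.of_forall fun p =>
          ((fderiv ℝ φ _).le_opNorm _).trans (by gcongr; exact hDφ _)
    have e4 : ∀ k, ∫ s in Ioc (0 : ℝ) 1, fderiv ℝ φ (k - s • η) η • f k
        = (φ k - φ (k - η)) • f k := by
      intro k
      rw [integral_smul_const, ← intervalIntegral.integral_of_le zero_le_one]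
      congr 1
      have hd : ∀ s ∈ uIcc (0 : ℝ) 1, HasDerivAt (fun s : ℝ => -φ (k - s • η))
          (fderiv ℝ φ (k - s • η) η) s := by
        intro s _
        have h1 : HasDerivAt (fun s : ℝ => k - s • η) (-η) s := by
          simpa using ((hasDerivAt_id s).smul_const η).const_sub k
        have h2 := ((hφ1.differentiable one_ne_zero) (k - s • η)).hasFDerivAt.comp_hasDerivAt s h1
        have h3 := h2.neg
        rw [map_neg, neg_neg] at h3
        exact h3
      rw [intervalIntegral.integral_eq_sub_of_hasDerivAt hd]
      · simp; ring
      · have : Continuous fun s : ℝ => fderiv ℝ φ (k - s • η) η := by fun_prop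
        exact this.intervalIntegrable _ _
    have i1 : Integrable (fun k => φ k • f k) volume :=
      hf.bdd_smul Cφ hφ.continuous.aestronglyMeasurable (Filter.Eventually.of_forall hCφ)
    have i2 : Integrable (fun k => φ (k - η) • f k) volume :=
      hf.bdd_smul Cφ
        (hφ.continuous.comp (continuous_id.sub continuous_const)).aestronglyMeasurable
        (Filter.Eventually.of_forall fun k => hCφ _)
    have i3 : Integrable (fun k => φ k • f (k + η)) volume := by
      simpa using i2.comp_add_right η
    rw [e1]
    simp_rw [e2]
    rw [integral_neg, e3]
    simp_rw [e4, sub_smul, smul_sub]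
    rw [integral_sub i1 i2, integral_sub i3 i1, neg_sub]
    congr 1
    rw [← integral_add_right_eq_self (fun k => φ (k - η) • f k) η]
    simp

/-- The increment is an average of `G` over the segment, and by translation invariance every point
of the segment contributes the same integral. The gradient bound on wavepackets is used only in this
integrated form. -/
lemma HasWeakGradient.integral_norm_sub_le {f : Wave d → Val J} {G : Wave d → Wave d →L[ℝ] Val J}
    (h : HasWeakGradient f G) (hf : Integrable f volume) (hG : Integrable G volume) (η : Wave d) :
    ∫ k, ‖f (k + η) - f k‖ ≤ ‖η‖ * ∫ k, ‖G k‖ := by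
  have hsh := (integrable_shear hG.norm η).const_mul ‖η‖
  have h1 : ∀ᵐ k, ‖f (k + η) - f k‖ ≤ ∫ s in Ioc (0 : ℝ) 1, ‖η‖ * ‖G (k + s • η)‖ := by
    filter_upwards [h.ae_sub_eq hf hG η, hsh.swap.prod_right_ae] with k hk hk2
    rw [← hk]
    refine norm_integral_le_of_norm_le hk2 (Filter.Eventually.of_forall fun s => ?_)
    exact ((G _).le_opNorm η).trans_eq (mul_comm _ _)
  refine (integral_mono_ae ((hf.comp_add_right η).sub hf).norm
    hsh.swap.integral_prod_left h1).trans ?_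
  have h2 : ∫ k, ∫ s in Ioc (0 : ℝ) 1, ‖η‖ * ‖G (k + s • η)‖
      = ∫ s in Ioc (0 : ℝ) 1, ∫ k, ‖η‖ * ‖G (k + s • η)‖ := integral_integral_swap hsh.swap
  change ∫ k, ∫ s in Ioc (0 : ℝ) 1, ‖η‖ * ‖G (k + s • η)‖ ≤ _
  rw [h2]
  have h3 : ∀ s : ℝ, ∫ k, ‖η‖ * ‖G (k + s • η)‖ = ‖η‖ * ∫ k, ‖G k‖ := fun s => by
    rw [integral_const_mul, integral_add_right_eq_self (fun k => ‖G k‖)]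
  simp [h3]

end WeakGradient

/-! ### Kernels with phase factors and their comparison by weights. -/

section PhaseKernels

variable {d J m : ℕ}

/-- The weight `min(1, |k - c|)`. -/
def wt (c k : Wave d) : ℝ := min 1 ‖k - c‖

lemma isWeight_wt (c : Wave d) : IsWeight (wt c) :=
  ⟨(by unfold wt; fun_prop : Continuous (wt c)).aestronglyMeasurable,
    fun _ => le_min zero_le_one (norm_nonneg _), fun _ => min_le_left _ _⟩

/-- The kernel `e^{iΘ} a`. -/
def phKer (a : (Fin m → Wave d) → MMap J m) (Θ : (Fin m → Wave d) → ℝ) (κ : Fin m → Wave d) :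
    MMap J m :=
  Complex.exp ((Θ κ : ℂ) * Complex.I) • a κ

lemma isKer_phKer {a : (Fin m → Wave d) → MMap J m} {K : ℝ} (ha : IsKer a K)
    {Θ : (Fin m → Wave d) → ℝ} (hΘ : AEStronglyMeasurable Θ volume) : IsKer (phKer a Θ) K := by
  refine ⟨ha.nonneg, ?_, ?_⟩
  · have : Continuous fun x : ℝ => Complex.exp ((x : ℂ) * Complex.I) := by fun_prop
    exact (this.comp_aestronglyMeasurable hΘ).smul ha.aesm
  · filter_upwards [ha.bound] with κ hκ
    rwa [phKer, norm_smul, Complex.norm_exp_ofReal_mul_I, one_mul]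

lemma phKer_phKer (a : (Fin m → Wave d) → MMap J m) (Θ Θ' : (Fin m → Wave d) → ℝ) :
    phKer (phKer a Θ) Θ' = phKer a (fun κ => Θ κ + Θ' κ) := by
  funext κ
  rw [phKer, phKer, phKer, smul_smul, ← Complex.exp_add]
  congr 2
  push_cast; ring

lemma mulOp_phase_kop (hm : 0 < m) {a : (Fin m → Wave d) → MMap J m} {K : ℝ} (ha : IsKer a K)
    {θ : Wave d → ℝ} (hθ : AEStronglyMeasurable θ volume) (v : Fin m → L1 d J) :
    mulOp (phase θ) (kop a v) = kop (phKer a fun κ => θ (∑ j, κ j)) v := by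
  rw [kop_apply hm ha, kop_apply hm (isKer_phKer ha (aesm_comp_sum hm hθ)),
    mulOp_cv hm (isMult_phase hθ) (ha.integrable v)]
  rfl

lemma aesm_sum_comp_eval {θ : Fin m → Wave d → ℝ} (hθ : ∀ j, AEStronglyMeasurable (θ j) volume) :
    AEStronglyMeasurable (fun κ : Fin m → Wave d => ∑ j, θ j (κ j)) volume :=
  Finset.aestronglyMeasurable_fun_sum _ fun j _ => aesm_comp_eval (hθ j) j

lemma kop_mulOp_phase (hm : 0 < m) {a : (Fin m → Wave d) → MMap J m} {K : ℝ} (ha : IsKer a K)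
    {θ : Fin m → Wave d → ℝ} (hθ : ∀ j, AEStronglyMeasurable (θ j) volume) (v : Fin m → L1 d J) :
    kop a (fun j => mulOp (phase (θ j)) (v j)) = kop (phKer a fun κ => ∑ j, θ j (κ j)) v := by
  rw [kop_apply hm ha, kop_apply hm (isKer_phKer ha (aesm_sum_comp_eval hθ))]
  refine cv_congr hm (ha.integrable _) ?_
  filter_upwards [ae_eval_all fun j => mulOp_coeFn (isMult_phase (hθ j)) (v j)] with κ hκ
  simp only [integrand, hκ, phase_apply, phKer, smul_apply]
  rw [(a κ).map_smul_univ, ← Complex.exp_sum]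
  congr 2
  push_cast [Finset.sum_mul]; rfl

lemma measurePreserving_add_pi (y : Fin m → Wave d) :
    MeasurePreserving (fun κ : Fin m → Wave d => κ + y) volume volume :=
  measurePreserving_add_right volume y

lemma IsKer.shift {a : (Fin m → Wave d) → MMap J m} {K : ℝ} (ha : IsKer a K)
    (y : Fin m → Wave d) : IsKer (fun κ => a (κ + y)) K :=
  ⟨ha.nonneg, ha.aesm.comp_measurePreserving (measurePreserving_add_pi y),
    (measurePreserving_add_pi y).quasiMeasurePreserving.ae ha.bound⟩

lemma translate_kop (hm : 0 < m) {a : (Fin m → Wave d) → MMap J m} {K : ℝ} (ha : IsKer a K)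
    (y : Fin m → Wave d) (v : Fin m → L1 d J) :
    translate (∑ j, y j) (kop a v)
      = kop (fun κ => a (κ + y)) (fun j => translate (y j) (v j)) := by
  rw [kop_apply hm ha, kop_apply hm (ha.shift y), translate_cv hm (ha.integrable v)]
  refine cv_congr hm (integrable_comp_add (ha.integrable v) y) ?_
  filter_upwards [ae_eval_all fun j => translate_coeFn (y j) (v j)] with κ hκ
  simp only [integrand, hκ]
  rfl

/-- Comparison of two kernels on functions whose supports are taken into account. -/
lemma norm_kop_sub_smul_le (hm : 0 < m) {a a' : (Fin m → Wave d) → MMap J m} {K K' : ℝ}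
    (ha : IsKer a K) (ha' : IsKer a' K') (z : ℂ) {c : Fin m → Wave d} (v : Fin m → L1 d J)
    {R μ L b : ℝ} (hL : 0 ≤ L) (hb : 0 ≤ b) (hR : ∀ j, ‖v j‖ ≤ R)
    (hμ : ∀ j, wmom (wt (c j)) (v j) ≤ μ)
    (h : ∀ᵐ κ, (∀ j, v j (κ j) ≠ 0) → ‖a κ - z • a' κ‖ ≤ L * ∑ j, wt (c j) (κ j) + b) :
    ‖kop a v - z • kop a' v‖ ≤ L * (m * (μ * R ^ (m - 1))) + b * R ^ m := by
  have i1 := ha.integrable v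
  have i2 : Integrable (fun κ => z • integrand a' v κ) volume := (ha'.integrable v).smul z
  rw [kop_apply hm ha, kop_apply hm ha', ← cv_smul hm z (ha'.integrable v)]
  rw [← cv_sub hm i1 i2]
  refine norm_cv_le_of_weight hm (i1.sub i2) (fun j => isWeight_wt (c j)) v hL hb hR hμ ?_
  filter_upwards [h] with κ hκ
  by_cases hz : ∃ j, v j (κ j) = 0
  · obtain ⟨j, hj⟩ := hz
    have h1 : integrand a v κ = 0 := (a κ).map_coord_zero j hj
    have h2 : integrand a' v κ = 0 := (a' κ).map_coord_zero j hj
    change ‖integrand a v κ - z • integrand a' v κ‖ ≤ _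
    rw [h1, h2, smul_zero, sub_zero, norm_zero]
    have : 0 ≤ ∑ j, wt (c j) (κ j) := Finset.sum_nonneg fun j _ => (isWeight_wt (c j)).nonneg _
    positivity
  · push Not at hz
    refine (((a κ - z • a' κ).le_opNorm fun j => v j (κ j)).trans ?_)
    gcongr
    exact hκ hz

lemma norm_exp_sub_exp_le (x y : ℝ) :
    ‖Complex.exp ((x : ℂ) * Complex.I) - Complex.exp ((y : ℂ) * Complex.I)‖ ≤ |x - y| := by
  have h1 : Complex.exp ((x : ℂ) * Complex.I) - Complex.exp ((y : ℂ) * Complex.I)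
      = Complex.exp ((y : ℂ) * Complex.I) * (Complex.exp (Complex.I * ((x - y : ℝ) : ℂ)) - 1) := by
    rw [mul_sub, mul_one, ← Complex.exp_add]
    congr 2
    push_cast; ring
  rw [h1, norm_mul, Complex.norm_exp_ofReal_mul_I, one_mul]
  exact Real.norm_exp_I_mul_ofReal_sub_one_le

/-- Since `e^{iπ} = -1`, the sum measures how far the two phases are from exact opposition. -/
lemma norm_exp_add_exp_le (x y : ℝ) :
    ‖Complex.exp ((x : ℂ) * Complex.I) + Complex.exp ((y : ℂ) * Complex.I)‖ ≤ |x - y - Real.pi| := by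
  have h1 : Complex.exp (((y + Real.pi : ℝ) : ℂ) * Complex.I)
      = -Complex.exp ((y : ℂ) * Complex.I) := by
    rw [Complex.ofReal_add, add_mul, Complex.exp_add, Complex.exp_pi_mul_I]; ring
  have h2 := norm_exp_sub_exp_le x (y + Real.pi)
  rw [h1, sub_neg_eq_add] at h2
  rwa [sub_sub]

lemma norm_exp_sub_smul_le_two (x y : ℝ) (z : ℂ) (hz : ‖z‖ = 1) :
    ‖Complex.exp ((x : ℂ) * Complex.I) - z * Complex.exp ((y : ℂ) * Complex.I)‖ ≤ 2 := by
  refine (norm_sub_le _ _).trans ?_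
  rw [norm_mul, hz, Complex.norm_exp_ofReal_mul_I, Complex.norm_exp_ofReal_mul_I]
  norm_num

/-- A function Lipschitz near `c` and bounded satisfies a global weighted bound. -/
lemma le_mul_sum_wt {c κ : Fin m → Wave d} {x C K ρ : ℝ} (hρ : 0 < ρ) (hρ1 : ρ ≤ 1) (hC : 0 ≤ C)
    (hK : 0 ≤ K) (hx : x ≤ K) (h : (∀ j, ‖κ j - c j‖ < ρ) → x ≤ C * ∑ j, ‖κ j - c j‖) :
    x ≤ (C + K / ρ) * ∑ j, wt (c j) (κ j) := by
  have hw : ∀ j, 0 ≤ wt (c j) (κ j) := fun j => (isWeight_wt (c j)).nonneg _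
  have hs : 0 ≤ ∑ j, wt (c j) (κ j) := Finset.sum_nonneg fun j _ => hw j
  by_cases hκ : ∀ j, ‖κ j - c j‖ < ρ
  · have : ∑ j, ‖κ j - c j‖ = ∑ j, wt (c j) (κ j) :=
      Finset.sum_congr rfl fun j _ => (min_eq_right ((hκ j).le.trans hρ1)).symm
    have h1 := h hκ
    rw [this] at h1
    have : 0 ≤ K / ρ * ∑ j, wt (c j) (κ j) := by positivity
    linarith
  · push Not at hκ
    obtain ⟨i, hi⟩ := hκ
    have h1 : ρ ≤ ∑ j, wt (c j) (κ j) :=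
      (le_min hρ1 hi).trans (Finset.single_le_sum (f := fun j => wt (c j) (κ j))
        (fun j _ => hw j) (Finset.mem_univ i))
    have h2 : K ≤ K / ρ * ∑ j, wt (c j) (κ j) := by
      calc K = K / ρ * ρ := by field_simp
        _ ≤ _ := by gcongr
    have : 0 ≤ C * ∑ j, wt (c j) (κ j) := by positivity
    linarith

end PhaseKernels

/-! ### Susceptibilities near the centres, and propagation of polarized functions. -/

section Freezing

variable {d J : ℕ} {A : LinearPart d J} {B : Nonlinearity d J} {Cχ : ℝ}

/-- Near `c` this is smoothness of the susceptibility. Away from `c` some weight is bounded below,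
which pays for the trivial bound `2 Cχ`. -/
lemma exists_ker_lipschitz (hA : A.Admissible) (hB : B.Admissible A Cχ) {m : ℕ}
    (hm : m ∈ B.degrees) {c : Fin m → Wave d} (hc : ∀ j, c j ∉ A.bandCrossing)
    (hs : (∑ j, c j) ∉ A.bandCrossing) :
    ∃ K, 0 ≤ K ∧ ∀ᵐ κ, ‖B.ker m κ - B.ker m c‖ ≤ K * ∑ j, wt (c j) (κ j) := by
  have hm0 : 0 < m := by have := B.two_le m hm; omega
  have hopen : IsOpen {p : Wave d × (Fin m → Wave d) |
      p.1 ∉ A.bandCrossing ∧ ∀ j, p.2 j ∉ A.bandCrossing} := by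
    have e : {p : Wave d × (Fin m → Wave d) | p.1 ∉ A.bandCrossing ∧ ∀ j, p.2 j ∉ A.bandCrossing}
        = Prod.fst ⁻¹' A.bandCrossingᶜ ∩
          ⋂ j, (fun p : Wave d × (Fin m → Wave d) => p.2 j) ⁻¹' A.bandCrossingᶜ := by
      ext κ; simp
    rw [e]
    exact (hA.isClosed.isOpen_compl.preimage continuous_fst).inter
      (isOpen_iInter_of_finite fun j => hA.isClosed.isOpen_compl.preimage (by fun_prop))
  have h1 : ContDiffAt ℝ 1 (fun p : Wave d × (Fin m → Wave d) => B.χ m p.1 p.2) (∑ j, c j, c) :=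
    ((hB.smooth m hm).contDiffAt (hopen.mem_nhds ⟨hs, hc⟩)).of_le (by exact_mod_cast le_top)
  have h2 : ContDiffAt ℝ 1 (fun κ : Fin m → Wave d => (∑ j, κ j, κ)) c := by fun_prop
  have h3 : ContDiffAt ℝ 1 (B.ker m) c :=
    (ContDiffAt.comp (g := fun p : Wave d × (Fin m → Wave d) => B.χ m p.1 p.2)
      (f := fun κ : Fin m → Wave d => (∑ j, κ j, κ)) c h1 h2).const_smul _
  obtain ⟨L, t, ht, hL⟩ := h3.exists_lipschitzOnWith
  obtain ⟨ρ, hρ, hb⟩ := Metric.mem_nhds_iff.1 ht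
  have hker := isKer_ker hA hB hm
  refine ⟨L + 2 * Cχ / min ρ 1, add_nonneg L.2 (div_nonneg (by linarith [hker.nonneg])
    (by positivity)), ?_⟩
  filter_upwards [hker.bound] with κ hκ
  refine le_mul_sum_wt (by positivity) (min_le_right _ _) L.2 (by linarith [hker.nonneg]) ?_ ?_
  · refine (norm_sub_le _ _).trans ?_
    have := norm_ker_le hB hm hs hc
    linarith
  · intro hκc
    have hmem : κ ∈ Metric.ball c ρ := by
      rw [mem_ball_iff_norm, pi_norm_lt_iff hρ]
      exact fun j => (hκc j).trans_le (min_le_left _ _)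
    refine (hL.norm_sub_le (hb hmem) (mem_of_mem_nhds ht)).trans ?_
    refine mul_le_mul_of_nonneg_left ?_ L.2
    refine (pi_norm_le_iff_of_nonneg (Finset.sum_nonneg fun _ _ => norm_nonneg _)).2 fun j => ?_
    exact Finset.single_le_sum (f := fun j => ‖κ j - c j‖) (fun _ _ => norm_nonneg _)
      (Finset.mem_univ j)

/-- The phase `(t/ϱ) ω_i`. -/
def omPhase (A : LinearPart d J) (ϱ t : ℝ) (i : Fin J × ℤˣ) (k : Wave d) : ℝ := t / ϱ * A.om i k

lemma aesm_omPhase (hA : A.Admissible) (ϱ t : ℝ) (i : Fin J × ℤˣ) :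
    AEStronglyMeasurable (omPhase A ϱ t i) volume :=
  (hA.aestronglyMeasurable_om i).const_mul _

lemma prop_eq_of_proj (hA : A.Admissible) (ϱ t : ℝ) {i : Fin J × ℤˣ} {v : L1 d J}
    (hv : ∀ᵐ k, A.projL i k (v k) = v k) :
    prop A ϱ t v = mulOp (phase (omPhase A ϱ t i)) v := by
  refine L1_ext ?_
  filter_upwards [mulOp_coeFn (isMult_propagator hA ϱ t) v,
    mulOp_coeFn (isMult_phase (aesm_omPhase hA ϱ t i)) v, hv] with k h1 h2 h3
  rw [prop, h1, h2, A.propagator_apply, phase_apply, omPhase]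
  rw [Finset.sum_eq_single i]
  · rw [h3]
  · intro j _ hj
    rw [← h3, A.projL_projL, if_neg hj, smul_zero]
  · simp

end Freezing

/-! ### The weight adapted to the harmonics of a wavevector -/

section Harmonics

variable {d J : ℕ} {A : LinearPart d J} {B : Nonlinearity d J} {Cχ : ℝ}

/-- The distance to the group `ℤ k_*`, truncated at `1`. -/
def harmonicWeight (kstar k : Wave d) : ℝ :=
  min 1 ‖(k : Wave d ⧸ AddSubgroup.zmultiples kstar)‖

lemma isWeight_harmonicWeight (kstar : Wave d) : IsWeight (harmonicWeight kstar) := by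
  refine ⟨Continuous.aestronglyMeasurable ?_, fun _ => le_min zero_le_one (norm_nonneg _),
    fun _ => min_le_left _ _⟩
  unfold harmonicWeight
  fun_prop

/-- The quotient norm is subadditive, and truncation at `1` does no harm because one saturated term
already dominates the left side. This is why the distance is taken to the whole group: unlike `{k_*,
-k_*}`, it is stable under the sums formed by the interactions. -/
lemma harmonicWeight_sum_le (kstar : Wave d) {m : ℕ} (κ : Fin m → Wave d) :
    harmonicWeight kstar (∑ j, κ j) ≤ ∑ j, harmonicWeight kstar (κ j) := by
  have hw := isWeight_harmonicWeight kstar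
  by_cases h : ∃ j, 1 ≤ ‖(κ j : Wave d ⧸ AddSubgroup.zmultiples kstar)‖
  · obtain ⟨j, hj⟩ := h
    refine (hw.le_one _).trans ?_
    have h1 : harmonicWeight kstar (κ j) = 1 := min_eq_left hj
    rw [← h1]
    exact Finset.single_le_sum (f := fun j => harmonicWeight kstar (κ j))
      (fun j _ => hw.nonneg _) (Finset.mem_univ j)
  · push Not at h
    refine (min_le_right _ _).trans ?_
    have h2 : ((∑ j, κ j : Wave d) : Wave d ⧸ AddSubgroup.zmultiples kstar)
        = ∑ j, (κ j : Wave d ⧸ AddSubgroup.zmultiples kstar) :=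
      map_sum (QuotientAddGroup.mk' (AddSubgroup.zmultiples kstar)) κ Finset.univ
    rw [h2]
    refine (norm_sum_le _ _).trans (Finset.sum_le_sum fun j _ => ?_)
    exact le_min (h j).le le_rfl

lemma sgn_smul_mem_zmultiples (ζ : ℤˣ) (kstar : Wave d) :
    sgn ζ • kstar ∈ AddSubgroup.zmultiples kstar :=
  ⟨(ζ : ℤ), (Int.cast_smul_eq_zsmul ℝ (ζ : ℤ) kstar).symm⟩

lemma harmonicWeight_le (ζ : ℤˣ) (kstar k : Wave d) :
    harmonicWeight kstar k ≤ ‖k - sgn ζ • kstar‖ := by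
  refine (min_le_right _ _).trans ?_
  rw [QuotientAddGroup.norm_mk, ← dist_eq_norm]
  exact Metric.infDist_le_dist_of_mem (sgn_smul_mem_zmultiples ζ kstar)

/-- Radius of balls around `± k_*` that are well separated from the other harmonics. -/
def sepRadius (kstar : Wave d) : ℝ := if kstar = 0 then 1 else min 1 (‖kstar‖ / 2)

lemma sepRadius_pos (kstar : Wave d) : 0 < sepRadius kstar := by
  unfold sepRadius
  split_ifs with h
  · exact one_pos
  · have := norm_pos_iff.2 h; positivity

/-- Every harmonic other than `ζ k_*` is at distance at least `‖k_*‖` from it, so within half this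
distance `ζ k_*` is the nearest point of the group. -/
lemma wt_le_harmonicWeight (ζ : ℤˣ) {kstar k : Wave d}
    (hk : ‖k - sgn ζ • kstar‖ < sepRadius kstar) :
    wt (sgn ζ • kstar) k ≤ harmonicWeight kstar k := by
  refine min_le_min_left _ ?_
  rw [QuotientAddGroup.norm_mk, Metric.le_infDist ⟨_, sgn_smul_mem_zmultiples ζ kstar⟩]
  rintro y ⟨n, rfl⟩
  simp only
  rw [dist_eq_norm]
  by_cases hn : n • kstar = sgn ζ • kstar
  · rw [hn]
  · have h0 : kstar ≠ 0 := fun h => hn (by simp [h])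
    have hne : n ≠ (ζ : ℤ) := fun h => hn (by rw [h, sgn, Int.cast_smul_eq_zsmul])
    rw [sepRadius, if_neg h0] at hk
    have h1 : ‖kstar‖ ≤ ‖n • kstar - sgn ζ • kstar‖ := by
      have : n • kstar - sgn ζ • kstar = ((n - (ζ : ℤ) : ℤ) : ℝ) • kstar := by
        rw [← Int.cast_smul_eq_zsmul ℝ n kstar, sgn]; push_cast; rw [sub_smul]
      rw [this, norm_smul, Real.norm_eq_abs]
      refine le_mul_of_one_le_left (norm_nonneg _) ?_
      exact_mod_cast Int.one_le_abs (sub_ne_zero.2 hne)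
    have h2 : ‖n • kstar - sgn ζ • kstar‖ ≤ ‖k - sgn ζ • kstar‖ + ‖k - n • kstar‖ := by
      rw [norm_sub_rev k (n • kstar), add_comm]
      exact (norm_sub_le_norm_sub_add_norm_sub _ k _)
    have h3 := hk.trans_le (min_le_right _ _)
    linarith

/-- A weight as a multiplier. -/
def weightMult (w : Wave d → ℝ) (k : Wave d) : Val J →L[ℂ] Val J :=
  (w k : ℂ) • ContinuousLinearMap.id ℂ (Val J)

lemma IsWeight.isMult {w : Wave d → ℝ} (hw : IsWeight w) :
    IsMult (weightMult w : Wave d → Val J →L[ℂ] Val J) := by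
  refine isMult_of_norm_apply_le ?_ fun k u => ?_
  · have : Continuous fun x : ℝ => (x : ℂ) • ContinuousLinearMap.id ℂ (Val J) := by fun_prop
    exact this.comp_aestronglyMeasurable hw.aesm
  · rw [weightMult, smul_apply, norm_smul, Complex.norm_real, Real.norm_eq_abs,
      abs_of_nonneg (hw.nonneg k)]
    exact mul_le_of_le_one_left (norm_nonneg _) (hw.le_one k)

lemma IsWeight.wmom_eq {w : Wave d → ℝ} (hw : IsWeight w) (f : L1 d J) :
    wmom w f = ‖mulOp (weightMult w) f‖ := by
  rw [norm_mulOp_apply hw.isMult, wmom]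
  refine integral_congr_ae (Filter.Eventually.of_forall fun k => ?_)
  simp only [weightMult, smul_apply]
  rw [norm_smul, Complex.norm_real, Real.norm_eq_abs, abs_of_nonneg (hw.nonneg k)]
  rfl

lemma wmom_prop (hA : A.Admissible) (w : Wave d → ℝ) (ϱ t : ℝ) (f : L1 d J) :
    wmom w (prop A ϱ t f) = wmom w f := by
  refine integral_congr_ae ?_
  filter_upwards [mulOp_coeFn (isMult_propagator hA ϱ t) f] with k hk
  rw [prop, hk, A.norm_propagator_apply]

/-- Propagators are pointwise isometries and do not change the moment. By subadditivity the weight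
of the output is distributed over the `m` arguments, and counting them reproduces the Lipschitz
constant `lip`. -/
lemma wmom_slowL1_le (hA : A.Admissible) (hB : B.Admissible A Cχ) (ϱ t : ℝ) (kstar : Wave d)
    {u : L1 d J} {r : ℝ} (hu : ‖u‖ ≤ r) :
    wmom (harmonicWeight kstar) (B.slowL1 A ϱ t u)
      ≤ lip B Cχ r * wmom (harmonicWeight kstar) u := by
  have hw := isWeight_harmonicWeight kstar
  rw [slowL1_eq hA hB, wmom_prop hA, hw.wmom_eq, map_sum, lip, Finset.mul_sum, Finset.sum_mul]
  refine (norm_sum_le _ _).trans (Finset.sum_le_sum fun m hm => ?_)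
  have hm0 : 0 < m := by have := B.two_le m hm; omega
  have hker := isKer_ker hA hB hm
  set f : Fin m → L1 d J := fun _ => prop A ϱ (-t) u with hf
  rw [kop_apply hm0 hker, mulOp_cv hm0 hw.isMult (hker.integrable f)]
  refine (norm_cv_le_of_weight hm0 (integrable_mult_sum hm0 hw.isMult (hker.integrable f))
    (fun _ => hw) f hker.nonneg le_rfl (R := r) (μ := wmom (harmonicWeight kstar) u)
    (fun _ => (norm_prop hA ϱ (-t) u).trans_le hu) (fun _ => (wmom_prop hA _ ϱ (-t) u).le)
    ?_).trans_eq (by ring)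
  filter_upwards [hker.norm_integrand_le f] with κ hκ
  rw [weightMult, smul_apply, norm_smul, Complex.norm_real, Real.norm_eq_abs,
    abs_of_nonneg (hw.nonneg _), add_zero, mul_comm Cχ, mul_assoc]
  refine mul_le_mul (harmonicWeight_sum_le kstar κ) hκ (norm_nonneg _)
    (Finset.sum_nonneg fun j _ => hw.nonneg _)

/-- The moment is the norm of a bounded multiplier applied to `u`, so it passes under the time
integral and Grönwall applies. The resulting factor does not depend on `ϱ`. -/
lemma IsSolution.wmom_le (hA : A.Admissible) (hB : B.Admissible A Cχ) {ϱ τs R : ℝ} (hR : 0 < R)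
    {g : L1 d J} {u : ℝ → L1 d J} (hu : IsSolution A B ϱ τs R g u) (kstar : Wave d) :
    ∀ t ∈ Icc 0 τs, wmom (harmonicWeight kstar) (u t)
      ≤ wmom (harmonicWeight kstar) g * Real.exp (lip B Cχ (2 * R) * τs) := by
  have hw := isWeight_harmonicWeight kstar
  refine gronwall_integral (φ := fun t => wmom (harmonicWeight kstar) (u t)) (hw.wmom_nonneg g)
    (lip_nonneg hA hB (by positivity)) ?_ (fun _ _ => hw.wmom_nonneg _) fun t ht => ?_
  · simp_rw [hw.wmom_eq]
    exact ((mulOp _).continuous.comp_continuousOn hu.continuousOn).norm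
  · have hc := continuousOn_slowL1 hA hB ϱ hu.continuousOn
    have hi := intervalIntegrable_of_continuousOn hc ht
    have e1 : mulOp (weightMult (harmonicWeight kstar)) (u t)
        = mulOp (weightMult (harmonicWeight kstar)) g
          + ∫ s in (0 : ℝ)..t, mulOp (weightMult (harmonicWeight kstar)) (B.slowL1 A ϱ s (u s)) := by
      rw [hu.equation t ht, map_add, ContinuousLinearMap.intervalIntegral_comp_comm _ hi]
    simp only [hw.wmom_eq]
    rw [e1]
    refine (norm_add_le _ _).trans (add_le_add le_rfl ?_)
    rw [← intervalIntegral.integral_const_mul]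
    refine intervalIntegral.norm_integral_le_of_norm_le ht.1 ?_ ?_
    · refine Filter.Eventually.of_forall fun s hs => ?_
      have hs' := Icc_subset_of_mem ht (Ioc_subset_Icc_self hs)
      rw [← hw.wmom_eq, ← hw.wmom_eq]
      exact wmom_slowL1_le hA hB ϱ s kstar (hu.bound s hs')
    · exact (intervalIntegrable_of_continuousOn
        ((mulOp _).continuous.comp_continuousOn hu.continuousOn).norm ht).const_mul _

end Harmonics

/-! ### Oscillatory operators and non-resonant cancellation in time. -/

section Oscillatory

variable {d J m : ℕ} {A : LinearPart d J} {B : Nonlinearity d J} {Cχ : ℝ}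

/-- The frequency mismatch `ω_i(κ_1 + … + κ_m) - ω_{ι_1}(κ_1) - … - ω_{ι_m}(κ_m)`. -/
def mismatch (A : LinearPart d J) (i : Fin J × ℤˣ) (ι : Fin m → Fin J × ℤˣ) (κ : Fin m → Wave d) :
    ℝ :=
  A.om i (∑ j, κ j) - ∑ j, A.om (ι j) (κ j)

/-- The oscillatory operator with frozen susceptibility `a`. -/
def osc (A : LinearPart d J) (ϱ s : ℝ) (i : Fin J × ℤˣ) (ι : Fin m → Fin J × ℤˣ) (a : MMap J m) :
    ContinuousMultilinearMap ℂ (fun _ : Fin m => L1 d J) (L1 d J) :=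
  kop (phKer (fun _ => a) fun κ => s / ϱ * mismatch A i ι κ)

variable (i : Fin J × ℤˣ) (ι : Fin m → Fin J × ℤˣ)

lemma aesm_mismatch (hA : A.Admissible) (hm : 0 < m) :
    AEStronglyMeasurable (mismatch A i ι) volume :=
  (aesm_comp_sum hm (hA.aestronglyMeasurable_om i)).sub
    (aesm_sum_comp_eval fun j => hA.aestronglyMeasurable_om (ι j))

lemma isKer_osc (hA : A.Admissible) (hm : 0 < m) (ϱ s : ℝ) (a : MMap J m) :
    IsKer (phKer (fun _ => a) fun κ => s / ϱ * mismatch A i ι κ) ‖a‖ :=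
  isKer_phKer (isKer_const a) ((aesm_mismatch i ι hA hm).const_mul _)

lemma norm_osc_le (hA : A.Admissible) (hm : 0 < m) (ϱ s : ℝ) (a : MMap J m) :
    ‖osc A ϱ s i ι a‖ ≤ ‖a‖ :=
  norm_kop_le hm (isKer_osc i ι hA hm ϱ s a)

lemma phase_mismatch (ϱ s : ℝ) (κ : Fin m → Wave d) :
    ∑ j, omPhase A ϱ (-s) (ι j) (κ j) + omPhase A ϱ s i (∑ j, κ j)
      = s / ϱ * mismatch A i ι κ := by
  simp only [omPhase, mismatch, ← Finset.mul_sum]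
  ring

/-- The mismatch separates into phases of the output and of the individual arguments; continuity in
`s` follows from strong continuity of the corresponding multipliers. -/
lemma osc_apply_eq (hA : A.Admissible) (hm : 0 < m) (ϱ s : ℝ) (a : MMap J m) (v : Fin m → L1 d J) :
    osc A ϱ s i ι a v = mulOp (phase (omPhase A ϱ s i))
      (kop (fun _ => a) fun j => mulOp (phase (omPhase A ϱ (-s) (ι j))) (v j)) := by
  have hΘ := fun j => aesm_omPhase hA ϱ (-s) (ι j)
  rw [kop_mulOp_phase hm (isKer_const a) hΘ,
    mulOp_phase_kop hm (isKer_phKer (isKer_const a) (aesm_sum_comp_eval hΘ))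
      (aesm_omPhase hA ϱ s i), phKer_phKer, osc]
  simp_rw [phase_mismatch]

lemma continuous_phase_omPhase (ϱ : ℝ) {f : ℝ → ℝ} (hf : Continuous f) (k : Wave d) :
    Continuous fun s => (phase (omPhase A ϱ (f s) i) k : Val J →L[ℂ] Val J) := by
  unfold phase omPhase
  fun_prop

lemma continuousOn_osc (hA : A.Admissible) (hm : 0 < m) (ϱ : ℝ) (a : MMap J m) {I : Set ℝ}
    {v : Fin m → ℝ → L1 d J} (hv : ∀ j, ContinuousOn (v j) I) :
    ContinuousOn (fun s => osc A ϱ s i ι a fun j => v j s) I := by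
  simp_rw [osc_apply_eq i ι hA hm]
  refine continuousOn_mulOp_apply (fun t => isMult_phase (aesm_omPhase hA ϱ t i))
    (Filter.Eventually.of_forall fun k => continuous_phase_omPhase i ϱ continuous_id k) ?_
  refine (kop fun _ => a).cont.comp_continuousOn (continuousOn_pi.2 fun j => ?_)
  exact continuousOn_mulOp_apply (fun t => isMult_phase (aesm_omPhase hA ϱ (-t) (ι j)))
    (Filter.Eventually.of_forall fun k => continuous_phase_omPhase (ι j) ϱ continuous_neg k) (hv j)

lemma exists_eventually_om_lipschitz (hA : A.Admissible) {c : Wave d} (hc : c ∉ A.bandCrossing) :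
    ∃ C > 0, ∀ᶠ k in nhds c, |A.om i k - A.om i c| ≤ C * ‖k - c‖ := by
  obtain ⟨C, hC, ρ, hρ, h⟩ := hA.exists_perturbation hc
  refine ⟨C, hC, Metric.eventually_nhds_iff.2 ⟨ρ, hρ, fun k hk => (h k ?_ i).2.2⟩⟩
  rwa [← dist_eq_norm]

lemma exists_eventually_projL_lipschitz (hA : A.Admissible) {c : Wave d}
    (hc : c ∉ A.bandCrossing) :
    ∃ C, 0 ≤ C ∧ ∀ᶠ k in nhds c, ‖A.projL i k - A.projL i c‖ ≤ C * ‖k - c‖ := by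
  obtain ⟨C, hC, ρ, hρ, h⟩ := hA.exists_perturbation hc
  refine ⟨C, hC.le, Metric.eventually_nhds_iff.2 ⟨ρ, hρ, fun k hk => (h k ?_ i).2.1⟩⟩
  rwa [← dist_eq_norm]

lemma exists_eventually_om_expansion (hA : A.Admissible) {c : Wave d} (hc : c ∉ A.bandCrossing) :
    ∃ C > 0, ∀ᶠ p : Wave d × Wave d in nhds (c, 0),
      |A.om i (p.1 + p.2) - A.om i p.1 - inner ℝ (gradient (A.om i) c) p.2|
        ≤ C * ‖p.2‖ * (‖p.2‖ + ‖p.1 - c‖) := by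
  obtain ⟨C, hC, ρ, hρ, h⟩ := hA.exists_om_expansion hc i
  refine ⟨C, hC, Metric.eventually_nhds_iff.2 ⟨ρ, hρ, fun p hp => h p.1 p.2 ?_ ?_⟩⟩
  · rw [← dist_eq_norm]; exact (le_max_left _ _).trans_lt hp
  · rw [← dist_zero_right]; exact (le_max_right _ _).trans_lt hp

lemma norm_smul_sub_smul_smul (x y z : ℂ) (a : MMap J m) :
    ‖x • a - z • y • a‖ = ‖a‖ * ‖x - z * y‖ := by
  have h : x • a - z • y • a = (x - z * y) • a := by
    rw [smul_smul]; exact (sub_smul x (z * y) a).symm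
  rw [h, norm_smul, mul_comm]

lemma norm_sum_sub_le (κ c : Fin m → Wave d) :
    ‖∑ j, κ j - ∑ j, c j‖ ≤ ∑ j, ‖κ j - c j‖ := by
  rw [← Finset.sum_sub_distrib]; exact norm_sum_le _ _

variable {c : Fin m → Wave d}

lemma exists_mismatch_lipschitz (hA : A.Admissible) (hc : ∀ j, c j ∉ A.bandCrossing)
    (hs : (∑ j, c j) ∉ A.bandCrossing) :
    ∃ C, 0 ≤ C ∧ ∀ᶠ κ in nhds c,
      |mismatch A i ι κ - mismatch A i ι c| ≤ C * ∑ j, ‖κ j - c j‖ := by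
  obtain ⟨C, hC, h⟩ := exists_eventually_om_lipschitz i hA hs
  choose D hD h' using fun j => exists_eventually_om_lipschitz (ι j) hA (hc j)
  have hS : Continuous fun κ : Fin m → Wave d => ∑ j, κ j := by fun_prop
  refine ⟨C + ∑ j, D j, add_nonneg hC.le (Finset.sum_nonneg fun j _ => (hD j).le), ?_⟩
  filter_upwards [hS.continuousAt.eventually h, Filter.eventually_all.2 fun j =>
    (continuous_apply j).continuousAt.eventually (h' j)] with κ h1 h2
  have e : mismatch A i ι κ - mismatch A i ι c = (A.om i (∑ j, κ j) - A.om i (∑ j, c j))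
      - ∑ j, (A.om (ι j) (κ j) - A.om (ι j) (c j)) := by
    rw [mismatch, mismatch, Finset.sum_sub_distrib]; ring
  rw [e, add_mul]
  refine (abs_sub _ _).trans (add_le_add ?_ ?_)
  · exact h1.trans (mul_le_mul_of_nonneg_left (norm_sum_sub_le κ c) hC.le)
  · rw [Finset.sum_mul]
    refine (Finset.abs_sum_le_sum_abs _ _).trans (Finset.sum_le_sum fun j _ => ?_)
    refine (h2 j).trans (mul_le_mul_of_nonneg_left ?_ (hD j).le)
    exact Finset.single_le_sum (f := fun j => ‖κ j - c j‖) (fun _ _ => norm_nonneg _)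
      (Finset.mem_univ j)

lemma exists_le_mul_sum_wt {x : (Fin m → Wave d) → ℝ} {C K : ℝ} (hC : 0 ≤ C) (hK : 0 ≤ K)
    (hx : ∀ κ, x κ ≤ K) (h : ∀ᶠ κ in nhds c, x κ ≤ C * ∑ j, ‖κ j - c j‖) :
    ∃ K', 0 ≤ K' ∧ ∀ κ, x κ ≤ K' * ∑ j, wt (c j) (κ j) := by
  obtain ⟨ρ, hρ, hb⟩ := Metric.eventually_nhds_iff.1 h
  refine ⟨C + K / min ρ 1, by positivity, fun κ => ?_⟩
  refine le_mul_sum_wt (by positivity) (min_le_right _ _) hC hK (hx κ) fun hκ => hb ?_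
  rw [dist_eq_norm, pi_norm_lt_iff hρ]
  exact fun j => (hκ j).trans_le (min_le_left _ _)

/-- Cancellation of the non-resonant oscillations. -/
lemma exists_norm_integral_osc_le (hA : A.Admissible) (hm : 0 < m)
    (hc : ∀ j, c j ∉ A.bandCrossing) (hs : (∑ j, c j) ∉ A.bandCrossing)
    (hne : mismatch A i ι c ≠ 0) (a : MMap J m) {R M τs : ℝ} (hR : 0 ≤ R) (hM : 0 ≤ M)
    (hτs : 0 ≤ τs) :
    ∃ K, 0 ≤ K ∧ ∀ (ϱ μ : ℝ) (v : Fin m → ℝ → L1 d J), 0 < ϱ → 0 ≤ μ →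
      (∀ j, ∀ t ∈ Icc 0 τs, ‖v j t‖ ≤ R) →
      (∀ j, ∀ t ∈ Icc 0 τs, wmom (wt (c j)) (v j t) ≤ μ) →
      (∀ j, ∀ t ∈ Icc 0 τs, ∀ t' ∈ Icc 0 τs, ‖v j t - v j t'‖ ≤ M * |t - t'|) →
      ∀ t ∈ Icc 0 τs, ‖∫ s in (0 : ℝ)..t, osc A ϱ s i ι a fun j => v j s‖ ≤ K * (ϱ + μ) := by
  set Φ := mismatch A i ι c with hΦ
  have hΦ0 : 0 < |Φ| := abs_pos.2 hne
  obtain ⟨C, hC, hlip⟩ := exists_mismatch_lipschitz i ι hA hc hs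
  -- The minimum with `2` records the trivial bound on a sum of two phases. It makes the local
  -- Lipschitz estimate of the mismatch usable for all `κ`.
  obtain ⟨L, hL, hker⟩ := exists_le_mul_sum_wt (c := c)
    (x := fun κ => min 2 (Real.pi / |Φ| * |mismatch A i ι κ - Φ|)) (C := Real.pi / |Φ| * C)
    (K := 2) (by positivity) (by norm_num) (fun κ => min_le_left _ _) (by
      filter_upwards [hlip] with κ hκ
      refine (min_le_right _ _).trans ?_
      rw [mul_assoc]
      gcongr)
  set K₁ := ‖a‖ * R ^ m * (Real.pi / |Φ|) + ‖a‖ * m * R ^ (m - 1) * M * (Real.pi / |Φ|) * τs with hK₁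
  set K₂ := ‖a‖ * L * m * R ^ (m - 1) * τs with hK₂
  have hK₁0 : 0 ≤ K₁ := by positivity
  have hK₂0 : 0 ≤ K₂ := by positivity
  refine ⟨K₁ + K₂, by positivity, fun ϱ μ v hϱ hμ0 hvR hvμ hvM t ht => ?_⟩
  -- Half the period of `e^{i s Φ / ϱ}`.
  have hh : 0 < Real.pi * ϱ / |Φ| := by positivity
  have hvc : ∀ j, ContinuousOn (v j) (Icc 0 τs) := fun j =>
    LipschitzOnWith.continuousOn (K := ⟨M, hM⟩)
      (LipschitzOnWith.of_dist_le_mul fun x hx y hy => by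
        rw [dist_eq_norm, Real.dist_eq]; exact hvM j x hx y hy)
  have main := norm_integral_le_of_half_period (Y := fun s => osc A ϱ s i ι a fun j => v j s)
    (τ := τs) (K := ‖a‖ * R ^ m) (h := Real.pi * ϱ / |Φ|)
    (e := ‖a‖ * m * R ^ (m - 1) * (M * (Real.pi * ϱ / |Φ|)) + ‖a‖ * L * (m * (μ * R ^ (m - 1))))
    hh (by positivity) (by positivity) (continuousOn_osc i ι hA hm ϱ a hvc)
    (fun s hs => norm_apply_le_pow _ (norm_osc_le i ι hA hm ϱ s a) hR fun j => hvR j s hs)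
    (fun s hs hs' => ?_) t ht
  · refine main.trans ?_
    have h1 : ‖a‖ * R ^ m * (Real.pi * ϱ / |Φ|) + (‖a‖ * m * R ^ (m - 1) *
        (M * (Real.pi * ϱ / |Φ|)) + ‖a‖ * L * (m * (μ * R ^ (m - 1)))) * τs
        = K₁ * ϱ + K₂ * μ := by rw [hK₁, hK₂]; ring
    rw [h1]
    nlinarith [mul_nonneg hK₁0 hμ0, mul_nonneg hK₂0 hϱ.le]
  · set h := Real.pi * ϱ / |Φ| with hh_def
    -- The arguments are brought back from `s + h` to `s` by their Lipschitz bound in time. With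
    -- equal arguments, the kernels at the two times then cancel up to the deviation of the mismatch
    -- from `Φ`.
    have h1 : ‖(osc A ϱ (s + h) i ι a fun j => v j (s + h)) - osc A ϱ (s + h) i ι a fun j => v j s‖
        ≤ ‖a‖ * m * R ^ (m - 1) * (M * h) := by
      refine norm_apply_sub_le _ (norm_osc_le i ι hA hm ϱ (s + h) a) hR (by positivity)
        (fun j => hvR j _ hs') (fun j => hvR j s hs) fun j => (hvM j _ hs' s hs).trans_eq ?_
      rw [add_sub_cancel_left, abs_of_pos hh]
    have h2 := norm_kop_sub_smul_le hm (isKer_osc i ι hA hm ϱ (s + h) a)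
      (isKer_osc i ι hA hm ϱ s a) (-1) (c := c) (fun j => v j s) (R := R) (μ := μ)
      (L := ‖a‖ * L) (b := 0) (by positivity) le_rfl (fun j => hvR j s hs) (fun j => hvμ j s hs) (by
        refine Filter.Eventually.of_forall fun κ _ => ?_
        rw [phKer, phKer, norm_smul_sub_smul_smul, neg_one_mul, sub_neg_eq_add, add_zero, mul_assoc]
        refine mul_le_mul_of_nonneg_left (le_trans (le_min ?_ ?_) (hker κ)) (norm_nonneg a)
        · refine (norm_add_le _ _).trans_eq ?_
          rw [Complex.norm_exp_ofReal_mul_I, Complex.norm_exp_ofReal_mul_I]; norm_num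
        · have e1 : ∀ Ψ : ℝ, (s + h) / ϱ * Ψ - s / ϱ * Ψ = Real.pi / |Φ| * Ψ := fun Ψ => by
            rw [hh_def]; field_simp; ring
          -- For negative `Φ` the phase decreases by `π` over the half-period, so the two
          -- exponentials exchange roles.
          rcases lt_or_gt_of_ne hne with hneg | hpos
          · rw [add_comm]
            refine (norm_exp_add_exp_le _ _).trans_eq ?_
            have e2 := e1 (mismatch A i ι κ)
            rw [← abs_of_pos (show 0 < Real.pi / |Φ| by positivity), ← abs_mul, mul_sub, ← e2,
              abs_of_neg hneg, ← abs_neg]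
            congr 1
            have : Φ ≠ 0 := hne
            field_simp
            ring
          · refine (norm_exp_add_exp_le _ _).trans_eq ?_
            have e2 := e1 (mismatch A i ι κ)
            rw [← abs_of_pos (show 0 < Real.pi / |Φ| by positivity), ← abs_mul, mul_sub, ← e2,
              abs_of_pos hpos]
            congr 1
            have : Φ ≠ 0 := hne
            field_simp)
    rw [neg_smul, one_smul, sub_neg_eq_add, zero_mul, add_zero] at h2
    have e : ((osc A ϱ (s + h) i ι a fun j => v j (s + h)) + osc A ϱ s i ι a fun j => v j s)
        = ((osc A ϱ (s + h) i ι a fun j => v j (s + h)) - osc A ϱ (s + h) i ι a fun j => v j s)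
          + ((osc A ϱ (s + h) i ι a fun j => v j s) + osc A ϱ s i ι a fun j => v j s) := by abel
    show ‖(osc A ϱ (s + h) i ι a fun j => v j (s + h)) + osc A ϱ s i ι a fun j => v j s‖ ≤ _
    rw [e]
    exact (norm_add_le _ _).trans (add_le_add h1 h2)

end Oscillatory

/-! ### Effect of modulated translations on oscillatory operators. -/

section Shifts

variable {d J m : ℕ} {A : LinearPart d J} {B : Nonlinearity d J} {Cχ : ℝ}

/-- Translation combined with modulation: `f ↦ e^{i r·y} f(· + y)`. -/
def mtrans (r y : Wave d) : L1 d J →L[ℂ] L1 d J :=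
  Complex.exp (((inner ℝ r y : ℝ) : ℂ) * Complex.I) • (translate y).toContinuousLinearMap

lemma mtrans_apply (r y : Wave d) (f : L1 d J) :
    mtrans r y f = Complex.exp (((inner ℝ r y : ℝ) : ℂ) * Complex.I) • translate y f := rfl

lemma norm_mtrans (r y : Wave d) (f : L1 d J) : ‖mtrans r y f‖ = ‖f‖ := by
  rw [mtrans_apply, norm_smul, Complex.norm_exp_ofReal_mul_I, one_mul, LinearIsometry.norm_map]

/-- Translation and modulation by a vector `(y_1, …, y_m)` of shifts. -/
lemma smul_translate_kop (hm : 0 < m) {a : (Fin m → Wave d) → MMap J m} {K : ℝ} (ha : IsKer a K)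
    (r y : Fin m → Wave d) (v : Fin m → L1 d J) :
    Complex.exp (((∑ j, inner ℝ (r j) (y j) : ℝ) : ℂ) * Complex.I) • translate (∑ j, y j) (kop a v)
      = kop (fun κ => a (κ + y)) fun j => mtrans (r j) (y j) (v j) := by
  simp only [mtrans_apply]
  rw [translate_kop hm ha, ContinuousMultilinearMap.map_smul_univ, ← Complex.exp_sum]
  congr 2
  push_cast [Finset.sum_mul]; rfl

variable (i : Fin J × ℤˣ) (ι : Fin m → Fin J × ℤˣ) {c : Fin m → Wave d}

/-- The linearization of the mismatch at the centres `c`. -/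
def mismatchSlope (A : LinearPart d J) (i : Fin J × ℤˣ) (ι : Fin m → Fin J × ℤˣ)
    (c y : Fin m → Wave d) : ℝ :=
  inner ℝ (gradient (A.om i) (∑ j, c j)) (∑ j, y j)
    - ∑ j, inner ℝ (gradient (A.om (ι j)) (c j)) (y j)

/-- The slope consists of group velocities at the centres only, so that under a shift the phase
changes by a constant factor up to the displayed error. -/
lemma exists_mismatch_expansion (hA : A.Admissible) (hc : ∀ j, c j ∉ A.bandCrossing)
    (hs : (∑ j, c j) ∉ A.bandCrossing) :
    ∃ C, 0 ≤ C ∧ ∃ ρ > 0, ∀ κ y : Fin m → Wave d, ∀ q, (∀ j, ‖κ j - c j‖ < ρ) → q < ρ →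
      (∀ j, ‖y j‖ ≤ q) →
      |mismatch A i ι (κ + y) - mismatch A i ι κ - mismatchSlope A i ι c y|
        ≤ C * q * (q + ∑ j, ‖κ j - c j‖) := by
  obtain ⟨C, hC, h⟩ := exists_eventually_om_expansion i hA hs
  choose D hD h' using fun j => exists_eventually_om_expansion (ι j) hA (hc j)
  have hS : Continuous fun p : (Fin m → Wave d) × (Fin m → Wave d) => (∑ j, p.1 j, ∑ j, p.2 j) := by
    fun_prop
  have hE : ∀ j, Continuous fun p : (Fin m → Wave d) × (Fin m → Wave d) => (p.1 j, p.2 j) :=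
    fun j => by fun_prop
  have tS := hS.tendsto (c, 0)
  have tE := fun j => (hE j).tendsto (c, 0)
  simp only [Pi.zero_apply, Finset.sum_const_zero] at tS tE
  have h1 : ∀ᶠ p : (Fin m → Wave d) × (Fin m → Wave d) in nhds (c, 0),
      |A.om i (∑ j, p.1 j + ∑ j, p.2 j) - A.om i (∑ j, p.1 j)
        - inner ℝ (gradient (A.om i) (∑ j, c j)) (∑ j, p.2 j)|
        ≤ C * ‖∑ j, p.2 j‖ * (‖∑ j, p.2 j‖ + ‖∑ j, p.1 j - ∑ j, c j‖) :=
    tS.eventually h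
  have h2 : ∀ᶠ p : (Fin m → Wave d) × (Fin m → Wave d) in nhds (c, 0), ∀ j,
      |A.om (ι j) (p.1 j + p.2 j) - A.om (ι j) (p.1 j)
        - inner ℝ (gradient (A.om (ι j)) (c j)) (p.2 j)|
        ≤ D j * ‖p.2 j‖ * (‖p.2 j‖ + ‖p.1 j - c j‖) :=
    Filter.eventually_all.2 fun j => (tE j).eventually (h' j)
  obtain ⟨ρ, hρ, hb⟩ := Metric.eventually_nhds_iff.1 (h1.and h2)
  refine ⟨C * (m * (m + 1)) + ∑ j, D j, add_nonneg (by positivity)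
    (Finset.sum_nonneg fun j _ => (hD j).le), ρ, hρ, fun κ y q hκ hq hy => ?_⟩
  by_cases hm : m = 0
  · subst hm
    simp [mismatch, mismatchSlope]
  have hq0 : 0 ≤ q := (norm_nonneg _).trans (hy ⟨0, Nat.pos_of_ne_zero hm⟩)
  have hmem : dist (κ, y) (c, 0) < ρ := by
    rw [Prod.dist_eq, max_lt_iff]
    constructor
    · rw [dist_eq_norm, pi_norm_lt_iff hρ]; exact hκ
    · rw [dist_zero_right, pi_norm_lt_iff hρ]; exact fun j => (hy j).trans_lt hq
  obtain ⟨g1, g2⟩ := hb hmem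
  simp only at g1 g2
  set σκ := ∑ j, ‖κ j - c j‖ with hsum
  have hsum0 : 0 ≤ σκ := Finset.sum_nonneg fun _ _ => norm_nonneg _
  have hY : ‖∑ j, y j‖ ≤ m * q := by
    refine (norm_sum_le _ _).trans ((Finset.sum_le_card_nsmul _ _ _ fun j _ => hy j).trans_eq ?_)
    rw [Finset.card_univ, Fintype.card_fin, nsmul_eq_mul]
  have e : mismatch A i ι (κ + y) - mismatch A i ι κ - mismatchSlope A i ι c y
      = (A.om i (∑ j, κ j + ∑ j, y j) - A.om i (∑ j, κ j)
        - inner ℝ (gradient (A.om i) (∑ j, c j)) (∑ j, y j))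
        - ∑ j, (A.om (ι j) (κ j + y j) - A.om (ι j) (κ j)
          - inner ℝ (gradient (A.om (ι j)) (c j)) (y j)) := by
    simp only [mismatch, mismatchSlope, Pi.add_apply, Finset.sum_sub_distrib,
      Finset.sum_add_distrib]
    ring
  have hmpos : (0 : ℝ) ≤ m := Nat.cast_nonneg m
  rw [e, add_mul, add_mul]
  refine (abs_sub _ _).trans (add_le_add (g1.trans ?_) ?_)
  · calc C * ‖∑ j, y j‖ * (‖∑ j, y j‖ + ‖∑ j, κ j - ∑ j, c j‖)
        ≤ C * (m * q) * (m * q + σκ) := by gcongr; exact norm_sum_sub_le κ c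
      _ ≤ C * (m * q) * ((m + 1) * (q + σκ)) := by
          gcongr
          nlinarith
      _ = _ := by ring
  · rw [Finset.sum_mul, Finset.sum_mul]
    refine (Finset.abs_sum_le_sum_abs _ _).trans (Finset.sum_le_sum fun j _ => (g2 j).trans ?_)
    have h3 : ‖κ j - c j‖ ≤ σκ := Finset.single_le_sum (f := fun j => ‖κ j - c j‖)
      (fun _ _ => norm_nonneg _) (Finset.mem_univ j)
    have := (hD j).le
    gcongr
    · exact hy j
    · exact hy j

/-- The expansion error times `s/ϱ` controls small shifts of arguments close to the centres.
Everything else falls under the trivial bound `2`, covered by the weight if an argument is far away,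
and by `q²/ϱ` if `q` is not small, since `ϱ ≤ 1`. -/
lemma exists_norm_exp_mismatch_shift_le (hA : A.Admissible) (hc : ∀ j, c j ∉ A.bandCrossing)
    (hs : (∑ j, c j) ∉ A.bandCrossing) {τs : ℝ} (hτs : 0 ≤ τs) :
    ∃ K, 0 ≤ K ∧ ∀ (ϱ s q : ℝ) (y κ : Fin m → Wave d), 0 < ϱ → ϱ ≤ 1 → s ∈ Icc 0 τs → 0 ≤ q →
      (∀ j, ‖y j‖ ≤ q) →
      ‖Complex.exp (((s / ϱ * mismatch A i ι (κ + y) : ℝ) : ℂ) * Complex.I)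
        - Complex.exp (((s / ϱ * mismatchSlope A i ι c y : ℝ) : ℂ) * Complex.I)
          * Complex.exp (((s / ϱ * mismatch A i ι κ : ℝ) : ℂ) * Complex.I)‖
        ≤ K * (q / ϱ + 1) * ∑ j, wt (c j) (κ j) + K * (q ^ 2 / ϱ) := by
  obtain ⟨C, hC, ρ₀, hρ₀, h⟩ := exists_mismatch_expansion i ι hA hc hs
  set ρ := min ρ₀ 1 with hρ
  have hρ0 : 0 < ρ := by positivity
  -- The summands serve, in order, the expansion error, arguments far from the centres, and shifts
  -- with `q ≥ ρ`.
  set K := τs * C + 2 / ρ + 2 / ρ ^ 2 with hK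
  have hKC : τs * C ≤ K := by
    have : 0 ≤ 2 / ρ + 2 / ρ ^ 2 := by positivity
    linarith
  have hK1 : 2 / ρ ≤ K := by
    have : 0 ≤ τs * C + 2 / ρ ^ 2 := by positivity
    linarith
  have hK2 : 2 / ρ ^ 2 ≤ K := by
    have : 0 ≤ τs * C + 2 / ρ := by positivity
    linarith
  have hK0 : 0 ≤ K := by positivity
  refine ⟨K, hK0, fun ϱ s q y κ hϱ hϱ1 hs hq hy => ?_⟩
  set x := ‖Complex.exp (((s / ϱ * mismatch A i ι (κ + y) : ℝ) : ℂ) * Complex.I)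
        - Complex.exp (((s / ϱ * mismatchSlope A i ι c y : ℝ) : ℂ) * Complex.I)
          * Complex.exp (((s / ϱ * mismatch A i ι κ : ℝ) : ℂ) * Complex.I)‖ with hx
  have hx2 : x ≤ 2 := norm_exp_sub_smul_le_two _ _ _ (Complex.norm_exp_ofReal_mul_I _)
  have hw : 0 ≤ ∑ j, wt (c j) (κ j) := Finset.sum_nonneg fun j _ => (isWeight_wt (c j)).nonneg _
  rcases lt_or_ge q ρ with hqρ | hqρ
  · have hb : 0 ≤ K * (q ^ 2 / ϱ) := by positivity
    have h1 := le_mul_sum_wt (c := c) (κ := κ) (x := x - K * (q ^ 2 / ϱ)) (C := K * (q / ϱ))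
      (K := 2) (ρ := ρ) hρ0 (min_le_right _ _) (by positivity) (by norm_num) (by linarith)
      fun hκ => ?_
    · have h2 : K * (q / ϱ) + 2 / ρ ≤ K * (q / ϱ + 1) := by linarith
      have h3 := mul_le_mul_of_nonneg_right h2 hw
      linarith
    · have h2 := h κ y q (fun j => (hκ j).trans_le (min_le_left _ _))
        (hqρ.trans_le (min_le_left _ _)) hy
      have h3 : x ≤ |s / ϱ * mismatch A i ι (κ + y)
          - (s / ϱ * mismatchSlope A i ι c y + s / ϱ * mismatch A i ι κ)| := by
        rw [hx, ← Complex.exp_add, ← add_mul, ← Complex.ofReal_add]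
        exact norm_exp_sub_exp_le _ _
      have h4 : s / ϱ * mismatch A i ι (κ + y)
          - (s / ϱ * mismatchSlope A i ι c y + s / ϱ * mismatch A i ι κ)
          = s / ϱ * (mismatch A i ι (κ + y) - mismatch A i ι κ - mismatchSlope A i ι c y) := by ring
      have hs0 : 0 ≤ s / ϱ := div_nonneg hs.1 hϱ.le
      rw [h4, abs_mul, abs_of_nonneg hs0] at h3
      have hsum0 : 0 ≤ ∑ j, ‖κ j - c j‖ := Finset.sum_nonneg fun _ _ => norm_nonneg _
      have h5 : s / ϱ * (C * q * (q + ∑ j, ‖κ j - c j‖))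
          ≤ K * (q / ϱ) * ∑ j, ‖κ j - c j‖ + K * (q ^ 2 / ϱ) := by
        have h6 : s * C ≤ K := (mul_le_mul_of_nonneg_right hs.2 hC).trans hKC
        calc s / ϱ * (C * q * (q + ∑ j, ‖κ j - c j‖))
            = (s * C) * ((q / ϱ) * (q + ∑ j, ‖κ j - c j‖)) := by ring
          _ ≤ K * ((q / ϱ) * (q + ∑ j, ‖κ j - c j‖)) := by gcongr
          _ = _ := by ring
      have := h3.trans (mul_le_mul_of_nonneg_left h2 hs0)
      linarith
  · have h1 : 2 ≤ K * (q ^ 2 / ϱ) := by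
      calc (2 : ℝ) = 2 / ρ ^ 2 * ρ ^ 2 := by field_simp
        _ ≤ K * (q ^ 2 / ϱ) := by
            gcongr
            rw [le_div_iff₀ hϱ]
            nlinarith [sq_nonneg ρ, pow_le_pow_left₀ hρ0.le hqρ 2]
    have : 0 ≤ K * (q / ϱ + 1) * ∑ j, wt (c j) (κ j) := by positivity
    linarith

/-- Effect of shifts of the arguments on the oscillatory operators. -/
lemma exists_norm_shift_osc_sub_le (hA : A.Admissible) (hm : 0 < m)
    (hc : ∀ j, c j ∉ A.bandCrossing) (hs : (∑ j, c j) ∉ A.bandCrossing) (a : MMap J m) {R τs : ℝ}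
    (hR : 0 ≤ R) (hτs : 0 ≤ τs) :
    ∃ K, 0 ≤ K ∧ ∀ (ϱ s q D μ : ℝ) (r y : Fin m → Wave d) (v : Fin m → L1 d J), 0 < ϱ → ϱ ≤ 1 →
      s ∈ Icc 0 τs → 0 ≤ q → (∀ j, ‖y j‖ ≤ q) → (∀ j, ‖v j‖ ≤ R) →
      (∀ j, wmom (wt (c j)) (v j) ≤ μ) → (∀ j, ‖mtrans (r j) (y j) (v j) - v j‖ ≤ D) →
      ‖Complex.exp (((∑ j, inner ℝ (r j) (y j) : ℝ) : ℂ) * Complex.I)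
            • translate (∑ j, y j) (osc A ϱ s i ι a v)
          - Complex.exp (((s / ϱ * mismatchSlope A i ι c y : ℝ) : ℂ) * Complex.I)
            • osc A ϱ s i ι a v‖
        ≤ K * (D + (q / ϱ + 1) * μ + q ^ 2 / ϱ) := by
  obtain ⟨L, hL, h⟩ := exists_norm_exp_mismatch_shift_le i ι hA hc hs hτs
  set K₁ := ‖a‖ * m * R ^ (m - 1) with hK₁
  set K₂ := ‖a‖ * L * (m * R ^ (m - 1)) with hK₂
  set K₃ := ‖a‖ * L * R ^ m with hK₃
  have h1 : 0 ≤ K₁ := by positivity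
  have h2 : 0 ≤ K₂ := by positivity
  have h3 : 0 ≤ K₃ := by positivity
  refine ⟨K₁ + K₂ + K₃, by positivity,
    fun ϱ s q D μ r y v hϱ hϱ1 hs hq hy hvR hvμ hvD => ?_⟩
  have hD : 0 ≤ D := (norm_nonneg _).trans (hvD ⟨0, hm⟩)
  have hμ : 0 ≤ μ := ((isWeight_wt _).wmom_nonneg _).trans (hvμ ⟨0, hm⟩)
  have hker := isKer_osc (A := A) (d := d) i ι hA hm ϱ s a
  set Θ : (Fin m → Wave d) → MMap J m := phKer (fun _ => a) fun κ => s / ϱ * mismatch A i ι κ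
    with hΘ
  have e1 := smul_translate_kop hm hker r y v
  set z := Complex.exp (((s / ϱ * mismatchSlope A i ι c y : ℝ) : ℂ) * Complex.I) with hz
  rw [osc, e1]
  -- The near invariance of the arguments is used first, with the shifted kernel; `g2` then trades
  -- the shifted kernel for the original one times the constant phase `z`.
  have g1 : ‖kop (fun κ => Θ (κ + y)) (fun j => mtrans (r j) (y j) (v j))
      - kop (fun κ => Θ (κ + y)) v‖ ≤ K₁ * D :=
    norm_apply_sub_le _ (norm_kop_le hm (hker.shift y)) hR hD
      (fun j => (norm_mtrans _ _ _).trans_le (hvR j)) hvR hvD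
  have g2 : ‖kop (fun κ => Θ (κ + y)) v - z • kop Θ v‖
      ≤ ‖a‖ * (L * (q / ϱ + 1)) * (m * (μ * R ^ (m - 1))) + ‖a‖ * (L * (q ^ 2 / ϱ)) * R ^ m := by
    refine norm_kop_sub_smul_le hm (hker.shift y) hker z v (by positivity) (by positivity) hvR hvμ
      (Filter.Eventually.of_forall fun κ _ => ?_)
    rw [hΘ, phKer, phKer, norm_smul_sub_smul_smul, mul_assoc ‖a‖, ← mul_add]
    exact mul_le_mul_of_nonneg_left (h ϱ s q y κ hϱ hϱ1 hs hq hy) (norm_nonneg a)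
  refine (norm_sub_le_norm_sub_add_norm_sub _ (kop (fun κ => Θ (κ + y)) v) _).trans
    ((add_le_add g1 g2).trans ?_)
  have e2 : ‖a‖ * (L * (q / ϱ + 1)) * (m * (μ * R ^ (m - 1))) + ‖a‖ * (L * (q ^ 2 / ϱ)) * R ^ m
      = K₂ * ((q / ϱ + 1) * μ) + K₃ * (q ^ 2 / ϱ) := by rw [hK₂, hK₃]; ring
  rw [e2]
  have p1 : 0 ≤ (q / ϱ + 1) * μ := by positivity
  have p2 : 0 ≤ q ^ 2 / ϱ := by positivity
  nlinarith [mul_nonneg h1 p1, mul_nonneg h1 p2, mul_nonneg h2 hD, mul_nonneg h2 p2,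
    mul_nonneg h3 hD, mul_nonneg h3 p1]

end Shifts

/-! ### Freezing the susceptibility and the band projection at the centres. -/

section Freezing

variable {d J m : ℕ} {A : LinearPart d J} {B : Nonlinearity d J} {Cχ : ℝ}

lemma IsKer.comp_mult (hm : 0 < m) {a : (Fin m → Wave d) → MMap J m} {K : ℝ} (ha : IsKer a K)
    {M : Wave d → Val J →L[ℂ] Val J} (hM : IsMult M) :
    IsKer (fun κ => (M (∑ j, κ j)).compContinuousMultilinearMap (a κ)) K := by
  refine ⟨ha.nonneg, ?_, ?_⟩
  · have h : Continuous fun p : (Val J →L[ℂ] Val J) × MMap J m =>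
        p.1.compContinuousMultilinearMap p.2 :=
      (isBoundedBilinearMap_compMultilinear (𝕜 := ℂ) (E := fun _ : Fin m => Val J) (F := Val J)
        (G := Val J)).continuous
    exact h.comp_aestronglyMeasurable ((aesm_comp_sum hm hM.aesm).prodMk ha.aesm)
  · filter_upwards [ha.bound, ae_sum hm hM.bound] with κ h1 h2
    refine (ContinuousLinearMap.norm_compContinuousMultilinearMap_le _ _).trans ?_
    calc ‖M (∑ j, κ j)‖ * ‖a κ‖ ≤ 1 * K := by gcongr
      _ = K := one_mul K

lemma mulOp_kop (hm : 0 < m) {a : (Fin m → Wave d) → MMap J m} {K : ℝ} (ha : IsKer a K)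
    {M : Wave d → Val J →L[ℂ] Val J} (hM : IsMult M) (v : Fin m → L1 d J) :
    mulOp M (kop a v)
      = kop (fun κ => (M (∑ j, κ j)).compContinuousMultilinearMap (a κ)) v := by
  rw [kop_apply hm ha, kop_apply hm (ha.comp_mult hm hM), mulOp_cv hm hM (ha.integrable v)]
  rfl

/-- A multiplier acting only on the band `i`. -/
structure IsBandMult (A : LinearPart d J) (i : Fin J × ℤˣ) (M : Wave d → Val J →L[ℂ] Val J) :
    Prop where
  isMult : IsMult M
  comp_projL : ∀ k j u, M k (A.projL j k u) = if j = i then M k u else 0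

lemma isBandMult_projL (hA : A.Admissible) (i : Fin J × ℤˣ) : IsBandMult A i (A.projL i) := by
  refine ⟨isMult_projL hA i, fun k j u => ?_⟩
  rw [A.projL_projL]
  split_ifs with h1 h2 h2
  · rw [h1]
  · exact absurd h1.symm h2
  · exact absurd h2.symm h1
  · rfl

lemma mulOp_prop_of_isBandMult (hA : A.Admissible) {i : Fin J × ℤˣ}
    {M : Wave d → Val J →L[ℂ] Val J} (hM : IsBandMult A i M) (ϱ s : ℝ) (f : L1 d J) :
    mulOp M (prop A ϱ s f) = mulOp M (mulOp (phase (omPhase A ϱ s i)) f) := by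
  refine L1_ext ?_
  filter_upwards [mulOp_coeFn hM.isMult (prop A ϱ s f),
    mulOp_coeFn hM.isMult (mulOp (phase (omPhase A ϱ s i)) f),
    mulOp_coeFn (isMult_propagator hA ϱ s) f,
    mulOp_coeFn (isMult_phase (aesm_omPhase hA ϱ s i)) f] with k h1 h2 h3 h4
  rw [h1, h2, prop, h3, h4, A.propagator_apply, map_sum, phase_apply, omPhase,
    Finset.sum_eq_single i]
  · rw [map_smul, map_smul, hM.comp_projL, if_pos rfl]
  · intro j _ hj
    rw [map_smul, hM.comp_projL, if_neg hj, smul_zero]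
  · simp

/-- Replacement of the susceptibility by its value at the centres of the wavepackets. -/
lemma exists_norm_sub_osc_le (hA : A.Admissible) (hB : B.Admissible A Cχ) (hm : m ∈ B.degrees)
    {i : Fin J × ℤˣ} {ι : Fin m → Fin J × ℤˣ} {c : Fin m → Wave d}
    (hc : ∀ j, c j ∉ A.bandCrossing) (hs : (∑ j, c j) ∉ A.bandCrossing)
    {M : Wave d → Val J →L[ℂ] Val J} (hM : IsBandMult A i M) {CM : ℝ} (hCM : 0 ≤ CM)
    (hML : ∀ᶠ k in nhds (∑ j, c j), ‖M k - M (∑ j, c j)‖ ≤ CM * ‖k - ∑ j, c j‖) {R : ℝ}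
    (hR : 0 ≤ R) :
    ∃ K, 0 ≤ K ∧ ∀ (ϱ s μ : ℝ) (v : Fin m → L1 d J), (∀ j, ‖v j‖ ≤ R) →
      (∀ j, wmom (wt (c j)) (v j) ≤ μ) → (∀ j, ∀ᵐ k, A.projL (ι j) k (v j k) = v j k) →
      ‖mulOp M (prop A ϱ s (kop (B.ker m) fun j => prop A ϱ (-s) (v j)))
        - osc A ϱ s i ι ((M (∑ j, c j)).compContinuousMultilinearMap (B.ker m c)) v‖ ≤ K * μ := by
  have hm0 : 0 < m := by have := B.two_le m hm; omega
  have hker := isKer_ker hA hB hm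
  have hC := hker.nonneg
  obtain ⟨L₁, hL₁, hχ⟩ := exists_ker_lipschitz hA hB hm hc hs
  set M₀ := M (∑ j, c j) with hM₀
  have hS : Continuous fun κ : Fin m → Wave d => ∑ j, κ j := by fun_prop
  -- The cap `1 + ‖M₀‖` is an almost everywhere bound of `‖M - M₀‖`, because a multiplier has norm
  -- at most one.
  obtain ⟨L₂, hL₂, hMw⟩ := exists_le_mul_sum_wt (c := c)
    (x := fun κ => min (1 + ‖M₀‖) ‖M (∑ j, κ j) - M₀‖) (C := CM) (K := 1 + ‖M₀‖) hCM
    (by positivity) (fun κ => min_le_left _ _) (by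
      filter_upwards [hS.continuousAt.eventually hML] with κ hκ
      exact (min_le_right _ _).trans (hκ.trans
        (mul_le_mul_of_nonneg_left (norm_sum_sub_le κ c) hCM)))
  refine ⟨(L₂ * Cχ + ‖M₀‖ * L₁) * (m * R ^ (m - 1)), by positivity, fun ϱ s μ v hvR hvμ hv => ?_⟩
  have hΘ := fun j => aesm_omPhase hA ϱ (-s) (ι j)
  have hk1 := isKer_phKer hker (aesm_sum_comp_eval hΘ)
  have hmm : AEStronglyMeasurable (fun κ : Fin m → Wave d => s / ϱ * mismatch A i ι κ) volume :=
    (aesm_mismatch i ι hA hm0).const_mul _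
  have hk2 : IsKer (phKer (B.ker m) fun κ => s / ϱ * mismatch A i ι κ) Cχ := isKer_phKer hker hmm
  have e1 : (fun j => prop A ϱ (-s) (v j)) = fun j => mulOp (phase (omPhase A ϱ (-s) (ι j))) (v j) :=
    funext fun j => prop_eq_of_proj hA ϱ (-s) (hv j)
  rw [mulOp_prop_of_isBandMult hA hM, e1, kop_mulOp_phase hm0 hker hΘ,
    mulOp_phase_kop hm0 hk1 (aesm_omPhase hA ϱ s i), phKer_phKer]
  simp_rw [phase_mismatch]
  rw [mulOp_kop hm0 hk2 hM.isMult]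
  have := norm_kop_sub_smul_le hm0 (hk2.comp_mult hm0 hM.isMult)
    (isKer_osc i ι hA hm0 ϱ s (M₀.compContinuousMultilinearMap (B.ker m c))) 1 (c := c) v
    (R := R) (μ := μ) (L := L₂ * Cχ + ‖M₀‖ * L₁) (b := 0) (by positivity) le_rfl hvR hvμ (by
      filter_upwards [hχ, hker.bound, ae_sum hm0 hM.isMult.bound] with κ h1 h2 h3 _
      have e2 : ∀ z : ℂ, (M (∑ j, κ j)).compContinuousMultilinearMap (z • B.ker m κ)
          - (1 : ℂ) • z • M₀.compContinuousMultilinearMap (B.ker m c)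
          = z • ((M (∑ j, κ j) - M₀).compContinuousMultilinearMap (B.ker m κ)
            + M₀.compContinuousMultilinearMap (B.ker m κ - B.ker m c)) := by
        intro z
        ext1 w
        simp [smul_sub]
      rw [phKer, phKer, e2, norm_smul, Complex.norm_exp_ofReal_mul_I, one_mul, add_zero, add_mul]
      refine (norm_add_le _ _).trans (add_le_add ?_ ?_)
      · refine (ContinuousLinearMap.norm_compContinuousMultilinearMap_le _ _).trans ?_
        have h4 : ‖M (∑ j, κ j) - M₀‖ ≤ L₂ * ∑ j, wt (c j) (κ j) := by
          refine le_trans (le_min ?_ le_rfl) (hMw κ)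
          exact (norm_sub_le _ _).trans (by linarith)
        calc ‖M (∑ j, κ j) - M₀‖ * ‖B.ker m κ‖
            ≤ (L₂ * ∑ j, wt (c j) (κ j)) * Cχ := by gcongr; exact (norm_nonneg _).trans h4
          _ = _ := by ring
      · refine (ContinuousLinearMap.norm_compContinuousMultilinearMap_le _ _).trans ?_
        rw [mul_assoc]
        gcongr)
  rw [one_smul, zero_mul, add_zero] at this
  refine this.trans_eq ?_
  ring

end Freezing

/-! ### Interactions of wave families and their non-resonant parts. -/

section Interaction

variable {d J m : ℕ} {A : LinearPart d J} {B : Nonlinearity d J} {Cχ : ℝ}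

/-- The interaction `e^{isL/ϱ} F̂^{(m)}(e^{-isL/ϱ} w_1, …, e^{-isL/ϱ} w_m)`. -/
def interaction (A : LinearPart d J) (B : Nonlinearity d J) (ϱ s : ℝ) (w : Fin m → L1 d J) :
    L1 d J :=
  prop A ϱ s (kop (B.ker m) fun j => prop A ϱ (-s) (w j))

lemma continuousOn_interaction (hA : A.Admissible) (ϱ : ℝ) {I : Set ℝ} {w : Fin m → ℝ → L1 d J}
    (hw : ∀ j, ContinuousOn (w j) I) :
    ContinuousOn (fun s => interaction A B ϱ s fun j => w j s) I := by
  refine continuousOn_prop_apply hA ϱ continuous_id ?_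
  refine (kop (B.ker m)).cont.comp_continuousOn (continuousOn_pi.2 fun j => ?_)
  exact continuousOn_prop_apply hA ϱ continuous_neg (hw j)

lemma slowL1_sum (hA : A.Admissible) (hB : B.Admissible A Cχ) (ϱ s : ℝ) {Λ : Type*} [Fintype Λ]
    [DecidableEq Λ] (v : Λ → L1 d J) :
    B.slowL1 A ϱ s (∑ l, v l)
      = ∑ m ∈ B.degrees, ∑ lam : Fin m → Λ, interaction A B ϱ s fun j => v (lam j) := by
  rw [slowL1_eq hA hB, map_sum]
  refine Finset.sum_congr rfl fun m _ => ?_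
  have h := (kop (B.ker m)).map_sum (α := fun _ => Λ) fun _ l => prop A ϱ (-s) (v l)
  simp_rw [map_sum]
  rw [h, map_sum]
  rfl

lemma norm_integral_sub_integral_le {X : Type*} [NormedAddCommGroup X] [NormedSpace ℝ X]
    {f g : ℝ → X} {τ e : ℝ} (he : 0 ≤ e) (hf : ContinuousOn f (Icc 0 τ))
    (hg : ContinuousOn g (Icc 0 τ)) (h : ∀ s ∈ Icc 0 τ, ‖f s - g s‖ ≤ e) :
    ∀ t ∈ Icc 0 τ, ‖(∫ s in (0 : ℝ)..t, f s) - ∫ s in (0 : ℝ)..t, g s‖ ≤ e * τ := by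
  intro t ht
  rw [← intervalIntegral.integral_sub (intervalIntegrable_of_continuousOn hf ht)
    (intervalIntegrable_of_continuousOn hg ht)]
  refine (intervalIntegral.norm_integral_le_of_norm_le_const fun s hs => ?_).trans
    (mul_le_mul_of_nonneg_left ?_ he)
  · rw [uIoc_of_le ht.1] at hs
    exact h s (Icc_subset_of_mem ht (Ioc_subset_Icc_self hs))
  · rw [sub_zero, abs_of_nonneg ht.1]; exact ht.2

/-- The families of inputs considered below: bounded, Lipschitz in time, concentrated near the
centres `c` and polarized along the bands `ι`. -/
structure IsWaveFamily (A : LinearPart d J) (τs R M μ : ℝ) {Λ : Type*} (ι : Λ → Fin J × ℤˣ)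
    (c : Λ → Wave d) (v : Λ → ℝ → L1 d J) : Prop where
  norm_le : ∀ l, ∀ t ∈ Icc 0 τs, ‖v l t‖ ≤ R
  lipschitz : ∀ l, ∀ t ∈ Icc 0 τs, ∀ t' ∈ Icc 0 τs, ‖v l t - v l t'‖ ≤ M * |t - t'|
  wmom_le : ∀ l, ∀ t ∈ Icc 0 τs, wmom (wt (c l)) (v l t) ≤ μ
  polarized : ∀ l, ∀ t ∈ Icc 0 τs, ∀ᵐ k, A.projL (ι l) k (v l t k) = v l t k

namespace IsWaveFamily

variable {Λ : Type*} {τs R M μ : ℝ} {ι : Λ → Fin J × ℤˣ} {c : Λ → Wave d} {v : Λ → ℝ → L1 d J}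

lemma comp (h : IsWaveFamily A τs R M μ ι c v) {Λ' : Type*} (f : Λ' → Λ) :
    IsWaveFamily A τs R M μ (fun l => ι (f l)) (fun l => c (f l)) fun l => v (f l) :=
  ⟨fun l => h.norm_le (f l), fun l => h.lipschitz (f l), fun l => h.wmom_le (f l),
    fun l => h.polarized (f l)⟩

lemma mono (h : IsWaveFamily A τs R M μ ι c v) {μ' : ℝ} (hμ : μ ≤ μ') :
    IsWaveFamily A τs R M μ' ι c v :=
  ⟨h.norm_le, h.lipschitz, fun l t ht => (h.wmom_le l t ht).trans hμ, h.polarized⟩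

lemma continuousOn (h : IsWaveFamily A τs R M μ ι c v) (l : Λ) :
    ContinuousOn (v l) (Icc 0 τs) := by
  refine LipschitzOnWith.continuousOn (K := ⟨|M|, abs_nonneg M⟩)
    (LipschitzOnWith.of_dist_le_mul fun x hx y hy => ?_)
  rw [dist_eq_norm, Real.dist_eq]
  exact (h.lipschitz l x hx y hy).trans
    (mul_le_mul_of_nonneg_right (le_abs_self M) (abs_nonneg _))

end IsWaveFamily

/-- A band multiplier applied to an interaction is an oscillatory operator, up to a small error. -/
lemma exists_norm_integral_band_sub_le (hA : A.Admissible) (hB : B.Admissible A Cχ)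
    (hm : m ∈ B.degrees) {i : Fin J × ℤˣ} {ι : Fin m → Fin J × ℤˣ} {c : Fin m → Wave d}
    (hc : ∀ j, c j ∉ A.bandCrossing) (hs : (∑ j, c j) ∉ A.bandCrossing)
    {P : Wave d → Val J →L[ℂ] Val J} (hP : IsBandMult A i P) {CP : ℝ} (hCP : 0 ≤ CP)
    (hPL : ∀ᶠ k in nhds (∑ j, c j), ‖P k - P (∑ j, c j)‖ ≤ CP * ‖k - ∑ j, c j‖) {R M τs : ℝ}
    (hR : 0 ≤ R) (hτs : 0 ≤ τs) :
    ∃ K, 0 ≤ K ∧ ∀ (ϱ μ : ℝ) (v : Fin m → ℝ → L1 d J), 0 ≤ μ → IsWaveFamily A τs R M μ ι c v →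
      ∀ t ∈ Icc 0 τs, ‖(∫ s in (0 : ℝ)..t, mulOp P (interaction A B ϱ s fun j => v j s))
        - ∫ s in (0 : ℝ)..t, osc A ϱ s i ι
            ((P (∑ j, c j)).compContinuousMultilinearMap (B.ker m c)) fun j => v j s‖ ≤ K * μ := by
  have hm0 : 0 < m := by have := B.two_le m hm; omega
  obtain ⟨K, hK, h⟩ := exists_norm_sub_osc_le hA hB hm (ι := ι) hc hs hP hCP hPL hR
  refine ⟨K * τs, by positivity, fun ϱ μ v hμ hv t ht => ?_⟩
  have := norm_integral_sub_integral_le (e := K * μ) (by positivity)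
    ((mulOp P).continuous.comp_continuousOn
      (continuousOn_interaction (B := B) hA ϱ fun j => hv.continuousOn j))
    (continuousOn_osc i ι hA hm0 ϱ ((P (∑ j, c j)).compContinuousMultilinearMap (B.ker m c))
      fun j => hv.continuousOn j)
    (fun s hs => h ϱ s μ (fun j => v j s) (fun j => hv.norm_le j s hs)
      (fun j => hv.wmom_le j s hs) fun j => hv.polarized j s hs) t ht
  refine this.trans_eq ?_
  ring

/-- Smallness of the non-resonant parts of the interactions. -/
lemma exists_norm_integral_band_le (hA : A.Admissible) (hB : B.Admissible A Cχ)
    (hm : m ∈ B.degrees) {i : Fin J × ℤˣ} {ι : Fin m → Fin J × ℤˣ} {c : Fin m → Wave d}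
    (hc : ∀ j, c j ∉ A.bandCrossing) (hs : (∑ j, c j) ∉ A.bandCrossing)
    {P : Wave d → Val J →L[ℂ] Val J} (hP : IsBandMult A i P) {CP : ℝ} (hCP : 0 ≤ CP)
    (hPL : ∀ᶠ k in nhds (∑ j, c j), ‖P k - P (∑ j, c j)‖ ≤ CP * ‖k - ∑ j, c j‖)
    (hne : mismatch A i ι c ≠ 0 ∨ P (∑ j, c j) = 0) {R M τs : ℝ}
    (hR : 0 ≤ R) (hM : 0 ≤ M) (hτs : 0 ≤ τs) :
    ∃ K, 0 ≤ K ∧ ∀ (ϱ μ : ℝ) (v : Fin m → ℝ → L1 d J), 0 < ϱ → 0 ≤ μ →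
      IsWaveFamily A τs R M μ ι c v → ∀ t ∈ Icc 0 τs,
      ‖∫ s in (0 : ℝ)..t, mulOp P (interaction A B ϱ s fun j => v j s)‖ ≤ K * (ϱ + μ) := by
  have hm0 : 0 < m := by have := B.two_le m hm; omega
  obtain ⟨K₁, hK₁, h1⟩ := exists_norm_integral_band_sub_le hA hB hm (ι := ι) hc hs hP hCP hPL
    (M := M) hR hτs
  set a := (P (∑ j, c j)).compContinuousMultilinearMap (B.ker m c) with ha
  obtain ⟨K₂, hK₂, h2⟩ : ∃ K, 0 ≤ K ∧ ∀ (ϱ μ : ℝ) (v : Fin m → ℝ → L1 d J), 0 < ϱ → 0 ≤ μ →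
      IsWaveFamily A τs R M μ ι c v → ∀ t ∈ Icc 0 τs,
      ‖∫ s in (0 : ℝ)..t, osc A ϱ s i ι a fun j => v j s‖ ≤ K * (ϱ + μ) := by
    -- Either the phase oscillates, or the multiplier vanishes at the output centre and the frozen
    -- coefficient is zero.
    rcases hne with hne | h0
    · obtain ⟨K, hK, h⟩ := exists_norm_integral_osc_le i ι hA hm0 hc hs hne a hR hM hτs
      exact ⟨K, hK, fun ϱ μ v hϱ hμ hv => h ϱ μ v hϱ hμ hv.norm_le hv.wmom_le hv.lipschitz⟩
    · refine ⟨0, le_rfl, fun ϱ μ v _ _ _ t _ => le_of_eq ?_⟩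
      have ha0 : a = 0 := by rw [ha, h0]; ext1 w; simp
      have h3 : ∀ s, osc A ϱ s i ι a = 0 := fun s => by
        have := norm_osc_le i ι hA hm0 ϱ s a
        rw [ha0, norm_zero] at this
        rw [ha0]
        exact norm_le_zero_iff.1 this
      simp [h3]
  refine ⟨K₁ + K₂, add_nonneg hK₁ hK₂, fun ϱ μ v hϱ hμ hv t ht => ?_⟩
  have g1 := h1 ϱ μ v hμ hv t ht
  have g2 := h2 ϱ μ v hϱ hμ hv t ht
  have g3 := norm_le_norm_sub_add (∫ s in (0 : ℝ)..t, mulOp P (interaction A B ϱ s fun j => v j s))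
    (∫ s in (0 : ℝ)..t, osc A ϱ s i ι a fun j => v j s)
  have := mul_nonneg hK₁ hϱ.le
  linarith

end Interaction

/-! ### Multipliers attached to one wavevector -/

section Bands

variable {d J : ℕ} {A : LinearPart d J}

lemma isBandMult_indicator (hA : A.Admissible) (i : Fin J × ℤˣ) {s : Set (Wave d)}
    (hs : MeasurableSet s) : IsBandMult A i (s.indicator (A.projL i)) := by
  have h := isBandMult_projL hA i
  refine ⟨⟨h.isMult.aesm.indicator hs, ?_⟩, fun k j u => ?_⟩
  · filter_upwards [h.isMult.bound] with k hk
    exact (norm_indicator_le_norm_self _ _).trans hk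
  · by_cases hk : k ∈ s
    · simp only [indicator_of_mem hk, h.comp_projL]
    · simp [indicator_of_notMem hk]

/-- Off the frontier the indicator is locally constant, so a sharp cutoff is as good as a smooth one
at such a centre. -/
lemma exists_indicator_lipschitz (hA : A.Admissible) (i : Fin J × ℤˣ) {s : Set (Wave d)}
    {c : Wave d} (hc : c ∉ A.bandCrossing) (hcs : c ∉ frontier s) :
    ∃ C, 0 ≤ C ∧ ∀ᶠ k in nhds c,
      ‖s.indicator (A.projL i) k - s.indicator (A.projL i) c‖ ≤ C * ‖k - c‖ := by
  obtain ⟨C, hC, h⟩ := exists_eventually_projL_lipschitz i hA hc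
  refine ⟨C, hC, ?_⟩
  by_cases hs : c ∈ s
  · have hi : s ∈ nhds c := by
      by_contra hn
      exact hcs ⟨subset_closure hs, fun h => hn (mem_interior_iff_mem_nhds.1 h)⟩
    filter_upwards [h, hi] with k hk hks
    rwa [indicator_of_mem hks, indicator_of_mem hs]
  · have hi : sᶜ ∈ nhds c := by
      by_contra hn
      rw [← frontier_compl] at hcs
      exact hcs ⟨subset_closure hs, fun h => hn (mem_interior_iff_mem_nhds.1 h)⟩
    filter_upwards [hi] with k hk
    rw [indicator_of_notMem hk, indicator_of_notMem hs, sub_zero, norm_zero]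
    positivity

lemma eq_or_sepRadius_lt (n : ℤ) (ζ : ℤˣ) (kstar : Wave d) :
    n • kstar = sgn ζ • kstar ∨ sepRadius kstar < ‖n • kstar - sgn ζ • kstar‖ := by
  by_cases hn : n • kstar = sgn ζ • kstar
  · exact Or.inl hn
  · right
    have h0 : kstar ≠ 0 := fun h => hn (by simp [h])
    have hne : n ≠ (ζ : ℤ) := fun h => hn (by rw [h, sgn, Int.cast_smul_eq_zsmul])
    have h1 : ‖kstar‖ ≤ ‖n • kstar - sgn ζ • kstar‖ := by
      have : n • kstar - sgn ζ • kstar = ((n - (ζ : ℤ) : ℤ) : ℝ) • kstar := by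
        rw [← Int.cast_smul_eq_zsmul ℝ n kstar, sgn]; push_cast; rw [sub_smul]
      rw [this, norm_smul, Real.norm_eq_abs]
      refine le_mul_of_one_le_left (norm_nonneg _) ?_
      exact_mod_cast Int.one_le_abs (sub_ne_zero.2 hne)
    have h2 : 0 < ‖kstar‖ := norm_pos_iff.2 h0
    rw [sepRadius, if_neg h0]
    exact (min_le_right _ _).trans_lt (by linarith)

/-- The ball around `ζ k_*` in which the component of sign `ζ` of a wave is concentrated. -/
def waveBall (kstar : Wave d) (ζ : ℤˣ) : Set (Wave d) :=
  Metric.ball (sgn ζ • kstar) (sepRadius kstar)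

lemma measurableSet_waveBall (kstar : Wave d) (ζ : ℤˣ) : MeasurableSet (waveBall kstar ζ) :=
  measurableSet_ball

/-- Self-interactions of a wave have their output centres in `ℤ k_*`. Such a point is either the
centre of the ball or strictly outside it, so the sharp cutoffs are harmless there. -/
lemma zsmul_notMem_frontier_waveBall (n : ℤ) (ζ : ℤˣ) (kstar : Wave d) :
    n • kstar ∉ frontier (waveBall kstar ζ) := by
  intro h
  have h1 := Metric.frontier_ball_subset_sphere h
  rw [mem_sphere_iff_norm] at h1
  rcases eq_or_sepRadius_lt n ζ kstar with h2 | h2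
  · rw [h2, sub_self, norm_zero] at h1
    exact (sepRadius_pos kstar).ne h1
  · exact h2.ne' h1

/-- The projection on the component of sign `ζ` of a wave. -/
def inMult (A : LinearPart d J) (n : Fin J) (kstar : Wave d) (ζ : ℤˣ) :
    Wave d → Val J →L[ℂ] Val J :=
  (waveBall kstar ζ).indicator (A.projL (n, ζ))

/-- The set in which the band `i` does not belong to the wave with `nk`-pair `(n, k_*)`. -/
def outSet (n : Fin J) (kstar : Wave d) (i : Fin J × ℤˣ) : Set (Wave d) :=
  if i.1 = n then (waveBall kstar i.2)ᶜ else univ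

/-- The part of the projection on the band `i` which is complementary to the wave. -/
def outMult (A : LinearPart d J) (n : Fin J) (kstar : Wave d) (i : Fin J × ℤˣ) :
    Wave d → Val J →L[ℂ] Val J :=
  (outSet n kstar i).indicator (A.projL i)

lemma measurableSet_outSet (n : Fin J) (kstar : Wave d) (i : Fin J × ℤˣ) :
    MeasurableSet (outSet n kstar i) := by
  unfold outSet
  split_ifs
  · exact (measurableSet_waveBall _ _).compl
  · exact MeasurableSet.univ

lemma zsmul_notMem_frontier_outSet (n : Fin J) (z : ℤ) (kstar : Wave d) (i : Fin J × ℤˣ) :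
    z • kstar ∉ frontier (outSet n kstar i) := by
  unfold outSet
  split_ifs
  · rw [frontier_compl]; exact zsmul_notMem_frontier_waveBall z i.2 kstar
  · simp

lemma isBandMult_inMult (hA : A.Admissible) (n : Fin J) (kstar : Wave d) (ζ : ℤˣ) :
    IsBandMult A (n, ζ) (inMult A n kstar ζ) :=
  isBandMult_indicator hA _ (measurableSet_waveBall kstar ζ)

lemma isBandMult_outMult (hA : A.Admissible) (n : Fin J) (kstar : Wave d) (i : Fin J × ℤˣ) :
    IsBandMult A i (outMult A n kstar i) :=
  isBandMult_indicator hA _ (measurableSet_outSet n kstar i)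

lemma sum_inMult_add_sum_outMult (n : Fin J) (kstar k : Wave d) (u : Val J) :
    ∑ ζ, inMult A n kstar ζ k u + ∑ i, outMult A n kstar i k u = u := by
  conv_rhs => rw [← A.sum_projL k u]
  have h1 : ∑ ζ, inMult A n kstar ζ k u
      = ∑ i : Fin J × ℤˣ, if i.1 = n then inMult A n kstar i.2 k u else 0 := by
    rw [Fintype.sum_prod_type, Finset.sum_eq_single n]
    · simp
    · intro b _ hb; simp [hb]
    · simp
  rw [h1, ← Finset.sum_add_distrib]
  refine Finset.sum_congr rfl fun i _ => ?_
  obtain ⟨n', ζ⟩ := i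
  by_cases hn : n' = n
  · subst hn
    by_cases hk : k ∈ waveBall kstar ζ
    · simp [inMult, outMult, outSet, hk]
    · simp [inMult, outMult, outSet, hk]
  · simp [outMult, outSet, hn]

lemma outMult_inMult (n : Fin J) (kstar k : Wave d) (i : Fin J × ℤˣ) (ζ : ℤˣ) (u : Val J) :
    outMult A n kstar i k (inMult A n kstar ζ k u) = 0 := by
  by_cases hk : k ∈ waveBall kstar ζ
  · rw [inMult, indicator_of_mem hk, outMult]
    by_cases hk' : k ∈ outSet n kstar i
    · rw [indicator_of_mem hk', A.projL_projL, if_neg]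
      rintro rfl
      simp [outSet, hk] at hk'
    · simp [indicator_of_notMem hk']
  · simp [inMult, indicator_of_notMem hk]

lemma inMult_inMult (n : Fin J) (kstar k : Wave d) (ζ ζ' : ℤˣ) (u : Val J) :
    inMult A n kstar ζ k (inMult A n kstar ζ' k u)
      = if ζ = ζ' then inMult A n kstar ζ k u else 0 := by
  by_cases hk : k ∈ waveBall kstar ζ
  · by_cases hk' : k ∈ waveBall kstar ζ'
    · simp only [inMult, indicator_of_mem hk, indicator_of_mem hk', A.projL_projL, Prod.mk.injEq,
        true_and]
      split_ifs with h
      · rw [h]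
      · rfl
    · have : ζ ≠ ζ' := by rintro rfl; exact hk' hk
      simp [inMult, indicator_of_notMem hk', this]
  · simp [inMult, indicator_of_notMem hk]

lemma projL_inMult (n : Fin J) (kstar k : Wave d) (ζ : ℤˣ) (u : Val J) :
    A.projL (n, ζ) k (inMult A n kstar ζ k u) = inMult A n kstar ζ k u := by
  by_cases hk : k ∈ waveBall kstar ζ
  · rw [inMult, indicator_of_mem hk, A.projL_projL, if_pos rfl]
  · simp [inMult, indicator_of_notMem hk]

lemma wmom_mulOp_inMult_le (hA : A.Admissible) (n : Fin J) (kstar : Wave d) (ζ : ℤˣ)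
    (f : L1 d J) :
    wmom (wt (sgn ζ • kstar)) (mulOp (inMult A n kstar ζ) f) ≤ wmom (harmonicWeight kstar) f := by
  refine integral_mono_ae ((isWeight_wt _).integrable _)
    ((isWeight_harmonicWeight kstar).integrable f) ?_
  filter_upwards [mulOp_coeFn (isBandMult_inMult hA n kstar ζ).isMult f] with k hk
  simp only [hk]
  have hw := (isWeight_harmonicWeight kstar).nonneg k
  by_cases hkb : k ∈ waveBall kstar ζ
  · rw [inMult, indicator_of_mem hkb]
    refine mul_le_mul (wt_le_harmonicWeight ζ ?_) (A.norm_projL_apply_le _ k _) (norm_nonneg _) hw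
    rwa [waveBall, mem_ball_iff_norm] at hkb
  · rw [inMult, indicator_of_notMem hkb]
    simpa using mul_nonneg hw (norm_nonneg _)

end Bands

/-! ### Self-interactions of a single wave. -/

section SingleWave

variable {d J : ℕ} {A : LinearPart d J} {B : Nonlinearity d J} {Cχ : ℝ}

/-- The conditions on an `nk`-pair which make the corresponding single-wave dynamics closed: the
harmonics generated are not band-crossing points, and the only resonances are the universal
ones. -/
structure IsClosedPair (A : LinearPart d J) (B : Nonlinearity d J) (n : Fin J)
    (kstar : Wave d) : Prop where
  notMem : ∀ ζ, sgn ζ • kstar ∉ A.bandCrossing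
  sum_notMem : ∀ m ∈ B.degrees, ∀ σ : Fin m → ℤˣ, (∑ j, sgn (σ j) • kstar) ∉ A.bandCrossing
  universal : ∀ m ∈ B.degrees, ∀ (σ : Fin m → ℤˣ) (i : Fin J × ℤˣ),
    mismatch A i (fun j => (n, σ j)) (fun j => sgn (σ j) • kstar) = 0 →
      i.1 = n ∧ ∑ j, (σ j : ℤ) = (i.2 : ℤ)

lemma sum_sgn_smul {m : ℕ} (σ : Fin m → ℤˣ) (kstar : Wave d) :
    ∑ j, sgn (σ j) • kstar = (∑ j, (σ j : ℤ)) • kstar := by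
  rw [← Finset.sum_smul, ← Int.cast_smul_eq_zsmul ℝ]
  push_cast
  rfl

lemma sum_sgn_smul_of_eq {m : ℕ} {σ : Fin m → ℤˣ} {ζ : ℤˣ} (h : ∑ j, (σ j : ℤ) = ζ)
    (x : Wave d) : ∑ j, sgn (σ j) • x = sgn ζ • x := by
  rw [sum_sgn_smul, h, sgn, Int.cast_smul_eq_zsmul]

/-- The components of signs `±` of a wave. -/
def waveComp (A : LinearPart d J) (n : Fin J) (kstar : Wave d) (ζ : ℤˣ) : L1 d J →L[ℂ] L1 d J :=
  mulOp (inMult A n kstar ζ)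

/-- The remainder left by the components of a wave. -/
def waveRest (A : LinearPart d J) (n : Fin J) (kstar : Wave d) : L1 d J →L[ℂ] L1 d J :=
  ∑ i, mulOp (outMult A n kstar i)

lemma waveRest_apply (n : Fin J) (kstar : Wave d) (f : L1 d J) :
    waveRest A n kstar f = ∑ i, mulOp (outMult A n kstar i) f := by
  rw [waveRest, sum_apply]

lemma norm_waveRest_le (n : Fin J) (kstar : Wave d) (f : L1 d J) :
    ‖waveRest A n kstar f‖ ≤ Fintype.card (Fin J × ℤˣ) * ‖f‖ := by
  rw [waveRest_apply]
  refine (norm_sum_le _ _).trans ((Finset.sum_le_card_nsmul _ _ _ fun i _ =>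
    norm_mulOp_apply_le _ f).trans_eq ?_)
  rw [Finset.card_univ, nsmul_eq_mul]

lemma sum_waveComp_add_waveRest (hA : A.Admissible) (n : Fin J) (kstar : Wave d) (f : L1 d J) :
    ∑ ζ, waveComp A n kstar ζ f + waveRest A n kstar f = f := by
  rw [waveRest_apply]
  refine L1_ext ?_
  have h1 : ∀ᵐ k, ∀ ζ ∈ (Finset.univ : Finset ℤˣ), (waveComp A n kstar ζ f : L1 d J) k
      = inMult A n kstar ζ k (f k) := (Finset.eventually_all _).2 fun ζ _ =>
    mulOp_coeFn (isBandMult_inMult hA n kstar ζ).isMult f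
  have h2 : ∀ᵐ k, ∀ i ∈ (Finset.univ : Finset (Fin J × ℤˣ)),
      (mulOp (outMult A n kstar i) f : L1 d J) k = outMult A n kstar i k (f k) :=
    (Finset.eventually_all _).2 fun i _ => mulOp_coeFn (isBandMult_outMult hA n kstar i).isMult f
  filter_upwards [h1, h2, Lp.coeFn_add (∑ ζ, waveComp A n kstar ζ f)
    (∑ i, mulOp (outMult A n kstar i) f),
    Lp.coeFn_fun_finsetSum Finset.univ (fun ζ => waveComp A n kstar ζ f),
    Lp.coeFn_fun_finsetSum Finset.univ (fun i => mulOp (outMult A n kstar i) f)]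
    with k g1 g2 g3 g4 g5
  rw [g3, Pi.add_apply, g4, g5, Finset.sum_congr rfl g1, Finset.sum_congr rfl g2,
    sum_inMult_add_sum_outMult]

lemma waveComp_waveComp (hA : A.Admissible) (n : Fin J) (kstar : Wave d) (ζ ζ' : ℤˣ)
    (f : L1 d J) : waveComp A n kstar ζ (waveComp A n kstar ζ' f)
      = if ζ = ζ' then waveComp A n kstar ζ f else 0 := by
  refine L1_ext ?_
  have h1 := mulOp_coeFn (isBandMult_inMult hA n kstar ζ).isMult (waveComp A n kstar ζ' f)
  have h2 := mulOp_coeFn (isBandMult_inMult hA n kstar ζ).isMult f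
  have h3 := mulOp_coeFn (isBandMult_inMult hA n kstar ζ').isMult f
  split_ifs with h
  · filter_upwards [h1, h2, h3] with k g1 g2 g3
    rw [waveComp, g1, g2, waveComp, g3, inMult_inMult, if_pos h]
  · filter_upwards [h1, h3, Lp.coeFn_zero (Val J) 1 (volume : Measure (Wave d))] with k g1 g3 g0
    rw [waveComp, g1, waveComp, g3, inMult_inMult, if_neg h, g0]
    rfl

lemma waveRest_waveComp (hA : A.Admissible) (n : Fin J) (kstar : Wave d) (ζ : ℤˣ)
    (f : L1 d J) : waveRest A n kstar (waveComp A n kstar ζ f) = 0 := by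
  rw [waveRest_apply]
  refine Finset.sum_eq_zero fun i _ => L1_ext ?_
  filter_upwards [mulOp_coeFn (isBandMult_outMult hA n kstar i).isMult (waveComp A n kstar ζ f),
    mulOp_coeFn (isBandMult_inMult hA n kstar ζ).isMult f,
    Lp.coeFn_zero (Val J) 1 (volume : Measure (Wave d))] with k g1 g2 g0
  rw [g1, waveComp, g2, outMult_inMult, g0]
  rfl

variable {n : Fin J} {kstar : Wave d} {τs R : ℝ}

/-- The components of a solution form a family of waves. -/
lemma IsSolution.isWaveFamily (hA : A.Admissible) (hB : B.Admissible A Cχ) (hR : 0 < R) {ϱ : ℝ}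
    {g : L1 d J} {u : ℝ → L1 d J} (hu : IsSolution A B ϱ τs R g u) (n : Fin J)
    (kstar : Wave d) :
    IsWaveFamily A τs (2 * R) (bnd B Cχ (2 * R))
      (wmom (harmonicWeight kstar) g * Real.exp (lip B Cχ (2 * R) * τs))
      (fun ζ : ℤˣ => (n, ζ)) (fun ζ => sgn ζ • kstar) fun ζ t => waveComp A n kstar ζ (u t) := by
  refine ⟨fun ζ t ht => (norm_mulOp_apply_le _ _).trans (hu.bound t ht), fun ζ t ht t' ht' => ?_,
    fun ζ t ht => (wmom_mulOp_inMult_le hA n kstar ζ (u t)).trans (hu.wmom_le hA hB hR kstar t ht),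
    fun ζ t _ => ?_⟩
  · rw [← map_sub]
    exact (norm_mulOp_apply_le _ _).trans (hu.norm_sub_le_time hA hB ht' ht)
  · filter_upwards [mulOp_coeFn (isBandMult_inMult hA n kstar ζ).isMult (u t)] with k hk
    rw [waveComp, hk, projL_inMult]

/-- The coefficient of the interaction of signs `σ` in the component `ζ` of a wave. -/
def waveCoeff (A : LinearPart d J) (B : Nonlinearity d J) (n : Fin J) (kstar : Wave d) (ζ : ℤˣ)
    (m : ℕ) (σ : Fin m → ℤˣ) : MMap J m :=
  (inMult A n kstar ζ (∑ j, sgn (σ j) • kstar)).compContinuousMultilinearMap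
    (B.ker m fun j => sgn (σ j) • kstar)

/-- The terms of the effective equation of a wave. -/
def waveTerm (A : LinearPart d J) (B : Nonlinearity d J) (n : Fin J) (kstar : Wave d) (ϱ : ℝ)
    (ζ : ℤˣ) (m : ℕ) (σ : Fin m → ℤˣ) (s : ℝ) (v : ℤˣ → L1 d J) : L1 d J :=
  osc A ϱ s (n, ζ) (fun j => (n, σ j)) (waveCoeff A B n kstar ζ m σ) fun j => v (σ j)

/-- If the signs do not add up to `ζ`, the mismatch at the centres cannot vanish for a closed pair,
and the term averages out. Otherwise the term is kept, with frozen coefficient. -/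
lemma exists_norm_integral_inMult_le (hA : A.Admissible) (hB : B.Admissible A Cχ)
    (hC : IsClosedPair A B n kstar) (hR : 0 < R) (hτs : 0 ≤ τs) {m : ℕ} (hm : m ∈ B.degrees)
    (σ : Fin m → ℤˣ) (ζ : ℤˣ) :
    ∃ K, 0 ≤ K ∧ ∀ (ϱ μ : ℝ) (v : ℤˣ → ℝ → L1 d J), 0 < ϱ → 0 ≤ μ →
      IsWaveFamily A τs R (bnd B Cχ R) μ (fun ζ : ℤˣ => (n, ζ)) (fun ζ => sgn ζ • kstar) v →
      ∀ t ∈ Icc 0 τs, ‖(∫ s in (0 : ℝ)..t,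
          waveComp A n kstar ζ (interaction A B ϱ s fun j => v (σ j) s))
        - if ∑ j, (σ j : ℤ) = ζ then
            ∫ s in (0 : ℝ)..t, waveTerm A B n kstar ϱ ζ m σ s fun ζ => v ζ s else 0‖
        ≤ K * (ϱ + μ) := by
  have hs := hC.sum_notMem m hm σ
  obtain ⟨CP, hCP, hPL⟩ := exists_indicator_lipschitz hA (n, ζ) hs
    (s := waveBall kstar ζ) (by rw [sum_sgn_smul]; exact zsmul_notMem_frontier_waveBall _ _ _)
  have hP := isBandMult_inMult hA n kstar ζ
  split_ifs with h
  · obtain ⟨K, hK, hb⟩ := exists_norm_integral_band_sub_le hA hB hm (ι := fun j => (n, σ j))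
      (c := fun j => sgn (σ j) • kstar) (fun j => hC.notMem (σ j)) hs hP hCP hPL
      (M := bnd B Cχ R) hR.le hτs
    refine ⟨K, hK, fun ϱ μ v hϱ hμ hv t ht => (hb ϱ μ _ hμ (hv.comp σ) t ht).trans ?_⟩
    have := mul_nonneg hK hϱ.le
    linarith
  · obtain ⟨K, hK, hb⟩ := exists_norm_integral_band_le hA hB hm (ι := fun j => (n, σ j))
      (c := fun j => sgn (σ j) • kstar) (fun j => hC.notMem (σ j)) hs hP hCP hPL
      (M := bnd B Cχ R) (Or.inl fun h0 => h (hC.universal m hm σ _ h0).2) hR.le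
      (bnd_nonneg hA hB hR.le) hτs
    refine ⟨K, hK, fun ϱ μ v hϱ hμ hv t ht => ?_⟩
    rw [sub_zero]
    exact hb ϱ μ _ hϱ hμ (hv.comp σ) t ht

/-- A vanishing mismatch puts the output into the band `(n, ζ)` with centre `ζ k_*`, exactly where
the complementary multiplier is zero. So what leaves the wave is never resonant. -/
lemma exists_norm_integral_outMult_le (hA : A.Admissible) (hB : B.Admissible A Cχ)
    (hC : IsClosedPair A B n kstar) (hR : 0 < R) (hτs : 0 ≤ τs) {m : ℕ} (hm : m ∈ B.degrees)
    (σ : Fin m → ℤˣ) (i : Fin J × ℤˣ) :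
    ∃ K, 0 ≤ K ∧ ∀ (ϱ μ : ℝ) (v : ℤˣ → ℝ → L1 d J), 0 < ϱ → 0 ≤ μ →
      IsWaveFamily A τs R (bnd B Cχ R) μ (fun ζ : ℤˣ => (n, ζ)) (fun ζ => sgn ζ • kstar) v →
      ∀ t ∈ Icc 0 τs, ‖∫ s in (0 : ℝ)..t,
          mulOp (outMult A n kstar i) (interaction A B ϱ s fun j => v (σ j) s)‖
        ≤ K * (ϱ + μ) := by
  have hs := hC.sum_notMem m hm σ
  obtain ⟨CP, hCP, hPL⟩ := exists_indicator_lipschitz hA i hs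
    (s := outSet n kstar i) (by rw [sum_sgn_smul]; exact zsmul_notMem_frontier_outSet _ _ _ _)
  obtain ⟨K, hK, hb⟩ := exists_norm_integral_band_le hA hB hm (ι := fun j => (n, σ j))
    (c := fun j => sgn (σ j) • kstar) (fun j => hC.notMem (σ j)) hs
    (isBandMult_outMult hA n kstar i) hCP hPL (M := bnd B Cχ R) (by
      by_cases h0 : mismatch A i (fun j => (n, σ j)) (fun j => sgn (σ j) • kstar) = 0
      · right
        obtain ⟨h1, h2⟩ := hC.universal m hm σ i h0
        rw [sum_sgn_smul_of_eq h2, outMult, indicator_of_notMem]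
        rw [outSet, if_pos h1, notMem_compl_iff]
        exact Metric.mem_ball_self (sepRadius_pos kstar)
      · exact Or.inl h0) hR.le (bnd_nonneg hA hB hR.le) hτs
  exact ⟨K, hK, fun ϱ μ v hϱ hμ hv t ht => hb ϱ μ _ hϱ hμ (hv.comp σ) t ht⟩

end SingleWave

/-! ### The effective equation of a single wave. -/

section WaveEstimate

variable {d J : ℕ} {A : LinearPart d J} {B : Nonlinearity d J} {Cχ : ℝ}

lemma integral_slowL1_sum (hA : A.Admissible) (hB : B.Admissible A Cχ) (ϱ : ℝ) {Λ : Type*}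
    [Fintype Λ] [DecidableEq Λ] {τs : ℝ} {v : Λ → ℝ → L1 d J}
    (hv : ∀ l, ContinuousOn (v l) (Icc 0 τs)) (T : L1 d J →L[ℂ] L1 d J) {t : ℝ}
    (ht : t ∈ Icc 0 τs) :
    ∫ s in (0 : ℝ)..t, T (B.slowL1 A ϱ s (∑ l, v l s))
      = ∑ m ∈ B.degrees, ∑ lam : Fin m → Λ,
          ∫ s in (0 : ℝ)..t, T (interaction A B ϱ s fun j => v (lam j) s) := by
  simp_rw [slowL1_sum hA hB, map_sum]
  have hi : ∀ (m : ℕ) (lam : Fin m → Λ), ContinuousOn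
      (fun s => T (interaction A B ϱ s fun j => v (lam j) s)) (Icc 0 τs) := fun m lam =>
    T.continuous.comp_continuousOn (continuousOn_interaction hA ϱ fun j => hv (lam j))
  rw [intervalIntegral.integral_finsetSum fun m _ => intervalIntegrable_of_continuousOn
    (continuousOn_finsetSum _ fun lam _ => hi m lam) ht]
  exact Finset.sum_congr rfl fun m _ => intervalIntegral.integral_finsetSum fun lam _ =>
    intervalIntegrable_of_continuousOn (hi m lam) ht

variable {n : Fin J} {kstar : Wave d} {τs R : ℝ}

lemma IsSolution.apply_eq (hA : A.Admissible) (hB : B.Admissible A Cχ) {ϱ : ℝ} {g : L1 d J}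
    {u : ℝ → L1 d J} (hu : IsSolution A B ϱ τs R g u) (T : L1 d J →L[ℂ] L1 d J) {t : ℝ}
    (ht : t ∈ Icc 0 τs) : T (u t) = T g + ∫ s in (0 : ℝ)..t, T (B.slowL1 A ϱ s (u s)) := by
  rw [hu.equation t ht, map_add, T.intervalIntegral_comp_comm
    (intervalIntegrable_of_continuousOn (continuousOn_slowL1 hA hB ϱ hu.continuousOn) ht)]

/-- Indices outside `s` receive the constant `0`, so that the constants form a total function and
can be summed. -/
lemma exists_uniform_bound {ι : Type*} [Fintype ι] (s : Finset ℕ) {α : ℕ → Type*}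
    [∀ m, Fintype (α m)] {P : (m : ℕ) → α m → ι → ℝ → Prop}
    (hP : ∀ m ∈ s, ∀ a i, ∃ K, 0 ≤ K ∧ P m a i K) :
    ∃ K : (m : ℕ) → α m → ι → ℝ, (∀ m a i, 0 ≤ K m a i) ∧ ∀ m ∈ s, ∀ a i, P m a i (K m a i) := by
  have h : ∀ m a i, ∃ K, 0 ≤ K ∧ (m ∈ s → P m a i K) := fun m a i => by
    by_cases hm : m ∈ s
    · obtain ⟨K, h1, h2⟩ := hP m hm a i
      exact ⟨K, h1, fun _ => h2⟩
    · exact ⟨0, le_rfl, fun h => absurd h hm⟩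
  choose K h1 h2 using h
  exact ⟨K, h1, fun m hm a i => h2 m a i hm⟩

/-- A solution whose data are a wave remains a wave, governed by an effective equation. -/
theorem exists_wave_estimate (hA : A.Admissible) (hB : B.Admissible A Cχ)
    (hC : IsClosedPair A B n kstar) (hR : 0 < R) (hτs : 0 ≤ τs) :
    ∃ K, 0 ≤ K ∧ ∀ (ϱ μ : ℝ) (g : L1 d J) (h : ℤˣ → L1 d J) (u : ℝ → L1 d J), 0 < ϱ →
      IsSolution A B ϱ τs R g u → g = ∑ ζ, h ζ → (∀ ζ, waveComp A n kstar ζ (h ζ) = h ζ) →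
      wmom (harmonicWeight kstar) g ≤ μ → ∀ t ∈ Icc 0 τs,
      ‖u t - ∑ ζ, waveComp A n kstar ζ (u t)‖ ≤ K * (ϱ + μ) ∧
      ∀ ζ, ‖waveComp A n kstar ζ (u t) - h ζ - ∑ m ∈ B.degrees, ∑ σ : Fin m → ℤˣ,
        if ∑ j, (σ j : ℤ) = ζ then ∫ s in (0 : ℝ)..t, waveTerm A B n kstar ϱ ζ m σ s
          fun ζ => waveComp A n kstar ζ (u s) else 0‖ ≤ K * (ϱ + μ) := by
  have h2R : 0 < 2 * R := by positivity
  obtain ⟨Ki, hKi0, hKi⟩ := exists_uniform_bound (α := fun m => Fin m → ℤˣ) B.degrees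
    fun m hm σ ζ => exists_norm_integral_inMult_le hA hB hC h2R hτs hm σ ζ
  obtain ⟨Ko, hKo0, hKo⟩ := exists_uniform_bound (α := fun m => Fin m → ℤˣ) B.degrees
    fun m hm σ i => exists_norm_integral_outMult_le hA hB hC h2R hτs hm σ i
  set E := Real.exp (lip B Cχ (2 * R) * τs) with hE
  have hE1 : 1 ≤ E := Real.one_le_exp (mul_nonneg (lip_nonneg hA hB h2R.le) hτs)
  -- The sum `y` of the two components, each of norm at most `2R`, lies only in the ball of radius
  -- `4R`.
  set Λ := lip B Cχ (2 * (2 * R)) with hΛ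
  have hΛ0 : 0 ≤ Λ := lip_nonneg hA hB (by positivity)
  set N : ℝ := (Fintype.card (Fin J × ℤˣ) : ℝ) with hN
  have hN0 : 0 ≤ N := Nat.cast_nonneg _
  set So := ∑ i, ∑ m ∈ B.degrees, ∑ σ, Ko m σ i with hSo
  have hSo0 : 0 ≤ So := Finset.sum_nonneg fun i _ => Finset.sum_nonneg fun m _ =>
    Finset.sum_nonneg fun σ _ => hKo0 m σ i
  set Si := ∑ ζ, ∑ m ∈ B.degrees, ∑ σ, Ki m σ ζ with hSi
  have hSiζ0 : ∀ ζ, 0 ≤ ∑ m ∈ B.degrees, ∑ σ, Ki m σ ζ := fun ζ =>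
    Finset.sum_nonneg fun m _ => Finset.sum_nonneg fun σ _ => hKi0 m σ ζ
  have hSi0 : 0 ≤ Si := Finset.sum_nonneg fun ζ _ => hSiζ0 ζ
  set Kr := So * E * Real.exp (N * Λ * τs) with hKr
  have hKr0 : 0 ≤ Kr := by positivity
  refine ⟨Kr + (Λ * Kr * τs + Si * E), by positivity,
    fun ϱ μ g h u hϱ hu hg hh hμ => ?_⟩
  have hμ0 : 0 ≤ μ := ((isWeight_harmonicWeight kstar).wmom_nonneg g).trans hμ
  set v : ℤˣ → ℝ → L1 d J := fun ζ t => waveComp A n kstar ζ (u t) with hv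
  have hF : IsWaveFamily A τs (2 * R) (bnd B Cχ (2 * R)) (μ * E) (fun ζ : ℤˣ => (n, ζ))
      (fun ζ => sgn ζ • kstar) v :=
    (hu.isWaveFamily hA hB hR n kstar).mono (by gcongr)
  have hμE : 0 ≤ μ * E := by positivity
  have hϱμ : ϱ + μ * E ≤ E * (ϱ + μ) := by nlinarith
  set y : ℝ → L1 d J := fun t => ∑ ζ, v ζ t with hy
  have hyc : ContinuousOn y (Icc 0 τs) := continuousOn_finsetSum _ fun ζ _ => hF.continuousOn ζ
  have hyR : ∀ t ∈ Icc 0 τs, ‖y t‖ ≤ 2 * (2 * R) := fun t ht => by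
    refine (norm_sum_le _ _).trans ((Finset.sum_le_card_nsmul _ _ _
      fun ζ _ => hF.norm_le ζ t ht).trans_eq ?_)
    rw [Finset.card_univ, Fintype.card_units_int, nsmul_eq_mul]; norm_num
  have huR : ∀ t ∈ Icc 0 τs, ‖u t‖ ≤ 2 * (2 * R) := fun t ht => by
    have := hu.bound t ht; linarith
  have hdiff : ∀ t ∈ Icc 0 τs, ‖B.slowL1 A ϱ t (u t) - B.slowL1 A ϱ t (y t)‖
      ≤ Λ * ‖u t - y t‖ := fun t ht => norm_slowL1_sub_le hA hB ϱ t (huR t ht) (hyR t ht)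
  have hcu := continuousOn_slowL1 hA hB ϱ hu.continuousOn
  have hcy := continuousOn_slowL1 hA hB ϱ hyc
  have hrest : ∀ t, waveRest A n kstar (u t) = u t - y t := fun t => by
    rw [eq_sub_iff_add_eq, add_comm]
    exact sum_waveComp_add_waveRest hA n kstar (u t)
  -- The datum is exactly a sum of components, so the remainder starts from zero.
  have hrg : waveRest A n kstar g = 0 := by
    rw [hg, map_sum]
    exact Finset.sum_eq_zero fun ζ _ => by rw [← hh ζ, waveRest_waveComp hA]
  have hest : ∀ t ∈ Icc 0 τs, ‖u t - y t‖ ≤ Kr * (ϱ + μ) := by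
    have hgr := gronwall_integral (φ := fun t => ‖u t - y t‖) (τ := τs)
      (K := So * (E * (ϱ + μ))) (Λ := N * Λ) (by positivity) (by positivity)
      (hu.continuousOn.sub hyc).norm (fun _ _ => norm_nonneg _) fun t ht => ?_
    · intro t ht
      refine (hgr t ht).trans_eq ?_
      rw [hKr]; ring
    · have hcRu : ContinuousOn (fun s => waveRest A n kstar (B.slowL1 A ϱ s (u s))) (Icc 0 τs) :=
        (waveRest A n kstar).continuous.comp_continuousOn hcu
      have hcRy : ContinuousOn (fun s => waveRest A n kstar (B.slowL1 A ϱ s (y s))) (Icc 0 τs) :=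
        (waveRest A n kstar).continuous.comp_continuousOn hcy
      have iRu := intervalIntegrable_of_continuousOn hcRu ht
      have iRy := intervalIntegrable_of_continuousOn hcRy ht
      -- The remainder is driven by itself, through the Lipschitz bound, and by the complementary
      -- part of the self-interactions of `y`, which is small by non-resonance; Grönwall closes the
      -- estimate.
      have e1 : u t - y t = (∫ s in (0 : ℝ)..t, (waveRest A n kstar (B.slowL1 A ϱ s (u s))
          - waveRest A n kstar (B.slowL1 A ϱ s (y s))))
          + ∫ s in (0 : ℝ)..t, waveRest A n kstar (B.slowL1 A ϱ s (y s)) := by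
        rw [intervalIntegral.integral_sub iRu iRy, ← hrest,
          hu.apply_eq hA hB (waveRest A n kstar) ht, hrg]
        simp
      have e2 : ∫ s in (0 : ℝ)..t, waveRest A n kstar (B.slowL1 A ϱ s (y s))
          = ∑ i, ∑ m ∈ B.degrees, ∑ σ : Fin m → ℤˣ, ∫ s in (0 : ℝ)..t,
            mulOp (outMult A n kstar i) (interaction A B ϱ s fun j => v (σ j) s) := by
        simp_rw [waveRest_apply]
        have hi : ∀ i, ContinuousOn (fun s => mulOp (outMult A n kstar i)
            (B.slowL1 A ϱ s (y s))) (Icc 0 τs) := fun i =>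
          (mulOp (outMult A n kstar i)).continuous.comp_continuousOn hcy
        rw [intervalIntegral.integral_finsetSum fun i _ =>
          intervalIntegrable_of_continuousOn (hi i) ht]
        exact Finset.sum_congr rfl fun i _ =>
          integral_slowL1_sum hA hB ϱ (fun ζ => hF.continuousOn ζ) _ ht
      have b2 : ‖∫ s in (0 : ℝ)..t, waveRest A n kstar (B.slowL1 A ϱ s (y s))‖
          ≤ So * (E * (ϱ + μ)) := by
        rw [e2, hSo, Finset.sum_mul]
        refine (norm_sum_le _ _).trans (Finset.sum_le_sum fun i _ => ?_)
        rw [Finset.sum_mul]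
        refine (norm_sum_le _ _).trans (Finset.sum_le_sum fun m hm => ?_)
        rw [Finset.sum_mul]
        refine (norm_sum_le _ _).trans (Finset.sum_le_sum fun σ _ => ?_)
        exact (hKo m hm σ i ϱ (μ * E) v hϱ hμE hF t ht).trans
          (mul_le_mul_of_nonneg_left hϱμ (hKo0 m σ i))
      have b1 : ‖∫ s in (0 : ℝ)..t, (waveRest A n kstar (B.slowL1 A ϱ s (u s))
          - waveRest A n kstar (B.slowL1 A ϱ s (y s)))‖
          ≤ N * Λ * ∫ s in (0 : ℝ)..t, ‖u s - y s‖ := by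
        rw [← intervalIntegral.integral_const_mul]
        refine intervalIntegral.norm_integral_le_of_norm_le ht.1
          (Filter.Eventually.of_forall fun s hs => ?_)
          ((intervalIntegrable_of_continuousOn (hu.continuousOn.sub hyc).norm ht).const_mul _)
        rw [← map_sub, mul_assoc]
        refine (norm_waveRest_le _ _ _).trans (mul_le_mul_of_nonneg_left ?_ hN0)
        exact hdiff s (Icc_subset_of_mem ht (Ioc_subset_Icc_self hs))
      show ‖u t - y t‖ ≤ _
      rw [e1, add_comm (So * _)]
      exact (norm_add_le _ _).trans (add_le_add b1 b2)
  have hϱμ0 : 0 ≤ ϱ + μ := by linarith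
  intro t ht
  refine ⟨(hest t ht).trans (mul_le_mul_of_nonneg_right (le_add_of_nonneg_right (by positivity))
    hϱμ0), fun ζ => ?_⟩
  have hg' : waveComp A n kstar ζ g = h ζ := by
    rw [hg, map_sum, Finset.sum_eq_single ζ]
    · exact hh ζ
    · intro ζ' _ hne
      rw [← hh ζ', waveComp_waveComp hA, if_neg hne.symm]
    · exact fun h => absurd (Finset.mem_univ _) h
  have hT := (waveComp A n kstar ζ).continuous
  -- In the equation for the component `ζ` the solution may now be replaced by `y`; `b2` then
  -- discards the non-resonant sign patterns.
  have b1 := norm_integral_sub_integral_le (e := Λ * (Kr * (ϱ + μ))) (by positivity)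
    (hT.comp_continuousOn hcu) (hT.comp_continuousOn hcy) (fun s hs => by
      simp only [Function.comp]
      rw [← map_sub]
      exact (norm_mulOp_apply_le _ _).trans ((hdiff s hs).trans
        (mul_le_mul_of_nonneg_left (hest s hs) hΛ0))) t ht
  have e2 := integral_slowL1_sum hA hB ϱ (fun ζ => hF.continuousOn ζ) (waveComp A n kstar ζ) ht
  set X := ∑ m ∈ B.degrees, ∑ σ : Fin m → ℤˣ, if ∑ j, (σ j : ℤ) = ζ then ∫ s in (0 : ℝ)..t,
    waveTerm A B n kstar ϱ ζ m σ s fun ζ => waveComp A n kstar ζ (u s) else 0 with hX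
  have b2 : ‖(∫ s in (0 : ℝ)..t, waveComp A n kstar ζ (B.slowL1 A ϱ s (∑ ζ, v ζ s))) - X‖
      ≤ Si * (E * (ϱ + μ)) := by
    rw [e2, hX, ← Finset.sum_sub_distrib]
    refine (norm_sum_le _ _).trans (le_trans ?_ (mul_le_mul_of_nonneg_right
      (Finset.single_le_sum (fun ζ _ => hSiζ0 ζ) (Finset.mem_univ ζ)) (by positivity)))
    rw [Finset.sum_mul]
    refine Finset.sum_le_sum fun m hm => ?_
    rw [← Finset.sum_sub_distrib, Finset.sum_mul]
    refine (norm_sum_le _ _).trans (Finset.sum_le_sum fun σ _ => ?_)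
    exact (hKi m hm σ ζ ϱ (μ * E) v hϱ hμE hF t ht).trans
      (mul_le_mul_of_nonneg_left hϱμ (hKi0 m σ ζ))
  rw [hu.apply_eq hA hB (waveComp A n kstar ζ) ht, hg', add_sub_cancel_left]
  refine (norm_sub_le_norm_sub_add_norm_sub _ _ _).trans ((add_le_add b1 b2).trans ?_)
  have : 0 ≤ Kr * (ϱ + μ) := by positivity
  have e3 : Λ * (Kr * (ϱ + μ)) * τs + Si * (E * (ϱ + μ))
      = (Λ * Kr * τs + Si * E) * (ϱ + μ) := by ring
  rw [e3, add_mul]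
  linarith

end WaveEstimate

/-! ### Near invariance of a wave under modulated translations. -/

section WaveShift

variable {d J : ℕ} {A : LinearPart d J} {B : Nonlinearity d J} {Cχ : ℝ}
  {n : Fin J} {kstar : Wave d} {τs R : ℝ}

lemma sgn_mul_self (ζ : ℤˣ) : sgn ζ * sgn ζ = 1 := by
  rw [sgn, ← Int.cast_mul, ← Units.val_mul, Int.units_mul_self]; simp

lemma abs_sgn (ζ : ℤˣ) : |sgn ζ| = 1 := by
  rcases Int.units_eq_one_or ζ with rfl | rfl <;> simp [sgn]

lemma sgn_mul (ζ ζ' : ℤˣ) : sgn (ζ * ζ') = sgn ζ * sgn ζ' := by simp [sgn]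

lemma norm_sgn_smul (ζ : ℤˣ) (y : Wave d) : ‖sgn ζ • y‖ = ‖y‖ := by
  rw [norm_smul, Real.norm_eq_abs, abs_sgn, one_mul]

/-- Shifts of the arguments of a universally resonant term of the effective equation. -/
lemma exists_norm_mtrans_waveTerm_sub_le (hA : A.Admissible) (hC : IsClosedPair A B n kstar)
    {G : Wave d} (hG : ∀ ζ, gradient (A.om (n, ζ)) (sgn ζ • kstar) = G) (hR : 0 ≤ R)
    (hτs : 0 ≤ τs) {m : ℕ} (hm : m ∈ B.degrees) (σ : Fin m → ℤˣ) (ζ : ℤˣ) :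
    ∃ K, 0 ≤ K ∧ (∑ j, (σ j : ℤ) = ζ → ∀ (ϱ s q D μ : ℝ) (r y : Wave d) (v : ℤˣ → L1 d J),
      0 < ϱ → ϱ ≤ 1 → s ∈ Icc 0 τs → 0 ≤ q → ‖y‖ ≤ q → (∀ ζ, ‖v ζ‖ ≤ R) →
      (∀ ζ, wmom (wt (sgn ζ • kstar)) (v ζ) ≤ μ) →
      (∀ ζ e, ‖mtrans r (sgn e • y) (v ζ) - v ζ‖ ≤ D) → ∀ e,
      ‖mtrans r (sgn e • y) (waveTerm A B n kstar ϱ ζ m σ s v) - waveTerm A B n kstar ϱ ζ m σ s v‖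
        ≤ K * (D + (q / ϱ + 1) * μ + q ^ 2 / ϱ)) := by
  have hm0 : 0 < m := by have := B.two_le m hm; omega
  obtain ⟨K, hK, h⟩ := exists_norm_shift_osc_sub_le (n, ζ) (fun j => (n, σ j)) hA hm0
    (c := fun j => sgn (σ j) • kstar) (fun j => hC.notMem (σ j)) (hC.sum_notMem m hm σ)
    (waveCoeff A B n kstar ζ m σ) hR hτs
  refine ⟨K, hK, fun hσ ϱ s q D μ r y v hϱ hϱ1 hs hq hy hvR hvμ hvD e => ?_⟩
  -- The argument of sign `σ j` is shifted by `σ_j ζ e y`. As the signs `σ_j` add up to `ζ`, the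
  -- output is shifted by `e y`. The arguments see both `y` and `-y`, which is why the hypothesis is
  -- needed for both signs.
  have hsum : ∑ j, sgn (σ j * ζ * e) • y = sgn e • y := by
    have : ∀ j, sgn (σ j * ζ * e) • y = sgn (σ j) • (sgn ζ • sgn e • y) := fun j => by
      rw [sgn_mul, sgn_mul, mul_smul, mul_smul]
    simp_rw [this]
    rw [sum_sgn_smul_of_eq hσ, smul_smul, sgn_mul_self, one_smul]
  have h1 := h ϱ s q D μ (fun _ => r) (fun j => sgn (σ j * ζ * e) • y) (fun j => v (σ j)) hϱ hϱ1 hs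
    hq (fun j => (norm_sgn_smul _ y).trans_le hy) (fun j => hvR _) (fun j => hvμ _)
    (fun j => hvD _ _)
  -- All group velocities involved equal `G`, so the slope is `G` paired with the output shift minus
  -- the sum of the argument shifts, which is zero.
  have hslope : mismatchSlope A (n, ζ) (fun j => (n, σ j)) (fun j => sgn (σ j) • kstar)
      (fun j => sgn (σ j * ζ * e) • y) = 0 := by
    rw [mismatchSlope, sum_sgn_smul_of_eq hσ]
    simp_rw [hG]
    rw [← inner_sum, sub_self]
  rw [hslope, mul_zero, Complex.ofReal_zero, zero_mul, Complex.exp_zero, one_smul, ← inner_sum,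
    hsum] at h1
  exact h1

/-- Position control of the components of a wave. -/
theorem exists_wave_shift_estimate (hA : A.Admissible) (hB : B.Admissible A Cχ)
    (hC : IsClosedPair A B n kstar) {G : Wave d}
    (hG : ∀ ζ, gradient (A.om (n, ζ)) (sgn ζ • kstar) = G) (hR : 0 < R) (hτs : 0 ≤ τs) :
    ∃ K, 0 ≤ K ∧ ∀ (ϱ μ : ℝ) (g : L1 d J) (h : ℤˣ → L1 d J) (u : ℝ → L1 d J), 0 < ϱ → ϱ ≤ 1 →
      IsSolution A B ϱ τs R g u → g = ∑ ζ, h ζ → (∀ ζ, waveComp A n kstar ζ (h ζ) = h ζ) →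
      wmom (harmonicWeight kstar) g ≤ μ → ∀ (q D : ℝ) (r y : Wave d), 0 ≤ q → ‖y‖ ≤ q →
      (∀ ζ e, ‖mtrans r (sgn e • y) (h ζ) - h ζ‖ ≤ D) → ∀ t ∈ Icc 0 τs, ∀ ζ e,
      ‖mtrans r (sgn e • y) (waveComp A n kstar ζ (u t)) - waveComp A n kstar ζ (u t)‖
        ≤ K * (D + ϱ + (q / ϱ + 1) * μ + q ^ 2 / ϱ) := by
  obtain ⟨K₁, hK₁, hest⟩ := exists_wave_estimate hA hB hC hR hτs
  obtain ⟨Ks, hKs0, hKs⟩ := exists_uniform_bound (α := fun m => Fin m → ℤˣ) B.degrees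
    fun m hm σ ζ => exists_norm_mtrans_waveTerm_sub_le hA hC hG
      (show 0 ≤ 2 * R by positivity) hτs hm σ ζ
  set E := Real.exp (lip B Cχ (2 * R) * τs) with hE
  have hE1 : 1 ≤ E := Real.one_le_exp (mul_nonneg (lip_nonneg hA hB (by positivity)) hτs)
  set Ss := ∑ ζ, ∑ m ∈ B.degrees, ∑ σ, Ks m σ ζ with hSs
  have hSζ0 : ∀ ζ, 0 ≤ ∑ m ∈ B.degrees, ∑ σ, Ks m σ ζ := fun ζ =>
    Finset.sum_nonneg fun m _ => Finset.sum_nonneg fun σ _ => hKs0 m σ ζ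
  have hSs0 : 0 ≤ Ss := Finset.sum_nonneg fun ζ _ => hSζ0 ζ
  -- The factor `4` counts the pairs of a component and a sign of the shift.
  set K₂ := 4 * (1 + 2 * K₁ + Ss * E * τs) with hK₂
  have hK₂0 : 0 ≤ K₂ := by positivity
  refine ⟨K₂ * Real.exp (4 * Ss * τs), by positivity,
    fun ϱ μ g h u hϱ hϱ1 hu hg hh hμ q D r y hq hy hD => ?_⟩
  have hμ0 : 0 ≤ μ := ((isWeight_harmonicWeight kstar).wmom_nonneg g).trans hμ
  have hD0 : 0 ≤ D := (norm_nonneg _).trans (hD 1 1)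
  set v : ℤˣ → ℝ → L1 d J := fun ζ t => waveComp A n kstar ζ (u t) with hv
  have hF : IsWaveFamily A τs (2 * R) (bnd B Cχ (2 * R)) (μ * E) (fun ζ : ℤˣ => (n, ζ))
      (fun ζ => sgn ζ • kstar) v :=
    (hu.isWaveFamily hA hB hR n kstar).mono (by gcongr)
  -- The effective equation couples both components and both signs of the shift, so Grönwall is run
  -- on the total defect.
  set φ : ℝ → ℝ := fun t => ∑ ζ, ∑ e, ‖mtrans r (sgn e • y) (v ζ t) - v ζ t‖ with hφ
  have hφ1 : ∀ t ζ e, ‖mtrans r (sgn e • y) (v ζ t) - v ζ t‖ ≤ φ t := fun t ζ e =>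
    (Finset.single_le_sum (f := fun e => ‖mtrans r (sgn e • y) (v ζ t) - v ζ t‖)
      (fun _ _ => norm_nonneg _) (Finset.mem_univ e)).trans
      (Finset.single_le_sum (f := fun ζ => ∑ e, ‖mtrans r (sgn e • y) (v ζ t) - v ζ t‖)
        (fun _ _ => Finset.sum_nonneg fun _ _ => norm_nonneg _) (Finset.mem_univ ζ))
  have hφc : ContinuousOn φ (Icc 0 τs) := continuousOn_finsetSum _ fun ζ _ =>
    continuousOn_finsetSum _ fun e _ =>
      (((mtrans r (sgn e • y)).continuous.comp_continuousOn (hF.continuousOn ζ)).sub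
        (hF.continuousOn ζ)).norm
  have hφ0 : ∀ t ∈ Icc 0 τs, 0 ≤ φ t := fun t _ => (norm_nonneg _).trans (hφ1 t 1 1)
  set W := (q / ϱ + 1) * μ + q ^ 2 / ϱ with hW
  have hqϱ : 0 ≤ q / ϱ := div_nonneg hq hϱ.le
  have hμW : μ ≤ W := by
    have : 0 ≤ q / ϱ * μ + q ^ 2 / ϱ := by positivity
    rw [hW, add_mul, one_mul]; linarith
  have hW0 : 0 ≤ W := hμ0.trans hμW
  have hWE : (q / ϱ + 1) * (μ * E) + q ^ 2 / ϱ ≤ E * W := by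
    have h1 : 0 ≤ q ^ 2 / ϱ := by positivity
    rw [hW]; nlinarith
  have hstep : ∀ t ∈ Icc 0 τs, ∀ ζ e, ‖mtrans r (sgn e • y) (v ζ t) - v ζ t‖
      ≤ (1 + 2 * K₁ + Ss * E * τs) * (D + ϱ + W) + Ss * ∫ s in (0 : ℝ)..t, φ s := by
    intro t ht ζ e
    set T := mtrans (J := J) r (sgn e • y) with hT
    have hr := (hest ϱ μ g h u hϱ hu hg hh hμ t ht).2 ζ
    set F : (m : ℕ) → (Fin m → ℤˣ) → ℝ → L1 d J := fun m σ s =>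
      waveTerm A B n kstar ϱ ζ m σ s fun ζ => v ζ s with hFdef
    set X := ∑ m ∈ B.degrees, ∑ σ : Fin m → ℤˣ,
      if ∑ j, (σ j : ℤ) = ζ then ∫ s in (0 : ℝ)..t, F m σ s else 0 with hX
    have iφ := intervalIntegrable_of_continuousOn hφc ht
    have hXb : ‖T X - X‖ ≤ Ss * E * τs * W + Ss * ∫ s in (0 : ℝ)..t, φ s := by
      have hI0 : 0 ≤ ∫ s in (0 : ℝ)..t, φ s := intervalIntegral.integral_nonneg ht.1 fun s hs =>
        hφ0 s (Icc_subset_of_mem ht hs)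
      have hb0 : 0 ≤ (∫ s in (0 : ℝ)..t, φ s) + E * W * τs := by positivity
      have : ‖T X - X‖ ≤ (∑ m ∈ B.degrees, ∑ σ, Ks m σ ζ)
          * ((∫ s in (0 : ℝ)..t, φ s) + E * W * τs) := by
        rw [hX, map_sum, ← Finset.sum_sub_distrib, Finset.sum_mul]
        refine (norm_sum_le _ _).trans (Finset.sum_le_sum fun m hm => ?_)
        rw [map_sum, ← Finset.sum_sub_distrib, Finset.sum_mul]
        refine (norm_sum_le _ _).trans (Finset.sum_le_sum fun σ _ => ?_)
        have hm0 : 0 < m := by have := B.two_le m hm; omega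
        split_ifs with hσ
        · have hcF : ContinuousOn (F m σ) (Icc 0 τs) :=
            continuousOn_osc (n, ζ) (fun j => (n, σ j)) hA hm0 ϱ (waveCoeff A B n kstar ζ m σ)
              fun j => hF.continuousOn (σ j)
          have iF := intervalIntegrable_of_continuousOn hcF ht
          have hcTF : ContinuousOn (fun s => T (F m σ s)) (Icc 0 τs) :=
            T.continuous.comp_continuousOn hcF
          rw [← T.intervalIntegral_comp_comm iF, ← intervalIntegral.integral_sub
            (intervalIntegrable_of_continuousOn hcTF ht) iF]
          have ib := (iφ.add (intervalIntegrable_const (c := E * W))).const_mul (Ks m σ ζ)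
          refine (intervalIntegral.norm_integral_le_of_norm_le ht.1
            (g := fun s => Ks m σ ζ * (φ s + E * W))
            (Filter.Eventually.of_forall fun s hs => ?_) ib).trans ?_
          · have hs' := Icc_subset_of_mem ht (Ioc_subset_Icc_self hs)
            refine (hKs m hm σ ζ hσ ϱ s q (φ s) (μ * E) r y (fun ζ => v ζ s) hϱ hϱ1 hs' hq hy
              (fun ζ => hF.norm_le ζ s hs') (fun ζ => hF.wmom_le ζ s hs')
              (fun ζ e => hφ1 s ζ e) e).trans (mul_le_mul_of_nonneg_left ?_ (hKs0 m σ ζ))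
            linarith
          · rw [intervalIntegral.integral_const_mul, intervalIntegral.integral_add iφ
              intervalIntegrable_const, intervalIntegral.integral_const, sub_zero, smul_eq_mul]
            refine mul_le_mul_of_nonneg_left (add_le_add le_rfl ?_) (hKs0 m σ ζ)
            rw [mul_comm]
            exact mul_le_mul_of_nonneg_left ht.2 (by positivity)
        · rw [map_zero, sub_zero, norm_zero]
          exact mul_nonneg (hKs0 m σ ζ) hb0
      refine this.trans ((mul_le_mul_of_nonneg_right (Finset.single_le_sum
        (fun ζ _ => hSζ0 ζ) (Finset.mem_univ ζ)) hb0).trans_eq ?_)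
      rw [← hSs]; ring
    set ρ := v ζ t - h ζ - X with hρ
    -- Defect of the datum, defect of the resonant terms, and the error of the effective equation;
    -- on the last one `T` is merely an isometry.
    have e1 : T (v ζ t) - v ζ t = (T (h ζ) - h ζ) + (T X - X) + (T ρ - ρ) := by
      rw [hρ, map_sub, map_sub]; abel
    have hρb : ‖T ρ - ρ‖ ≤ 2 * (K₁ * (ϱ + μ)) := by
      refine (norm_sub_le _ _).trans ?_
      rw [hT, norm_mtrans]
      have : ‖ρ‖ ≤ K₁ * (ϱ + μ) := hr
      linarith
    rw [e1]
    refine (norm_add₃_le).trans ((add_le_add (add_le_add (hD ζ e) hXb) hρb).trans ?_)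
    have p1 : 0 ≤ 2 * K₁ + Ss * E * τs := by positivity
    have p2 : 0 ≤ Ss * E * τs := by positivity
    nlinarith [mul_nonneg p1 hD0, mul_nonneg p2 hϱ.le, mul_nonneg p2 hD0,
      mul_le_mul_of_nonneg_left hμW hK₁, mul_nonneg hK₁ hD0]
  have hgr := gronwall_integral (φ := φ) (τ := τs) (K := K₂ * (D + ϱ + W)) (Λ := 4 * Ss)
    (by positivity) (by positivity) hφc hφ0 fun t ht => ?_
  · intro t ht ζ e
    refine (hφ1 t ζ e).trans ((hgr t ht).trans_eq ?_)
    rw [hW]; ring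
  · refine (Finset.sum_le_card_nsmul _ _ _ fun ζ _ => Finset.sum_le_card_nsmul _ _ _ fun e _ =>
      hstep t ht ζ e).trans_eq ?_
    rw [Finset.card_univ, Fintype.card_units_int, nsmul_eq_mul, nsmul_eq_mul, hK₂]
    push_cast
    ring

end WaveShift

/-! ### Interactions of waves with different group velocities. -/

section Mixed

variable {d J m : ℕ} {A : LinearPart d J}

lemma translate_zero (f : L1 d J) : translate 0 f = f := by
  refine L1_ext ?_
  filter_upwards [translate_coeFn 0 f] with k hk
  rw [hk, add_zero]

/-- The opposite shifts of two arguments. -/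
def dipole (j₁ j₂ : Fin m) (η : Wave d) (j : Fin m) : Wave d :=
  (if j = j₁ then η else 0) - if j = j₂ then η else 0

lemma sum_dipole (j₁ j₂ : Fin m) (η : Wave d) : ∑ j, dipole j₁ j₂ η j = 0 := by
  simp [dipole, Finset.sum_sub_distrib]

lemma sum_inner_dipole (j₁ j₂ : Fin m) (η : Wave d) (x : Fin m → Wave d) :
    ∑ j, inner ℝ (x j) (dipole j₁ j₂ η j) = inner ℝ (x j₁ - x j₂) η := by
  have : ∀ j, inner ℝ (x j) (dipole j₁ j₂ η j)
      = (if j = j₁ then inner ℝ (x j) η else 0) - if j = j₂ then inner ℝ (x j) η else 0 := by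
    intro j
    rw [dipole, inner_sub_right]
    congr 1 <;> split_ifs <;> simp
  simp_rw [this]
  rw [Finset.sum_sub_distrib, inner_sub_left]
  simp

lemma norm_dipole_le {j₁ j₂ : Fin m} (hj : j₁ ≠ j₂) (η : Wave d) (j : Fin m) :
    ‖dipole j₁ j₂ η j‖ ≤ ‖η‖ := by
  unfold dipole
  by_cases h1 : j = j₁
  · have h2 : j ≠ j₂ := fun h => hj (h1.symm.trans h)
    simp [h1, hj]
  · by_cases h2 : j = j₂
    · simp [h2, hj.symm]
    · simp [h1, h2]

/-- Pointwise decay of the interaction of waves with different group velocities. -/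
lemma exists_norm_osc_mixed_le (hA : A.Admissible) (hm : 0 < m) (i : Fin J × ℤˣ)
    (ι : Fin m → Fin J × ℤˣ) {c : Fin m → Wave d} (hc : ∀ j, c j ∉ A.bandCrossing)
    (hs : (∑ j, c j) ∉ A.bandCrossing) {j₁ j₂ : Fin m} (hj : j₁ ≠ j₂)
    (hp : gradient (A.om (ι j₁)) (c j₁) ≠ gradient (A.om (ι j₂)) (c j₂)) (a : MMap J m)
    {R τs K₀ : ℝ} (hR : 0 ≤ R) (hτs : 0 ≤ τs) (hK₀ : 0 ≤ K₀) :
    ∃ K, 0 ≤ K ∧ ∀ (ϱ b μ : ℝ) (r : Fin m → Wave d), 0 < ϱ → ϱ ≤ 1 → 1 ≤ b → μ ≤ K₀ * (ϱ * b) →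
      1 ≤ K₀ * (b ^ 2 * ϱ) → ∃ t₀ : ℝ, ∀ s ∈ Icc 0 τs, ∀ v : Fin m → L1 d J,
      (∀ j, ‖v j‖ ≤ R) → (∀ j, wmom (wt (c j)) (v j) ≤ μ) →
      (∀ j q y, 0 ≤ q → ‖y‖ ≤ q →
        ‖mtrans (r j) y (v j) - v j‖ ≤ K₀ * (q * b + ϱ + (q / ϱ + 1) * μ + q ^ 2 / ϱ)) →
      ‖osc A ϱ s i ι a v‖ ≤ K * (ϱ * b / (ϱ * b + |s - t₀|) + ϱ * b) := by
  obtain ⟨L, hL, hsh⟩ := exists_norm_shift_osc_sub_le i ι hA hm hc hs a hR hτs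
  set p := gradient (A.om (ι j₁)) (c j₁) - gradient (A.om (ι j₂)) (c j₂) with hpdef
  have hp0 : 0 < ‖p‖ := norm_pos_iff.2 (sub_ne_zero.2 hp)
  set P := Real.pi / ‖p‖ with hP
  have hP0 : 0 < P := by positivity
  set K₁ := L * (K₀ + 1) * ((P + K₀ * P + K₀ * P ^ 2) + (1 + K₀)) with hK₁
  have hK₁0 : 0 ≤ K₁ := by positivity
  set K₂ := 2 * (‖a‖ * R ^ m) with hK₂
  have hK₂0 : 0 ≤ K₂ := by positivity
  refine ⟨K₁ + K₂, by positivity, fun ϱ b μ r hϱ hϱ1 hb hμ hbϱ => ?_⟩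
  set α := ϱ * b with hα
  have hα0 : 0 < α := by positivity
  -- The time at which `r_{j₁} - r_{j₂} + (s/ϱ) p` is orthogonal to `p`, that is, the time of
  -- closest approach of the two packets.
  refine ⟨-ϱ * (inner ℝ (r j₁ - r j₂) p / ‖p‖ ^ 2), fun s hs v hvR hvμ hvD => ?_⟩
  set t₀ := -ϱ * (inner ℝ (r j₁ - r j₂) p / ‖p‖ ^ 2) with ht₀
  have hsum : 0 < α + |s - t₀| := by positivity
  -- During the encounter the trivial bound suffices, the quotient on the right being at least
  -- `1/2`.
  rcases lt_or_ge |s - t₀| α with hlt | hge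
  · have h1 : 1 ≤ 2 * (α / (α + |s - t₀|)) := by
      rw [mul_div_assoc', le_div_iff₀ hsum]; linarith
    have h2 := norm_apply_le_pow _ (norm_osc_le i ι hA hm ϱ s a) hR hvR
    have h4 : 0 ≤ α / (α + |s - t₀|) := by positivity
    have h3 : ‖a‖ * R ^ m ≤ K₂ * (α / (α + |s - t₀|)) := by
      have : 0 ≤ ‖a‖ * R ^ m := by positivity
      have := mul_le_mul_of_nonneg_left h1 this
      rw [hK₂]
      linarith
    linarith [mul_nonneg hK₁0 h4, mul_nonneg hK₁0 hα0.le, mul_nonneg hK₂0 hα0.le]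
  · have hst0 : 0 < |s - t₀| := hα0.trans_le hge
    have hst : s - t₀ ≠ 0 := abs_pos.1 hst0
    set z := α / |s - t₀| with hz
    have hz0 : 0 ≤ z := by positivity
    have hz1 : z ≤ 1 := by rw [hz, div_le_one hst0]; exact hge
    have hz2 : z ≤ 2 * (α / (α + |s - t₀|)) := by
      rw [hz, mul_div_assoc', div_le_div_iff₀ hst0 hsum]
      nlinarith
    -- The shift `η` is parallel to `p` with `p·η = x`. This value makes the position phase and the
    -- group velocity phase differ by exactly `π`.
    set x := Real.pi * ϱ / (s - t₀) with hx
    set η := (x / ‖p‖ ^ 2) • p with hη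
    set q := ‖η‖ with hq
    have hq0 : 0 ≤ q := norm_nonneg _
    have hqe : q = P * ϱ / |s - t₀| := by
      rw [hq, hη, norm_smul, Real.norm_eq_abs, abs_div, hx, abs_div, abs_of_nonneg (sq_nonneg ‖p‖),
        abs_of_pos (by positivity : 0 < Real.pi * ϱ), hP]
      field_simp
    have hqb : q * b = P * z := by rw [hqe, hz, hα]; ring
    have hμ0 : 0 ≤ μ := ((isWeight_wt _).wmom_nonneg _).trans (hvμ j₁)
    set Z := q * b + ϱ + (q / ϱ + 1) * μ + q ^ 2 / ϱ with hZ
    -- The bound on `μ` controls `qμ/ϱ` by `q b`, and `1 ≤ K₀ b²ϱ` controls `q²/ϱ` by `(q b)²`.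
    -- Since `q b = P z` with `z ≤ 1`, the quadratic term is also linear in `z`.
    have hZb : Z ≤ (P + K₀ * P + K₀ * P ^ 2) * z + (1 + K₀) * α := by
      have e1 : q / ϱ * μ ≤ K₀ * P * z := by
        calc q / ϱ * μ ≤ q / ϱ * (K₀ * (ϱ * b)) := by gcongr
          _ = K₀ * (q * b) := by field_simp
          _ = K₀ * P * z := by rw [hqb]; ring
      have e2 : q ^ 2 / ϱ ≤ K₀ * P ^ 2 * z := by
        have e3 : q ^ 2 ≤ K₀ * (q * b) ^ 2 * ϱ := by
          calc q ^ 2 = q ^ 2 * 1 := (mul_one _).symm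
            _ ≤ q ^ 2 * (K₀ * (b ^ 2 * ϱ)) := by gcongr
            _ = _ := by ring
        calc q ^ 2 / ϱ ≤ K₀ * (q * b) ^ 2 * ϱ / ϱ := by gcongr
          _ = K₀ * (q * b) ^ 2 := by field_simp
          _ = K₀ * P ^ 2 * (z * z) := by rw [hqb]; ring
          _ ≤ K₀ * P ^ 2 * (z * 1) := by gcongr
          _ = K₀ * P ^ 2 * z := by ring
      have e4 : ϱ ≤ α := le_mul_of_one_le_right hϱ.le hb
      rw [hZ, hqb, add_mul (q / ϱ), one_mul]
      linarith
    have hZ0 : 0 ≤ Z := by positivity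
    have h1 := hsh ϱ s q (K₀ * Z) μ r (dipole j₁ j₂ η) v hϱ hϱ1 hs hq0
      (fun j => norm_dipole_le hj η j) hvR hvμ fun j =>
        hvD j q _ hq0 (norm_dipole_le hj η j)
    have hslope : mismatchSlope A i ι c (dipole j₁ j₂ η) = -inner ℝ p η := by
      rw [mismatchSlope, sum_dipole, inner_zero_right, zero_sub,
        sum_inner_dipole j₁ j₂ η fun j => gradient (A.om (ι j)) (c j)]
    rw [sum_dipole, sum_inner_dipole, translate_zero, hslope] at h1
    have hpη : inner ℝ p η = x := by
      rw [hη, inner_smul_right, real_inner_self_eq_norm_sq]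
      field_simp
    have hrη : inner ℝ (r j₁ - r j₂) η = s / ϱ * -x + Real.pi := by
      rw [hη, inner_smul_right]
      have e5 : inner ℝ (r j₁ - r j₂) p / ‖p‖ ^ 2 = -t₀ / ϱ := by
        rw [ht₀]; field_simp; try ring
      have e6 : x / ‖p‖ ^ 2 * inner ℝ (r j₁ - r j₂) p
          = x * (inner ℝ (r j₁ - r j₂) p / ‖p‖ ^ 2) := by ring
      have e7 : x * (s - t₀) = Real.pi * ϱ := by rw [hx]; field_simp
      rw [e6, e5]
      field_simp
      linarith
    rw [hpη, hrη] at h1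
    -- With opposite factors the difference in `h1` becomes a unimodular multiple of twice the
    -- operator, so the shift error bounds the operator itself.
    have e8 : Complex.exp (((s / ϱ * -x + Real.pi : ℝ) : ℂ) * Complex.I)
        = -Complex.exp (((s / ϱ * -x : ℝ) : ℂ) * Complex.I) := by
      rw [Complex.ofReal_add, add_mul, Complex.exp_add, Complex.exp_pi_mul_I, mul_neg_one]
    rw [e8, neg_smul, ← neg_add', norm_neg, ← two_smul ℂ, norm_smul, norm_smul,
      Complex.norm_exp_ofReal_mul_I, one_mul, Complex.norm_ofNat] at h1
    have h2 : K₀ * Z + (q / ϱ + 1) * μ + q ^ 2 / ϱ ≤ (K₀ + 1) * Z := by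
      have : 0 ≤ q * b + ϱ := by positivity
      rw [add_mul, one_mul]
      linarith
    have h3 : 2 * ‖osc A ϱ s i ι a v‖ ≤ K₁ * z + K₁ * α := by
      refine (h1.trans (mul_le_mul_of_nonneg_left (h2.trans (mul_le_mul_of_nonneg_left hZb
        (by positivity))) hL)).trans ?_
      have q1 : 0 ≤ L * (K₀ + 1) := by positivity
      have q2 : 0 ≤ (P + K₀ * P + K₀ * P ^ 2) * α := by positivity
      have q3 : 0 ≤ (1 + K₀) * z := by positivity
      have e9 : K₁ * z + K₁ * α - L * ((K₀ + 1) * ((P + K₀ * P + K₀ * P ^ 2) * z + (1 + K₀) * α))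
          = L * (K₀ + 1) * ((P + K₀ * P + K₀ * P ^ 2) * α + (1 + K₀) * z) := by rw [hK₁]; ring
      have := mul_nonneg q1 (add_nonneg q2 q3)
      linarith
    have h4 : 0 ≤ α / (α + |s - t₀|) := by positivity
    linarith [mul_le_mul_of_nonneg_left hz2 hK₁0, mul_nonneg hK₂0 h4, mul_nonneg hK₂0 hα0.le,
      mul_nonneg hK₁0 hα0.le]

/-- Smallness of the interaction of waves with different group velocities. -/
theorem exists_norm_integral_mixed_le (hA : A.Admissible) (hm : 0 < m) (i : Fin J × ℤˣ)
    (ι : Fin m → Fin J × ℤˣ) {c : Fin m → Wave d} (hc : ∀ j, c j ∉ A.bandCrossing)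
    (hs : (∑ j, c j) ∉ A.bandCrossing) {j₁ j₂ : Fin m} (hj : j₁ ≠ j₂)
    (hp : gradient (A.om (ι j₁)) (c j₁) ≠ gradient (A.om (ι j₂)) (c j₂)) (a : MMap J m)
    {R M τs K₀ : ℝ} (hR : 0 ≤ R) (hτs : 0 ≤ τs) (hK₀ : 0 ≤ K₀) :
    ∃ K, 0 ≤ K ∧ ∀ (ϱ b μ : ℝ) (r : Fin m → Wave d) (v : Fin m → ℝ → L1 d J), 0 < ϱ → ϱ ≤ 1 →
      1 ≤ b → μ ≤ K₀ * (ϱ * b) → 1 ≤ K₀ * (b ^ 2 * ϱ) → IsWaveFamily A τs R M μ ι c v →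
      (∀ j, ∀ s ∈ Icc 0 τs, ∀ q y, 0 ≤ q → ‖y‖ ≤ q → ‖mtrans (r j) y (v j s) - v j s‖
        ≤ K₀ * (q * b + ϱ + (q / ϱ + 1) * μ + q ^ 2 / ϱ)) → ∀ t ∈ Icc 0 τs,
      ‖∫ s in (0 : ℝ)..t, osc A ϱ s i ι a fun j => v j s‖
        ≤ K * (ϱ * b * (1 + Real.log (1 + τs / (ϱ * b)))) := by
  obtain ⟨K, hK, h⟩ := exists_norm_osc_mixed_le hA hm i ι hc hs hj hp a hR hτs hK₀
  refine ⟨K * (2 + τs), by positivity, fun ϱ b μ r v hϱ hϱ1 hb hμ hbϱ hv hvD t ht => ?_⟩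
  obtain ⟨t₀, h⟩ := h ϱ b μ r hϱ hϱ1 hb hμ hbϱ
  set α := ϱ * b with hα
  have hα0 : 0 < α := by positivity
  have hc1 : Continuous fun s => α / (α + |s - t₀|) := by
    refine continuous_const.div (by fun_prop) fun s => ?_
    positivity
  have i1 : IntervalIntegrable (fun s => α / (α + |s - t₀|)) volume 0 t :=
    hc1.intervalIntegrable _ _
  refine (intervalIntegral.norm_integral_le_of_norm_le ht.1
    (g := fun s => K * (α / (α + |s - t₀|) + α)) (Filter.Eventually.of_forall fun s hs => ?_)
    ((i1.add intervalIntegrable_const).const_mul K)).trans ?_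
  · have hs' := Icc_subset_of_mem ht (Ioc_subset_Icc_self hs)
    exact h s hs' (fun j => v j s) (fun j => hv.norm_le j s hs') (fun j => hv.wmom_le j s hs')
      fun j q y hq hy => hvD j s hs' q y hq hy
  · rw [intervalIntegral.integral_const_mul, intervalIntegral.integral_add i1
      intervalIntegrable_const, intervalIntegral.integral_const, sub_zero, smul_eq_mul, mul_assoc]
    refine mul_le_mul_of_nonneg_left ?_ hK
    have h1 := integral_inv_add_abs_le (t₀ := t₀) ht.1 hα0
    have h2 : Real.log (1 + t / α) ≤ Real.log (1 + τs / α) := by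
      have := ht.1
      refine Real.log_le_log (by positivity) ?_
      gcongr
      exact ht.2
    have h3 : 0 ≤ Real.log (1 + τs / α) := Real.log_nonneg (by
      have : 0 ≤ τs / α := by positivity
      linarith)
    have h4 := mul_le_mul_of_nonneg_left h2 hα0.le
    have h5 := mul_le_mul_of_nonneg_right ht.2 hα0.le
    nlinarith [mul_nonneg hτs (mul_nonneg hα0.le h3)]

end Mixed

/-! ### Reduction of the superposition principle to mixed interactions. -/

section Superposition

variable {d J N : ℕ} {A : LinearPart d J} {B : Nonlinearity d J} {Cχ : ℝ}

lemma sum_mulOp_projL (hA : A.Admissible) (f : L1 d J) : ∑ i, mulOp (A.projL i) f = f := by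
  refine L1_ext ?_
  have h1 : ∀ᵐ k, ∀ i ∈ (Finset.univ : Finset (Fin J × ℤˣ)),
      (mulOp (A.projL i) f : L1 d J) k = A.projL i k (f k) :=
    (Finset.eventually_all _).2 fun i _ => mulOp_coeFn (isMult_projL hA i) f
  filter_upwards [h1, Lp.coeFn_fun_finsetSum Finset.univ (fun i => mulOp (A.projL i) f)] with k g1 g2
  rw [g2, Finset.sum_congr rfl g1, A.sum_projL]

/-- Smallness of the mixed interactions. -/
lemma exists_norm_integral_interaction_mixed_le (hA : A.Admissible) (hB : B.Admissible A Cχ)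
    {m : ℕ} (hm : m ∈ B.degrees) (ι : Fin m → Fin J × ℤˣ) {c : Fin m → Wave d}
    (hc : ∀ j, c j ∉ A.bandCrossing) (hs : (∑ j, c j) ∉ A.bandCrossing) {j₁ j₂ : Fin m}
    (hj : j₁ ≠ j₂)
    (hp : gradient (A.om (ι j₁)) (c j₁) ≠ gradient (A.om (ι j₂)) (c j₂))
    {R M τs K₀ : ℝ} (hR : 0 ≤ R) (hτs : 0 ≤ τs) (hK₀ : 0 ≤ K₀) :
    ∃ K, 0 ≤ K ∧ ∀ (ϱ b μ : ℝ) (r : Fin m → Wave d) (v : Fin m → ℝ → L1 d J), 0 < ϱ → ϱ ≤ 1 →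
      1 ≤ b → 0 ≤ μ → μ ≤ K₀ * (ϱ * b) → 1 ≤ K₀ * (b ^ 2 * ϱ) → IsWaveFamily A τs R M μ ι c v →
      (∀ j, ∀ s ∈ Icc 0 τs, ∀ q y, 0 ≤ q → ‖y‖ ≤ q → ‖mtrans (r j) y (v j s) - v j s‖
        ≤ K₀ * (q * b + ϱ + (q / ϱ + 1) * μ + q ^ 2 / ϱ)) → ∀ t ∈ Icc 0 τs,
      ‖∫ s in (0 : ℝ)..t, interaction A B ϱ s fun j => v j s‖
        ≤ K * (ϱ * b * (1 + Real.log (1 + τs / (ϱ * b)))) := by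
  have hm0 : 0 < m := by have := B.two_le m hm; omega
  have hi : ∀ i : Fin J × ℤˣ, ∃ K, 0 ≤ K ∧ ∀ (ϱ b μ : ℝ) (r : Fin m → Wave d)
      (v : Fin m → ℝ → L1 d J), 0 < ϱ → ϱ ≤ 1 →
      1 ≤ b → 0 ≤ μ → μ ≤ K₀ * (ϱ * b) → 1 ≤ K₀ * (b ^ 2 * ϱ) → IsWaveFamily A τs R M μ ι c v →
      (∀ j, ∀ s ∈ Icc 0 τs, ∀ q y, 0 ≤ q → ‖y‖ ≤ q → ‖mtrans (r j) y (v j s) - v j s‖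
        ≤ K₀ * (q * b + ϱ + (q / ϱ + 1) * μ + q ^ 2 / ϱ)) → ∀ t ∈ Icc 0 τs,
      ‖∫ s in (0 : ℝ)..t, mulOp (A.projL i) (interaction A B ϱ s fun j => v j s)‖
        ≤ K * (ϱ * b * (1 + Real.log (1 + τs / (ϱ * b)))) := by
    intro i
    obtain ⟨CP, hCP, hPL⟩ := exists_eventually_projL_lipschitz i hA hs
    obtain ⟨K₁, hK₁, h1⟩ := exists_norm_integral_band_sub_le hA hB hm (ι := ι) hc hs
      (isBandMult_projL hA i) hCP hPL (M := M) hR hτs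
    obtain ⟨K₂, hK₂, h2⟩ := exists_norm_integral_mixed_le hA hm0 i ι hc hs hj hp
      ((A.projL i (∑ j, c j)).compContinuousMultilinearMap (B.ker m c)) (M := M) hR hτs hK₀
    refine ⟨K₁ * K₀ + K₂, by positivity, fun ϱ b μ r v hϱ hϱ1 hb hμ0 hμ hbϱ hv hvD t ht => ?_⟩
    have g1 := h1 ϱ μ v hμ0 hv t ht
    have g2 := h2 ϱ b μ r v hϱ hϱ1 hb hμ hbϱ hv hvD t ht
    refine (norm_le_norm_sub_add _ _).trans ((add_le_add g1 g2).trans ?_)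
    rw [add_mul]
    refine add_le_add ?_ le_rfl
    rw [mul_assoc]
    refine mul_le_mul_of_nonneg_left (hμ.trans (mul_le_mul_of_nonneg_left ?_ hK₀)) hK₁
    have : 0 ≤ Real.log (1 + τs / (ϱ * b)) := Real.log_nonneg (by
      have : 0 ≤ τs / (ϱ * b) := by positivity
      linarith)
    exact le_mul_of_one_le_right (by positivity) (by linarith)
  choose K hK h using hi
  refine ⟨∑ i, K i, Finset.sum_nonneg fun i _ => hK i,
    fun ϱ b μ r v hϱ hϱ1 hb hμ0 hμ hbϱ hv hvD t ht => ?_⟩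
  have hcI := continuousOn_interaction (B := B) hA ϱ fun j => hv.continuousOn j
  have e1 : ∫ s in (0 : ℝ)..t, interaction A B ϱ s (fun j => v j s)
      = ∑ i, ∫ s in (0 : ℝ)..t, mulOp (A.projL i) (interaction A B ϱ s fun j => v j s) := by
    have hci : ∀ i, ContinuousOn (fun s => mulOp (A.projL i)
        (interaction A B ϱ s fun j => v j s)) (Icc 0 τs) := fun i =>
      (mulOp (A.projL i)).continuous.comp_continuousOn hcI
    rw [← intervalIntegral.integral_finsetSum fun i _ =>
      intervalIntegrable_of_continuousOn (hci i) ht]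
    simp_rw [sum_mulOp_projL hA]
  rw [e1, Finset.sum_mul]
  exact (norm_sum_le _ _).trans (Finset.sum_le_sum fun i _ =>
    h i ϱ b μ r v hϱ hϱ1 hb hμ0 hμ hbϱ hv hvD t ht)

lemma interaction_eq_zero {m : ℕ} (ϱ s : ℝ) {w : Fin m → L1 d J} {j : Fin m} (h : w j = 0) :
    interaction A B ϱ s w = 0 := by
  rw [interaction, (kop (B.ker m)).map_coord_zero j (by rw [h, map_zero]), map_zero]

/-- The part of the family `v` belonging to the wave `l`. -/
def onlyWave (v : ℤˣ × Fin N → L1 d J) (l : Fin N) (p : ℤˣ × Fin N) : L1 d J :=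
  if p.2 = l then v p else 0

lemma sum_onlyWave (v : ℤˣ × Fin N → L1 d J) (l : Fin N) :
    ∑ p, onlyWave v l p = ∑ ζ, v (ζ, l) := by
  rw [Fintype.sum_prod_type]
  refine Finset.sum_congr rfl fun ζ _ => ?_
  simp [onlyWave]

/-- Only the mixed interactions contribute to the defect of additivity. -/
lemma slowL1_sum_sub (hA : A.Admissible) (hB : B.Admissible A Cχ) (ϱ s : ℝ)
    (v : ℤˣ × Fin N → L1 d J) :
    B.slowL1 A ϱ s (∑ p, v p) - ∑ l, B.slowL1 A ϱ s (∑ ζ, v (ζ, l))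
      = ∑ m ∈ B.degrees, ∑ lam : Fin m → ℤˣ × Fin N,
          if ∃ j₁ j₂, (lam j₁).2 ≠ (lam j₂).2 then interaction A B ϱ s fun j => v (lam j)
          else 0 := by
  simp_rw [← sum_onlyWave, slowL1_sum hA hB]
  rw [Finset.sum_comm, ← Finset.sum_sub_distrib]
  refine Finset.sum_congr rfl fun m hm => ?_
  have hm0 : 0 < m := by have := B.two_le m hm; omega
  rw [Finset.sum_comm, ← Finset.sum_sub_distrib]
  refine Finset.sum_congr rfl fun lam _ => ?_
  split_ifs with h
  · obtain ⟨j₁, j₂, hne⟩ := h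
    rw [Finset.sum_eq_zero, sub_zero]
    intro l _
    by_cases h1 : (lam j₁).2 = l
    · exact interaction_eq_zero ϱ s (j := j₂) (if_neg fun h2 => hne (h1.trans h2.symm))
    · exact interaction_eq_zero ϱ s (j := j₁) (if_neg h1)
  · push Not at h
    have h0 := fun j => h j ⟨0, hm0⟩
    rw [sub_eq_zero, Finset.sum_eq_single (lam ⟨0, hm0⟩).2]
    · congr 1
      funext j
      rw [onlyWave, if_pos (h0 j)]
    · intro l _ hl
      exact interaction_eq_zero ϱ s (j := ⟨0, hm0⟩) (if_neg hl.symm)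
    · exact fun h => absurd (Finset.mem_univ _) h

/-- The superposition principle for solutions which are close to families of waves. -/
theorem exists_superposition_estimate (hA : A.Admissible) (hB : B.Admissible A Cχ)
    (S : Fin N → Fin J × Wave d) (hk : ∀ l ζ, sgn ζ • (S l).2 ∉ A.bandCrossing)
    (hout : ∀ m ∈ B.degrees, ∀ lam : Fin m → ℤˣ × Fin N, kappa S lam ∉ A.bandCrossing)
    {G : Fin N → Wave d} (hG : ∀ l ζ, gradient (A.om ((S l).1, ζ)) (sgn ζ • (S l).2) = G l)
    (hGne : Function.Injective G) {R τs K₀ : ℝ} (hR : 0 < R) (hτs : 0 ≤ τs) (hK₀ : 0 ≤ K₀) :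
    ∃ K, 0 ≤ K ∧ ∀ (ϱ b μ δ : ℝ) (r : Fin N → Wave d) (h : Fin N → L1 d J) (u : ℝ → L1 d J)
      (w : Fin N → ℝ → L1 d J) (v : ℤˣ × Fin N → ℝ → L1 d J), 0 < ϱ → ϱ ≤ 1 → 1 ≤ b → 0 ≤ μ →
      0 ≤ δ → μ ≤ K₀ * (ϱ * b) → 1 ≤ K₀ * (b ^ 2 * ϱ) → IsSolution A B ϱ τs R (∑ l, h l) u →
      (∀ l, IsSolution A B ϱ τs R (h l) (w l)) →
      IsWaveFamily A τs (2 * R) (bnd B Cχ (2 * R)) μ (fun p : ℤˣ × Fin N => ((S p.2).1, p.1))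
        (fun p => sgn p.1 • (S p.2).2) v →
      (∀ p, ∀ s ∈ Icc 0 τs, ∀ q y, 0 ≤ q → ‖y‖ ≤ q → ‖mtrans (r p.2) y (v p s) - v p s‖
        ≤ K₀ * (q * b + ϱ + (q / ϱ + 1) * μ + q ^ 2 / ϱ)) →
      (∀ l, ∀ t ∈ Icc 0 τs, ‖w l t - ∑ ζ, v (ζ, l) t‖ ≤ δ) → ∀ t ∈ Icc 0 τs,
      ‖u t - ∑ l, w l t‖ ≤ K * (ϱ * b * (1 + Real.log (1 + τs / (ϱ * b))) + δ) := by
  have h2R : 0 ≤ 2 * R := by positivity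
  have hmix : ∀ m ∈ B.degrees, ∀ (lam : Fin m → ℤˣ × Fin N) (_ : Unit), ∃ K, 0 ≤ K ∧
      ((∃ j₁ j₂, (lam j₁).2 ≠ (lam j₂).2) → ∀ (ϱ b μ : ℝ) (r : Fin N → Wave d)
      (v : ℤˣ × Fin N → ℝ → L1 d J), 0 < ϱ → ϱ ≤ 1 → 1 ≤ b → 0 ≤ μ → μ ≤ K₀ * (ϱ * b) →
      1 ≤ K₀ * (b ^ 2 * ϱ) →
      IsWaveFamily A τs (2 * R) (bnd B Cχ (2 * R)) μ (fun p : ℤˣ × Fin N => ((S p.2).1, p.1))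
        (fun p => sgn p.1 • (S p.2).2) v →
      (∀ p, ∀ s ∈ Icc 0 τs, ∀ q y, 0 ≤ q → ‖y‖ ≤ q → ‖mtrans (r p.2) y (v p s) - v p s‖
        ≤ K₀ * (q * b + ϱ + (q / ϱ + 1) * μ + q ^ 2 / ϱ)) → ∀ t ∈ Icc 0 τs,
      ‖∫ s in (0 : ℝ)..t, interaction A B ϱ s fun j => v (lam j) s‖
        ≤ K * (ϱ * b * (1 + Real.log (1 + τs / (ϱ * b))))) := by
    intro m hm lam _
    by_cases hne : ∃ j₁ j₂, (lam j₁).2 ≠ (lam j₂).2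
    · obtain ⟨j₁, j₂, hne⟩ := hne
      obtain ⟨K, hK, hb⟩ := exists_norm_integral_interaction_mixed_le hA hB hm
        (fun j => ((S (lam j).2).1, (lam j).1)) (c := fun j => sgn (lam j).1 • (S (lam j).2).2)
        (fun j => hk _ _) (hout m hm lam) (j₁ := j₁) (j₂ := j₂) (fun h => hne (by rw [h]))
        (by rw [hG, hG]; exact fun h => hne (hGne h)) (M := bnd B Cχ (2 * R)) h2R hτs hK₀
      exact ⟨K, hK, fun _ ϱ b μ r v hϱ hϱ1 hb1 hμ0 hμ hbϱ hv hvD t ht =>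
        hb ϱ b μ (fun j => r (lam j).2) (fun j => v (lam j)) hϱ hϱ1 hb1 hμ0 hμ hbϱ (hv.comp lam)
          (fun j => hvD (lam j)) t ht⟩
    · exact ⟨0, le_rfl, fun h => absurd h hne⟩
  obtain ⟨Km, hKm0, hKm⟩ := exists_uniform_bound (α := fun m => Fin m → ℤˣ × Fin N) B.degrees hmix
  set Sm := ∑ m ∈ B.degrees, ∑ lam, Km m lam () with hSm
  have hSm0 : 0 ≤ Sm := Finset.sum_nonneg fun m _ => Finset.sum_nonneg fun lam _ => hKm0 m lam ()
  -- A radius that contains the solutions, their sum, each pair of components, and the sum of all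
  -- components.
  set ρ : ℝ := 2 * (N * (2 * R)) + 2 * (2 * R) with hρ
  have hρ0 : 0 ≤ ρ := by positivity
  set Λ := lip B Cχ ρ with hΛ
  have hΛ0 : 0 ≤ Λ := lip_nonneg hA hB hρ0
  refine ⟨(Sm + 2 * (Λ * N * τs)) * Real.exp (Λ * τs), by positivity,
    fun ϱ b μ δ r h u w v hϱ hϱ1 hb hμ0 hδ hμ hbϱ hu hw hv hvD hwv => ?_⟩
  set X := ϱ * b * (1 + Real.log (1 + τs / (ϱ * b))) with hX
  have hX0 : 0 ≤ X := by
    have : 0 ≤ Real.log (1 + τs / (ϱ * b)) := Real.log_nonneg (by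
      have : 0 ≤ τs / (ϱ * b) := by positivity
      linarith)
    positivity
  set y : ℝ → L1 d J := fun t => ∑ l, w l t with hy
  set z : Fin N → ℝ → L1 d J := fun l t => ∑ ζ, v (ζ, l) t with hz
  have hyc : ContinuousOn y (Icc 0 τs) := continuousOn_finsetSum _ fun l _ => (hw l).continuousOn
  have hzc : ∀ l, ContinuousOn (z l) (Icc 0 τs) := fun l =>
    continuousOn_finsetSum _ fun ζ _ => hv.continuousOn (ζ, l)
  have hNR : 0 ≤ (N : ℝ) * (2 * R) := by positivity
  have hzR : ∀ l, ∀ t ∈ Icc 0 τs, ‖z l t‖ ≤ 2 * (2 * R) := fun l t ht => by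
    refine (norm_sum_le _ _).trans ((Finset.sum_le_card_nsmul _ _ _
      fun ζ _ => hv.norm_le (ζ, l) t ht).trans_eq ?_)
    rw [Finset.card_univ, Fintype.card_units_int, nsmul_eq_mul]; norm_num
  have hsumle : ∀ (f : Fin N → L1 d J) (e : ℝ), (∀ l, ‖f l‖ ≤ e) → ‖∑ l, f l‖ ≤ N * e := by
    intro f e hf
    refine (norm_sum_le _ _).trans ((Finset.sum_le_card_nsmul _ _ _ fun l _ => hf l).trans_eq ?_)
    rw [Finset.card_univ, Fintype.card_fin, nsmul_eq_mul]
  have hyR : ∀ t ∈ Icc 0 τs, ‖y t‖ ≤ ρ := fun t ht => by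
    have := hsumle (fun l => w l t) (2 * R) fun l => (hw l).bound t ht
    exact this.trans (by rw [hρ]; linarith)
  have hzsum : ∀ t, ∑ l, z l t = ∑ p, v p t := fun t => by
    rw [Fintype.sum_prod_type, Finset.sum_comm]
  have hZR : ∀ t ∈ Icc 0 τs, ‖∑ l, z l t‖ ≤ ρ := fun t ht => by
    have := hsumle (fun l => z l t) (2 * (2 * R)) fun l => hzR l t ht
    exact this.trans (by rw [hρ]; linarith)
  have hZc : ContinuousOn (fun t => ∑ l, z l t) (Icc 0 τs) :=
    continuousOn_finsetSum _ fun l _ => hzc l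
  have hmain := norm_sub_le_of_residual hA hB (ϱ := ϱ) (r := ρ)
    (e := Sm * X + 2 * (Λ * N * τs) * δ) hρ0 (by positivity) hu.continuousOn hyc
    (fun t ht => (hu.bound t ht).trans (by rw [hρ]; linarith)) hyR fun t ht => ?_
  · intro t ht
    refine (hmain t ht).trans ?_
    have hE : 0 ≤ Real.exp (Λ * τs) := (Real.exp_pos _).le
    have h0 : 0 ≤ Λ * N * τs := by positivity
    have h1 : Sm * X + 2 * (Λ * N * τs) * δ ≤ (Sm + 2 * (Λ * N * τs)) * (X + δ) := by
      linarith [mul_nonneg hSm0 hδ, mul_nonneg h0 hX0]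
    refine (mul_le_mul_of_nonneg_right h1 hE).trans_eq ?_
    ring
  · have isl := fun {f : ℝ → L1 d J} (hf : ContinuousOn f (Icc 0 τs)) =>
      continuousOn_slowL1 hA hB ϱ hf
    have ii := fun {f : ℝ → L1 d J} (hf : ContinuousOn f (Icc 0 τs)) =>
      intervalIntegrable_of_continuousOn (isl hf) ht
    -- The data cancel, and the residual of `∑ w_l` is the defect of additivity of the nonlinearity.
    -- Passing from `w_l` to its wave components costs `δ` and leaves only mixed interactions.
    have e1 : u t - y t - ((∫ s in (0 : ℝ)..t, B.slowL1 A ϱ s (u s))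
        - ∫ s in (0 : ℝ)..t, B.slowL1 A ϱ s (y s))
        = (∫ s in (0 : ℝ)..t, B.slowL1 A ϱ s (y s))
          - ∑ l, ∫ s in (0 : ℝ)..t, B.slowL1 A ϱ s (w l s) := by
      have e2 : y t = ∑ l, h l + ∑ l, ∫ s in (0 : ℝ)..t, B.slowL1 A ϱ s (w l s) := by
        rw [← Finset.sum_add_distrib]
        exact Finset.sum_congr rfl fun l _ => (hw l).equation t ht
      rw [e2, hu.equation t ht]
      abel
    have e3 : (∫ s in (0 : ℝ)..t, B.slowL1 A ϱ s (∑ l, z l s))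
          - ∑ l, ∫ s in (0 : ℝ)..t, B.slowL1 A ϱ s (z l s)
        = ∑ m ∈ B.degrees, ∑ lam : Fin m → ℤˣ × Fin N,
          if ∃ j₁ j₂, (lam j₁).2 ≠ (lam j₂).2 then
            ∫ s in (0 : ℝ)..t, interaction A B ϱ s fun j => v (lam j) s else 0 := by
      have hci : ∀ (m : ℕ) (lam : Fin m → ℤˣ × Fin N), ContinuousOn
          (fun s => if ∃ j₁ j₂, (lam j₁).2 ≠ (lam j₂).2 then
            interaction A B ϱ s fun j => v (lam j) s else 0) (Icc 0 τs) := fun m lam => by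
        split_ifs
        · exact continuousOn_interaction hA ϱ fun j => hv.continuousOn (lam j)
        · exact continuousOn_const
      rw [← intervalIntegral.integral_finsetSum fun l _ => ii (hzc l),
        ← intervalIntegral.integral_sub (ii hZc)
          (intervalIntegrable_of_continuousOn (continuousOn_finsetSum _ fun l _ => isl (hzc l)) ht)]
      simp_rw [hzsum, hz, slowL1_sum_sub hA hB ϱ _ fun p => v p _]
      rw [intervalIntegral.integral_finsetSum fun m _ => intervalIntegrable_of_continuousOn
        (continuousOn_finsetSum _ fun lam _ => hci m lam) ht]
      refine Finset.sum_congr rfl fun m _ => ?_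
      rw [intervalIntegral.integral_finsetSum fun lam _ =>
        intervalIntegrable_of_continuousOn (hci m lam) ht]
      refine Finset.sum_congr rfl fun lam _ => ?_
      split_ifs
      · rfl
      · simp
    have b3 : ‖(∫ s in (0 : ℝ)..t, B.slowL1 A ϱ s (∑ l, z l s))
          - ∑ l, ∫ s in (0 : ℝ)..t, B.slowL1 A ϱ s (z l s)‖ ≤ Sm * X := by
      rw [e3, hSm, Finset.sum_mul]
      refine (norm_sum_le _ _).trans (Finset.sum_le_sum fun m hm => ?_)
      rw [Finset.sum_mul]
      refine (norm_sum_le _ _).trans (Finset.sum_le_sum fun lam _ => ?_)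
      split_ifs with hne
      · exact hKm m hm lam () hne ϱ b μ r v hϱ hϱ1 hb hμ0 hμ hbϱ hv hvD t ht
      · rw [norm_zero]; exact mul_nonneg (hKm0 m lam ()) hX0
    have b4 : ‖(∫ s in (0 : ℝ)..t, B.slowL1 A ϱ s (y s))
        - ∫ s in (0 : ℝ)..t, B.slowL1 A ϱ s (∑ l, z l s)‖ ≤ Λ * (N * δ) * τs := by
      refine norm_integral_sub_integral_le (by positivity) (isl hyc) (isl hZc) (fun s hs => ?_) t ht
      refine (norm_slowL1_sub_le hA hB ϱ s (hyR s hs) (hZR s hs)).trans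
        (mul_le_mul_of_nonneg_left ?_ hΛ0)
      rw [hy, ← Finset.sum_sub_distrib]
      exact hsumle _ δ fun l => hwv l s hs
    have b5 : ‖(∑ l, ∫ s in (0 : ℝ)..t, B.slowL1 A ϱ s (z l s))
        - ∑ l, ∫ s in (0 : ℝ)..t, B.slowL1 A ϱ s (w l s)‖ ≤ N * (Λ * δ * τs) := by
      rw [← Finset.sum_sub_distrib]
      refine hsumle _ _ fun l => norm_integral_sub_integral_le (by positivity) (isl (hzc l))
        (isl (hw l).continuousOn) (fun s hs => ?_) t ht
      refine (norm_slowL1_sub_le hA hB ϱ s ((hzR l s hs).trans (by rw [hρ]; linarith))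
        (((hw l).bound s hs).trans (by rw [hρ]; linarith))).trans
        (mul_le_mul_of_nonneg_left ?_ hΛ0)
      rw [norm_sub_rev]
      exact hwv l s hs
    rw [e1]
    have e6 : (∫ s in (0 : ℝ)..t, B.slowL1 A ϱ s (y s))
          - ∑ l, ∫ s in (0 : ℝ)..t, B.slowL1 A ϱ s (w l s)
        = ((∫ s in (0 : ℝ)..t, B.slowL1 A ϱ s (y s))
            - ∫ s in (0 : ℝ)..t, B.slowL1 A ϱ s (∑ l, z l s))
          + ((∫ s in (0 : ℝ)..t, B.slowL1 A ϱ s (∑ l, z l s))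
            - ∑ l, ∫ s in (0 : ℝ)..t, B.slowL1 A ϱ s (z l s))
          + ((∑ l, ∫ s in (0 : ℝ)..t, B.slowL1 A ϱ s (z l s))
            - ∑ l, ∫ s in (0 : ℝ)..t, B.slowL1 A ϱ s (w l s)) := by abel
    rw [e6]
    refine norm_add₃_le.trans ((add_le_add (add_le_add b4 b3) b5).trans_eq ?_)
    ring

end Superposition

/-! ### Consequences of universal resonance invariance for each pair of the spectrum. -/

section Spectrum

variable {d J N : ℕ} {A : LinearPart d J} {B : Nonlinearity d J}

lemma sgn_smul_sgn_smul (ζ : ℤˣ) (x : Wave d) : sgn ζ • sgn ζ • x = x := by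
  rw [smul_smul, sgn_mul_self, one_smul]

lemma sgn_smul_notMem {x : Wave d} (h : x ∉ A.bandCrossing ∧ -x ∉ A.bandCrossing) (ζ : ℤˣ) :
    sgn ζ • x ∉ A.bandCrossing := by
  rcases Int.units_eq_one_or ζ with rfl | rfl
  · simpa [sgn] using h.1
  · simpa [sgn] using h.2

lemma om_eq_sgn_mul (hA : A.Admissible) (n : Fin J) (ζ : ℤˣ) {k : Wave d}
    (hk : k ∉ A.bandCrossing) : A.om (n, ζ) k = sgn ζ * A.freq n 1 (sgn ζ • k) := by
  rcases Int.units_eq_one_or ζ with rfl | rfl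
  · simp [sgn, LinearPart.om]
  · have h := hA.symm n (-1) k hk
    rw [neg_neg] at h
    simp [sgn, LinearPart.om, h]

lemma sgn_smul_kappa (S : Fin N → Fin J × Wave d) {m : ℕ} (lam : Fin m → ℤˣ × Fin N) (ζ : ℤˣ) :
    sgn ζ • kappa S lam = kappa S fun j => (ζ * (lam j).1, (lam j).2) := by
  rw [kappa, kappa, Finset.smul_sum]
  exact Finset.sum_congr rfl fun j _ => by rw [sgn_mul, mul_smul]

/-- In a universally resonance invariant spectrum, every wave has a closed dynamics. -/
lemma isClosedPair_of_universallyResonanceInvariant (hA : A.Admissible)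
    {S : Fin N → Fin J × Wave d}
    (hk : ∀ l, (S l).2 ∉ A.bandCrossing ∧ -(S l).2 ∉ A.bandCrossing)
    (hout : outputKSpectrum B S ∩ A.bandCrossing = ∅) (hS : UniversallyResonanceInvariant A B S)
    (l : Fin N) : IsClosedPair A B (S l).1 (S l).2 := by
  have hnot : ∀ m ∈ B.degrees, ∀ lam : Fin m → ℤˣ × Fin N, kappa S lam ∉ A.bandCrossing :=
    fun m hm lam h => (eq_empty_iff_forall_notMem.1 hout) _ ⟨⟨m, hm, lam, rfl⟩, h⟩
  refine ⟨sgn_smul_notMem (hk l), fun m hm σ => hnot m hm fun j => (σ j, l), ?_⟩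
  rintro m hm σ ⟨n', ζ'⟩ h0
  set lam : Fin m → ℤˣ × Fin N := fun j => (σ j, l) with hlam
  have hsum : ∑ j, sgn (σ j) • (S l).2 = kappa S lam := rfl
  have hp : (⟨m, ζ', n', lam⟩ : ResIndex J N) ∈ resSolutions A B S := by
    refine ⟨hm, ?_⟩
    rw [mismatch, hsum, om_eq_sgn_mul hA n' ζ' (hnot m hm lam)] at h0
    simp_rw [om_eq_sgn_mul hA (S l).1 _ (sgn_smul_notMem (hk l) _), sgn_smul_sgn_smul] at h0
    simp only [ResIndex.out, hlam] at h0 ⊢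
    linarith
  have hmem : (n', sgn ζ' • kappa S lam) ∈ range S := by
    rw [← hS.1]
    -- The output spectrum is symmetric under multiplication of all signs by `ζ'`, so the resonant
    -- output is selected and lies in `S`; the solution is therefore internal, hence universal.
    refine Or.inr ⟨⟨m, hm, fun j => (ζ' * (lam j).1, (lam j).2), sgn_smul_kappa S lam ζ'⟩,
      ⟨m, ζ', n', lam⟩, hp, rfl⟩
  have hint : (⟨m, ζ', n', lam⟩ : ResIndex J N) ∈ resUniversal A B S := by
    rw [hS.2]
    exact ⟨hp, hmem⟩
  obtain ⟨-, I₀, h1, -, h3, h4⟩ := hint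
  -- The string uses the index `l` only, so a nonzero `δ` can occur at no other index.
  have hI : l = I₀ := by
    by_contra hne
    have : delta lam I₀ = 0 := Finset.sum_eq_zero fun j _ => if_neg hne
    simp only at h1
    rcases h1 with h1 | h1 <;> omega
  subst hI
  refine ⟨h3, ?_⟩
  simp only [delta, hlam, if_true] at h4
  exact h4.symm

/-- In `ω_{n,-}(x) = -ω_{n,+}(-x)` the two minus signs cancel on differentiation: both components of
a wave travel with the same velocity. -/
lemma gradient_om_sgn (hA : A.Admissible) (n : Fin J) {k : Wave d} (hk : k ∉ A.bandCrossing)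
    (ζ : ℤˣ) : gradient (A.om (n, ζ)) (sgn ζ • k) = gradient (A.freq n 1) k := by
  rcases Int.units_eq_one_or ζ with rfl | rfl
  · simp only [sgn, Units.val_one, Int.cast_one, one_smul]
    rfl
  · have e : sgn (-1) • k = -k := by simp [sgn]
    have h1 : A.om (n, -1) =ᶠ[nhds (-k)] fun x => -A.freq n 1 (-x) := by
      have ho : IsOpen ((fun x : Wave d => -x) ⁻¹' A.bandCrossingᶜ) :=
        hA.isClosed.isOpen_compl.preimage continuous_neg
      have hk' : -k ∈ (fun x : Wave d => -x) ⁻¹' A.bandCrossingᶜ := by simpa using hk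
      filter_upwards [ho.mem_nhds hk'] with x hx
      have := hA.symm n 1 (-x) hx
      rwa [neg_neg] at this
    have h2 : fderiv ℝ (fun x => A.freq n 1 (-x)) (-k) = -fderiv ℝ (A.freq n 1) k := by
      have := fderiv_comp_smul (f := A.freq n 1) (x := -k) (-1 : ℝ)
      simpa only [neg_smul, one_smul, neg_neg] using this
    rw [e, gradient, gradient, h1.fderiv_eq, fderiv_fun_neg, h2, neg_neg]

end Spectrum

/-! ### Concentration, polarization and position of wavepackets. -/

section Wavepacket

variable {d J : ℕ} {A : LinearPart d J}

lemma ae_of_localized {Ψ : Wave d → ℝ} (hΨ : IsCutoff Ψ) {δ : ℝ} (hδ : 0 < δ) {n : Fin J}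
    {ζ : ℤˣ} {c : Wave d} {f : L1 d J}
    (h : ∀ᵐ k, f k = cutoffAt Ψ δ c k • A.proj n ζ k (f k)) :
    ∀ᵐ k, A.projL (n, ζ) k (f k) = f k ∧ (δ ≤ ‖k - c‖ → f k = 0) := by
  filter_upwards [h] with k hk
  have hP : A.proj n ζ k (f k) = A.projL (n, ζ) k (f k) := (A.projL_apply (n, ζ) k (f k)).symm
  rw [hP] at hk
  constructor
  · rw [hk, ContinuousLinearMap.map_smul_of_tower, A.projL_projL, if_pos rfl, ← hk]
  · intro hle
    rw [hk, cutoffAt, hΨ.eq_zero, zero_smul]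
    rw [norm_smul, norm_inv, Real.norm_eq_abs, abs_of_pos hδ, inv_mul_eq_div, one_le_div hδ]
    exact hle

lemma waveComp_eq_self (hA : A.Admissible) {n : Fin J} {kstar : Wave d} {ζ : ℤˣ} {δ : ℝ}
    (hδ : δ ≤ sepRadius kstar) {f : L1 d J}
    (h : ∀ᵐ k, A.projL (n, ζ) k (f k) = f k ∧ (δ ≤ ‖k - sgn ζ • kstar‖ → f k = 0)) :
    waveComp A n kstar ζ f = f := by
  refine L1_ext ?_
  filter_upwards [mulOp_coeFn (isBandMult_inMult hA n kstar ζ).isMult f, h] with k h1 h2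
  rw [waveComp, h1, inMult]
  by_cases hk : k ∈ waveBall kstar ζ
  · rw [indicator_of_mem hk, h2.1]
  · have : f k = 0 := h2.2 (by
      rw [waveBall, mem_ball_iff_norm, not_lt] at hk
      exact hδ.trans hk)
    rw [this, map_zero]

lemma wmom_harmonicWeight_le {n : Fin J} {kstar : Wave d} {ζ : ℤˣ} {δ : ℝ} {f : L1 d J}
    (h : ∀ᵐ k, A.projL (n, ζ) k (f k) = f k ∧ (δ ≤ ‖k - sgn ζ • kstar‖ → f k = 0)) :
    wmom (harmonicWeight kstar) f ≤ δ * ‖f‖ := by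
  rw [L1.norm_eq_integral_norm, ← integral_const_mul]
  refine integral_mono_ae ((isWeight_harmonicWeight kstar).integrable f)
    ((L1.integrable_coeFn f).norm.const_mul δ) ?_
  filter_upwards [h] with k hk
  rcases lt_or_ge ‖k - sgn ζ • kstar‖ δ with hlt | hge
  · exact mul_le_mul_of_nonneg_right ((harmonicWeight_le ζ kstar k).trans hlt.le) (norm_nonneg _)
  · rw [hk.2 hge]; simp

lemma IsWeight.wmom_sum_le {w : Wave d → ℝ} (hw : IsWeight w) {ι : Type*} (s : Finset ι)
    (f : ι → L1 d J) : wmom w (∑ i ∈ s, f i) ≤ ∑ i ∈ s, wmom w (f i) := by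
  simp_rw [hw.wmom_eq, map_sum]
  exact norm_sum_le _ _

/-- Shifts of a function whose modulation has an integrable weak gradient. -/
lemma norm_mtrans_sub_le {r : Wave d} {f : L1 d J} {G : Wave d → Wave d →L[ℝ] Val J}
    (h : HasWeakGradient
      (fun k => Complex.exp (Complex.I * ((inner ℝ r k : ℝ) : ℂ)) • f k) G)
    (hG : Integrable G volume) (y : Wave d) : ‖mtrans r y f - f‖ ≤ ‖y‖ * ∫ k, ‖G k‖ := by
  have hn : ∀ x : ℝ, ‖Complex.exp (Complex.I * (x : ℂ))‖ = 1 := fun x => by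
    rw [mul_comm, Complex.norm_exp_ofReal_mul_I]
  have hf : Integrable (fun k => Complex.exp (Complex.I * ((inner ℝ r k : ℝ) : ℂ)) • f k)
      volume := by
    refine (L1.integrable_coeFn f).bdd_smul
      (φ := fun k => Complex.exp (Complex.I * ((inner ℝ r k : ℝ) : ℂ))) 1 ?_ ?_
    · exact (by fun_prop : Continuous fun k : Wave d =>
        Complex.exp (Complex.I * ((inner ℝ r k : ℝ) : ℂ))).aestronglyMeasurable
    · exact Filter.Eventually.of_forall fun k => (hn _).le
  refine le_trans (le_of_eq ?_) (h.integral_norm_sub_le hf hG y)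
  rw [L1.norm_eq_integral_norm]
  refine integral_congr_ae ?_
  filter_upwards [Lp.coeFn_sub (mtrans r y f) f, translate_coeFn y f,
    Lp.coeFn_smul (Complex.exp (((inner ℝ r y : ℝ) : ℂ) * Complex.I)) (translate y f)]
    with k h1 h2 h3
  have h4 : (mtrans r y f : L1 d J) k
      = Complex.exp (((inner ℝ r y : ℝ) : ℂ) * Complex.I) • f (k + y) := by
    rw [mtrans_apply, h3, Pi.smul_apply, h2]
  rw [h1, Pi.sub_apply, h4]
  have e : ∀ a b : Val J, Complex.exp (Complex.I * ((inner ℝ r (k + y) : ℝ) : ℂ)) • a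
      - Complex.exp (Complex.I * ((inner ℝ r k : ℝ) : ℂ)) • b
      = Complex.exp (Complex.I * ((inner ℝ r k : ℝ) : ℂ))
        • (Complex.exp (((inner ℝ r y : ℝ) : ℂ) * Complex.I) • a - b) := fun a b => by
    rw [smul_sub, smul_smul, ← Complex.exp_add, inner_add_right]
    congr 3
    push_cast; ring
  rw [e, norm_smul, hn, one_mul]

end Wavepacket

/-! ### Relations between `β`, `ϱ` and `ε`. -/

section Parameters

variable {β ϱ ε C₀ : ℝ}

lemma one_le_rpow_neg (hβ : 0 < β) (hβ1 : β ≤ 1) (hε : 0 < ε) : 1 ≤ β ^ (-1 - ε) :=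
  Real.one_le_rpow_of_pos_of_le_one_of_nonpos hβ hβ1 (by linarith)

lemma div_rpow_eq (hβ : 0 < β) : ϱ / β ^ (1 + ε) = ϱ * β ^ (-1 - ε) := by
  rw [div_eq_mul_inv, ← Real.rpow_neg hβ.le]
  congr 2; ring

/-- `β^{1-ε} = β² β^{-1-ε}`: the width of the packets is dominated by the main error term. -/
lemma rpow_one_sub_le (hβ : 0 < β) (hϱ : β ^ 2 ≤ C₀ * ϱ) :
    β ^ (1 - ε) ≤ C₀ * (ϱ * β ^ (-1 - ε)) := by
  have h : β ^ (1 - ε) = β ^ 2 * β ^ (-1 - ε) := by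
    rw [← Real.rpow_natCast β 2, ← Real.rpow_add hβ]
    congr 1; push_cast; ring
  rw [h, ← mul_assoc]
  exact mul_le_mul_of_nonneg_right hϱ (Real.rpow_nonneg hβ.le _)

/-- Provides the condition under which the quadratic phase error of a shift is bounded by the square
of its gradient error. -/
lemma one_le_mul_rpow_sq (hβ : 0 < β) (hβ1 : β ≤ 1) (hε : 0 < ε) (hϱ : β ^ 2 ≤ C₀ * ϱ) :
    1 ≤ C₀ * ((β ^ (-1 - ε)) ^ 2 * ϱ) := by
  have h1 : β⁻¹ ≤ β ^ (-1 - ε) := by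
    rw [← Real.rpow_neg_one]
    exact Real.rpow_le_rpow_of_exponent_ge hβ hβ1 (by linarith)
  have h2 : 1 ≤ β ^ (-1 - ε) * β := by
    calc (1 : ℝ) = β⁻¹ * β := by field_simp
      _ ≤ _ := by gcongr
  calc (1 : ℝ) ≤ (β ^ (-1 - ε) * β) ^ 2 := one_le_pow₀ h2
    _ = (β ^ (-1 - ε)) ^ 2 * β ^ 2 := by ring
    _ ≤ (β ^ (-1 - ε)) ^ 2 * (C₀ * ϱ) := by gcongr
    _ = _ := by ring

lemma log_two_le_abs_log (hβ : 0 < β) (hβ2 : β ≤ 1 / 2) : Real.log 2 ≤ |Real.log β| := by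
  have h := Real.log_le_log hβ hβ2
  rw [one_div, Real.log_inv] at h
  exact (by linarith : Real.log 2 ≤ -Real.log β).trans (neg_le_abs _)

/-- The main term is bounded below by a multiple of `β`, so the logarithm of its inverse is at most
`|ln β|` plus a constant. -/
lemma log_one_add_le (hβ : 0 < β) (hβ1 : β ≤ 1) (hε : 0 < ε) (hϱ0 : 0 < ϱ) (hC₀ : 0 ≤ C₀)
    (hϱ : β ^ 2 ≤ C₀ * ϱ) {τs : ℝ} (hτs : 0 ≤ τs) :
    Real.log (1 + τs / (ϱ * β ^ (-1 - ε))) ≤ Real.log (1 + τs * C₀) + |Real.log β| := by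
  set α := ϱ * β ^ (-1 - ε) with hα
  have hα0 : 0 < α := by have := Real.rpow_pos_of_pos hβ (-1 - ε); positivity
  have h1 : β ≤ C₀ * α := by
    refine le_trans ?_ (rpow_one_sub_le (ε := ε) hβ hϱ)
    conv_lhs => rw [← Real.rpow_one β]
    exact Real.rpow_le_rpow_of_exponent_ge hβ hβ1 (by linarith)
  have h2 : 1 + τs / α ≤ (1 + τs * C₀) * β⁻¹ := by
    have h3 : τs / α ≤ τs * C₀ * β⁻¹ := by
      rw [div_le_iff₀ hα0]
      calc τs = τs * β * β⁻¹ := by field_simp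
        _ ≤ τs * (C₀ * α) * β⁻¹ := by gcongr
        _ = _ := by ring
    have h4 : 1 ≤ β⁻¹ := (one_le_inv₀ hβ).2 hβ1
    rw [add_mul, one_mul]
    linarith
  have h5 : 0 < 1 + τs * C₀ := by positivity
  calc Real.log (1 + τs / α) ≤ Real.log ((1 + τs * C₀) * β⁻¹) := by
        refine Real.log_le_log ?_ h2
        positivity
    _ = Real.log (1 + τs * C₀) + -Real.log β := by
        rw [Real.log_mul h5.ne' (inv_ne_zero hβ.ne'), Real.log_inv]
    _ ≤ _ := by gcongr; exact neg_le_abs _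

lemma eventually_mul_rpow_le {s e : ℝ} (hs : 0 < s) (C : ℝ) (he : 0 < e) :
    ∀ᶠ β in nhdsWithin (0 : ℝ) (Ioi 0), C * β ^ s ≤ e := by
  have h : Filter.Tendsto (fun β : ℝ => C * β ^ s) (nhds 0) (nhds 0) := by
    have := ((Real.continuousAt_rpow_const 0 s (Or.inr hs.le)).const_mul C).tendsto
    simpa [Real.zero_rpow hs.ne'] using this
  exact nhdsWithin_le_nhds (h.eventually (ge_mem_nhds he))

end Parameters

/-! ### From a particle-like wavepacket to a wave family. -/

section Single

variable {d J : ℕ} {A : LinearPart d J} {B : Nonlinearity d J} {Cχ R τs : ℝ}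

/-- The solution generated by a particle-like wavepacket is, up to a small error, a wave family
whose modulations are nearly translation invariant. -/
theorem exists_wavepacket_estimate (hA : A.Admissible) (hB : B.Admissible A Cχ) (hR : 0 < R)
    (hτs : 0 < τs) (hτs' : τs * lipConst B Cχ R < 1) {n : Fin J} {kstar : Wave d}
    (hC : IsClosedPair A B n kstar) {V : Wave d}
    (hV : ∀ ζ, gradient (A.om (n, ζ)) (sgn ζ • kstar) = V) {Ψ : Wave d → ℝ} (hΨ : IsCutoff Ψ)
    {ε s β₀ C₀ : ℝ} (hε : 0 < ε) (hε1 : ε < 1) (hs : 0 < s) (hC₀ : 0 ≤ C₀)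
    {h : ℝ → Wave d → L1 d J} (hh : IsParticleWavepacket A Ψ ε s β₀ n kstar h) :
    ∃ K, 0 ≤ K ∧ ∀ᶠ β in nhdsWithin (0 : ℝ) (Ioi 0), ∀ ϱ : ℝ, β < β₀ → β ≤ 1 → 0 < ϱ → ϱ ≤ 1 →
      β ^ 2 ≤ C₀ * ϱ → ∀ r : Wave d, ‖h β r‖ ≤ R / 2 → ∃ v : ℤˣ → ℝ → L1 d J,
        IsWaveFamily A τs (2 * R) (bnd B Cχ (2 * R)) (K * β ^ (1 - ε)) (fun ζ : ℤˣ => (n, ζ))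
          (fun ζ => sgn ζ • kstar) v ∧
        (∀ ζ, ∀ t ∈ Icc 0 τs, ∀ q y, 0 ≤ q → ‖y‖ ≤ q → ‖mtrans r y (v ζ t) - v ζ t‖
          ≤ K * (q * β ^ (-1 - ε) + ϱ + (q / ϱ + 1) * (K * β ^ (1 - ε)) + q ^ 2 / ϱ)) ∧
        ∀ w, IsSolution A B ϱ τs R (h β r) w → ∀ t ∈ Icc 0 τs,
          ‖w t - ∑ ζ, v ζ t‖ ≤ K * (ϱ * β ^ (-1 - ε) + β ^ s) := by
  obtain ⟨C, C', C₁, hc, hh⟩ := hh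
  obtain ⟨K₁, hK₁, hest⟩ := exists_wave_estimate hA hB hC hR hτs.le
  obtain ⟨K₂, hK₂, hshift⟩ := exists_wave_shift_estimate hA hB hC hV hR hτs.le
  set E := Real.exp (lip B Cχ (2 * R) * τs) with hE
  have hE0 : 0 < E := Real.exp_pos _
  refine ⟨1 + R * E + R + K₂ * (1 + |C₁|) + |C'| * E + K₁ * (1 + R * C₀), by positivity, ?_⟩
  set K := 1 + R * E + R + K₂ * (1 + |C₁|) + |C'| * E + K₁ * (1 + R * C₀) with hK
  have p1 : 0 ≤ R * E := by positivity
  have p2 : 0 ≤ K₂ * (1 + |C₁|) := by positivity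
  have p3 : 0 ≤ |C'| * E := by positivity
  have p4 : 0 ≤ K₁ * (1 + R * C₀) := by positivity
  filter_upwards [eventually_mul_rpow_le (sub_pos.2 hε1) (1 / 2) (sepRadius_pos kstar),
    eventually_mul_rpow_le hs C' (half_pos hR), self_mem_nhdsWithin]
    with β hβ2 hβ3 hβ ϱ hβ₀ hβ1 hϱ hϱ1 hβϱ r hr
  rw [mem_Ioi] at hβ
  obtain ⟨hw, hgrad⟩ := hh β hβ hβ₀ r
  set f := hc β r with hf
  set δ := β ^ (1 - ε) / 2 with hδ
  set b := β ^ (-1 - ε) with hb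
  have hβε : 0 < β ^ (1 - ε) := Real.rpow_pos_of_pos hβ _
  have hβs : 0 < β ^ s := Real.rpow_pos_of_pos hβ _
  have hb1 : 1 ≤ b := one_le_rpow_neg hβ hβ1 hε
  have hδ0 : 0 < δ := by positivity
  have hloc := fun ζ => ae_of_localized hΨ hδ0 (hw.localized ζ)
  have hself : ∀ ζ, waveComp A n kstar ζ (f ζ) = f ζ := fun ζ =>
    waveComp_eq_self hA (by rw [hδ]; linarith) (hloc ζ)
  set g := ∑ ζ, f ζ with hg
  have hg2 : g = f 1 + f (-1) := by
    rw [hg, show (Finset.univ : Finset ℤˣ) = {1, -1} from rfl,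
      Finset.sum_pair (by decide)]
  have hrem : ‖h β r - g‖ ≤ C' * β ^ s := by rw [hg2]; exact hw.remainder
  -- The exactly localized datum `g` may exceed `h` by the remainder; the margin between `R/2` and
  -- `R` absorbs it for small `β`.
  have hgR : ‖g‖ ≤ R := by
    have h1 : ‖g‖ ≤ ‖h β r‖ + ‖h β r - g‖ := by
      have := norm_sub_le (h β r) (h β r - g)
      rwa [sub_sub_cancel] at this
    linarith
  -- No bound on the pieces is part of the definition of a wavepacket. Each piece is a component of
  -- `g`, which bounds it.
  have hfR : ∀ ζ, ‖f ζ‖ ≤ R := fun ζ => by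
    have h1 : waveComp A n kstar ζ g = f ζ := by
      rw [hg, map_sum, Finset.sum_eq_single ζ, hself]
      · intro ζ' _ hne
        rw [← hself ζ', waveComp_waveComp hA, if_neg hne.symm]
      · exact fun h => absurd (Finset.mem_univ ζ) h
    rw [← h1]
    exact (norm_mulOp_apply_le _ _).trans hgR
  set μ := R * β ^ (1 - ε) with hμ
  have hwm : wmom (harmonicWeight kstar) g ≤ μ := by
    refine ((isWeight_harmonicWeight kstar).wmom_sum_le _ _).trans ?_
    calc ∑ ζ, wmom (harmonicWeight kstar) (f ζ) ≤ ∑ _ζ : ℤˣ, δ * R :=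
          Finset.sum_le_sum fun ζ _ => (wmom_harmonicWeight_le (hloc ζ)).trans
            (mul_le_mul_of_nonneg_left (hfR ζ) hδ0.le)
      _ = μ := by
        rw [Finset.sum_const, Finset.card_univ, Fintype.card_units_int, hδ, hμ]
        simp; ring
  -- The waves are the components of the solution with datum `g`, not `h`. Continuous dependence on
  -- the data later charges the difference to `β^s`.
  set w' := solutionOperator A B ϱ τs R g with hw'
  have hsol : IsSolution A B ϱ τs R g w' := isSolution_solutionOperator hA hB hR hτs hτs' ϱ hgR
  refine ⟨fun ζ t => waveComp A n kstar ζ (w' t), ?_, ?_, ?_⟩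
  · refine (hsol.isWaveFamily hA hB hR n kstar).mono ?_
    calc wmom (harmonicWeight kstar) g * E ≤ μ * E := by gcongr
      _ = R * E * β ^ (1 - ε) := by rw [hμ]; ring
      _ ≤ K * β ^ (1 - ε) := by gcongr; linarith
  · intro ζ t ht q y hq hy
    have hD : ∀ ζ e, ‖mtrans r (sgn e • y) (f ζ) - f ζ‖ ≤ q * (|C₁| * b) := fun ζ e => by
      obtain ⟨G, hG, hGi, hGb⟩ := hgrad ζ
      refine (norm_mtrans_sub_le hG hGi _).trans ?_
      rw [norm_sgn_smul]
      refine mul_le_mul hy (hGb.trans ?_) (integral_nonneg fun _ => norm_nonneg _) hq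
      exact mul_le_mul_of_nonneg_right (le_abs_self _) (zero_le_one.trans hb1)
    have h1 := hshift ϱ μ g f w' hϱ hϱ1 hsol hg hself hwm q _ r y hq hy hD t ht ζ 1
    have e1 : sgn 1 • y = y := by simp [sgn]
    rw [e1] at h1
    refine h1.trans ?_
    have h2 : (q / ϱ + 1) * μ ≤ (q / ϱ + 1) * (K * β ^ (1 - ε)) := by
      rw [hμ]; gcongr; linarith
    set X := (q / ϱ + 1) * (K * β ^ (1 - ε)) with hX
    have hX0 : 0 ≤ X := by
      have : 0 ≤ (q / ϱ + 1) * μ := by positivity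
      linarith
    have hY0 : 0 ≤ q ^ 2 / ϱ := by positivity
    have hqb : 0 ≤ q * b := by positivity
    calc K₂ * (q * (|C₁| * b) + ϱ + (q / ϱ + 1) * μ + q ^ 2 / ϱ)
        ≤ K₂ * ((1 + |C₁|) * (q * b + ϱ + X + q ^ 2 / ϱ)) := by
          refine mul_le_mul_of_nonneg_left ?_ hK₂
          have h3 : 0 ≤ |C₁| * (ϱ + X + q ^ 2 / ϱ) := by positivity
          have h4 : (1 + |C₁|) * (q * b + ϱ + X + q ^ 2 / ϱ) = q * b + q * (|C₁| * b) + ϱ + X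
            + q ^ 2 / ϱ + |C₁| * (ϱ + X + q ^ 2 / ϱ) := by ring
          linarith
      _ = K₂ * (1 + |C₁|) * (q * b + ϱ + X + q ^ 2 / ϱ) := by ring
      _ ≤ K * (q * b + ϱ + X + q ^ 2 / ϱ) := by
          refine mul_le_mul_of_nonneg_right (by linarith) (by positivity)
  · intro w hw t ht
    have h1 := hw.norm_sub_le hA hB hR hsol t ht
    have h2 := (hest ϱ μ g f w' hϱ hsol hg hself hwm t ht).1
    have h3 : ‖h β r - g‖ * E ≤ |C'| * E * β ^ s := by
      calc ‖h β r - g‖ * E ≤ (|C'| * β ^ s) * E := by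
            gcongr
            exact hrem.trans (mul_le_mul_of_nonneg_right (le_abs_self _) hβs.le)
        _ = _ := by ring
    have h4 : K₁ * (ϱ + μ) ≤ K₁ * (1 + R * C₀) * (ϱ * b) := by
      have h5 : ϱ ≤ ϱ * b := le_mul_of_one_le_right hϱ.le hb1
      have h6 : μ ≤ R * (C₀ * (ϱ * b)) :=
        mul_le_mul_of_nonneg_left (rpow_one_sub_le hβ hβϱ) hR.le
      calc K₁ * (ϱ + μ) ≤ K₁ * (ϱ * b + R * (C₀ * (ϱ * b))) := by gcongr
        _ = _ := by ring
    have h7 : K₁ * (1 + R * C₀) * (ϱ * b) ≤ K * (ϱ * b) :=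
      mul_le_mul_of_nonneg_right (by linarith) (by positivity)
    have h8 : |C'| * E * β ^ s ≤ K * β ^ s := mul_le_mul_of_nonneg_right (by linarith) hβs.le
    have h9 := norm_sub_le_norm_sub_add_norm_sub (w t) (w' t)
      (∑ ζ, waveComp A n kstar ζ (w' t))
    rw [mul_add]
    linarith

end Single

/-! ### The superposition principle for particle-like wavepackets. -/

section Superposition

variable {d J N : ℕ} {A : LinearPart d J} {B : Nonlinearity d J} {Cχ R τs : ℝ}

lemma norm_sum_le_of_forall_card_mul_le {E : Type*} [SeminormedAddCommGroup E] (hR : 0 ≤ R)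
    {h : Fin N → E} (hh : ∀ l, N * ‖h l‖ ≤ R) : ‖∑ l, h l‖ ≤ R := by
  rcases Nat.eq_zero_or_pos N with rfl | hN
  · simpa using hR
  have hN' : (0 : ℝ) < N := Nat.cast_pos.2 hN
  refine (norm_sum_le _ _).trans (le_of_mul_le_mul_left ?_ hN')
  rw [Finset.mul_sum]
  refine (Finset.sum_le_sum fun l _ => hh l).trans_eq ?_
  rw [Finset.sum_const, Finset.card_univ, Fintype.card_fin, nsmul_eq_mul]

lemma norm_le_of_card_mul_le {E : Type*} [SeminormedAddCommGroup E] (l : Fin N) {x : E}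
    (hx : N * ‖x‖ ≤ R) : ‖x‖ ≤ R := by
  have hN : (1 : ℝ) ≤ N := by exact_mod_cast (Nat.zero_le _).trans_lt l.2
  exact (le_mul_of_one_le_left (norm_nonneg _) hN).trans hx

/-- The superposition principle for all small `β`. -/
theorem eventually_superposition_estimate (hA : A.Admissible) (hB : B.Admissible A Cχ)
    (hR : 0 < R) (hτs : 0 < τs) (hτs' : τs * lipConst B Cχ R < 1) {S : Fin N → Fin J × Wave d}
    (hk : ∀ l, (S l).2 ∉ A.bandCrossing ∧ -(S l).2 ∉ A.bandCrossing)
    (hout : outputKSpectrum B S ∩ A.bandCrossing = ∅) (hS : UniversallyResonanceInvariant A B S)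
    (hv : ∀ l₁ l₂, l₁ ≠ l₂ →
      gradient (A.freq (S l₁).1 1) (S l₁).2 ≠ gradient (A.freq (S l₂).1 1) (S l₂).2)
    {Ψ : Wave d → ℝ} (hΨ : IsCutoff Ψ) {ε s β₀ C₀ : ℝ} (hε : 0 < ε) (hε1 : ε < 1) (hs : 0 < s)
    (hC₀ : 0 ≤ C₀) {h : Fin N → ℝ → Wave d → L1 d J}
    (hh : ∀ l, IsParticleWavepacket A Ψ ε s β₀ (S l).1 (S l).2 (h l))
    (hhR : ∀ l β, 0 < β → β < β₀ → ∀ r : Wave d, N * ‖h l β r‖ ≤ R) (hN : N ≠ 1) :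
    ∃ K, 0 ≤ K ∧ ∀ᶠ β in nhdsWithin (0 : ℝ) (Ioi 0), ∀ ϱ : ℝ, β < β₀ → β ≤ 1 / 2 → 0 < ϱ →
      ϱ ≤ 1 → β ^ 2 ≤ C₀ * ϱ → ∀ r : Fin N → Wave d, ∀ τ ∈ Icc 0 τs,
        ‖solutionOperator A B ϱ τs R (∑ l, h l β (r l)) τ
            - ∑ l, solutionOperator A B ϱ τs R (h l β (r l)) τ‖
          ≤ K * (ϱ * β ^ (-1 - ε) * |Real.log β| + β ^ s) := by
  choose k hk0 hev using fun l => exists_wavepacket_estimate hA hB hR hτs hτs'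
    (isClosedPair_of_universallyResonanceInvariant hA hk hout hS l)
    (gradient_om_sgn hA (S l).1 (hk l).1) hΨ hε hε1 hs hC₀ (hh l)
  set κ := ∑ l, k l with hκ
  have hκ0 : 0 ≤ κ := Finset.sum_nonneg fun l _ => hk0 l
  have hkκ : ∀ l, k l ≤ κ := fun l => Finset.single_le_sum (f := k) (fun l _ => hk0 l)
    (Finset.mem_univ l)
  obtain ⟨K, hK, hsup⟩ := exists_superposition_estimate hA hB S (fun l => sgn_smul_notMem (hk l))
    (fun m hm lam hmem => (eq_empty_iff_forall_notMem.1 hout) _ ⟨⟨m, hm, lam, rfl⟩, hmem⟩)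
    (fun l => gradient_om_sgn hA (S l).1 (hk l).1)
    (fun l₁ l₂ heq => by_contra fun hne => hv l₁ l₂ hne heq) hR hτs.le
    (show 0 ≤ κ + κ * C₀ + C₀ by positivity)
  set c := Real.log (1 + τs * C₀) with hc
  have hc0 : 0 ≤ c := Real.log_nonneg (by have := mul_nonneg hτs.le hC₀; linarith)
  have hl2 : 0 < Real.log 2 := Real.log_pos (by norm_num)
  refine ⟨K * ((1 + c + κ) / Real.log 2 + 1 + κ), by positivity, ?_⟩
  filter_upwards [Filter.eventually_all.2 hev, self_mem_nhdsWithin]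
    with β hβe hβ ϱ hβ₀ hβ2 hϱ hϱ1 hβϱ r τ hτ
  rw [mem_Ioi] at hβ
  have hβ1 : β ≤ 1 := by linarith
  -- An index `l` exists and `N ≠ 1`, so `N ≥ 2`; this yields the margin required for the localized
  -- data.
  have hN2 : ∀ l, ‖h l β (r l)‖ ≤ R / 2 := fun l => by
    have h2 : (2 : ℝ) ≤ N := by exact_mod_cast (by have := l.2; omega : 2 ≤ N)
    have h3 := hhR l β hβ hβ₀ (r l)
    have h4 := mul_le_mul_of_nonneg_right h2 (norm_nonneg (h l β (r l)))
    linarith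
  choose v hvf hvs hvw using fun l => hβe l ϱ hβ₀ hβ1 hϱ hϱ1 hβϱ (r l) (hN2 l)
  have hβε : 0 < β ^ (1 - ε) := Real.rpow_pos_of_pos hβ _
  have hβs : 0 < β ^ s := Real.rpow_pos_of_pos hβ _
  have hb1 : 1 ≤ β ^ (-1 - ε) := one_le_rpow_neg hβ hβ1 hε
  set b := β ^ (-1 - ε) with hb
  set α := ϱ * b with hα
  have hα0 : 0 < α := by positivity
  set μ := κ * β ^ (1 - ε) with hμ
  have hkμ : ∀ l, k l * β ^ (1 - ε) ≤ μ := fun l => by rw [hμ]; gcongr; exact hkκ l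
  have hw : ∀ l, IsSolution A B ϱ τs R (h l β (r l))
      (solutionOperator A B ϱ τs R (h l β (r l))) := fun l =>
    isSolution_solutionOperator hA hB hR hτs hτs' ϱ (by linarith [hN2 l])
  have hu := isSolution_solutionOperator hA hB hR hτs hτs' ϱ
    (norm_sum_le_of_forall_card_mul_le hR.le fun l => hhR l β hβ hβ₀ (r l))
  have hμα : μ ≤ κ * C₀ * α := by
    rw [hμ, mul_assoc]
    exact mul_le_mul_of_nonneg_left (rpow_one_sub_le hβ hβϱ) hκ0
  have key := hsup ϱ b μ (κ * (α + β ^ s)) r (fun l => h l β (r l)) _ _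
    (fun p => v p.2 p.1) hϱ hϱ1 hb1 (by positivity) (by positivity)
    (hμα.trans (mul_le_mul_of_nonneg_right (by linarith) hα0.le))
    ((one_le_mul_rpow_sq hβ hβ1 hε hβϱ).trans
      (mul_le_mul_of_nonneg_right (by have := mul_nonneg hκ0 hC₀; linarith) (by positivity)))
    hu hw ⟨fun p => (hvf p.2).norm_le p.1, fun p => (hvf p.2).lipschitz p.1,
      fun p t ht => ((hvf p.2).wmom_le p.1 t ht).trans (hkμ p.2),
      fun p => (hvf p.2).polarized p.1⟩ ?_ ?_ τ hτ
  · refine key.trans ?_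
    have h1 : Real.log (1 + τs / α) ≤ c + |Real.log β| :=
      log_one_add_le hβ hβ1 hε hϱ hC₀ hβϱ hτs.le
    -- `β ≤ 1/2` keeps `|ln β|` away from zero, so terms without logarithm are absorbed.
    have h2 : 1 ≤ |Real.log β| / Real.log 2 :=
      (one_le_div hl2).2 (log_two_le_abs_log hβ hβ2)
    have h3 : α * (1 + Real.log (1 + τs / α)) + κ * (α + β ^ s)
        ≤ ((1 + c + κ) / Real.log 2 + 1 + κ) * (α * |Real.log β| + β ^ s) := by
      have h4 : α * (1 + Real.log (1 + τs / α)) ≤ α * (1 + (c + |Real.log β|)) := by gcongr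
      have h5 : (1 + c + κ) * α ≤ (1 + c + κ) * α * (|Real.log β| / Real.log 2) :=
        le_mul_of_one_le_right (by positivity) h2
      have h6 : (1 + c + κ) * α * (|Real.log β| / Real.log 2)
          = (1 + c + κ) / Real.log 2 * (α * |Real.log β|) := by ring
      have h7 : 0 ≤ (1 + c + κ) / Real.log 2 * β ^ s := by positivity
      have h8 : 0 ≤ κ * (α * |Real.log β|) := by positivity
      rw [h6] at h5
      calc _ ≤ (1 + c + κ) * α + α * |Real.log β| + κ * β ^ s := by linarith
        _ ≤ (1 + c + κ) / Real.log 2 * (α * |Real.log β|) + α * |Real.log β| + κ * β ^ s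
            + (1 + c + κ) / Real.log 2 * β ^ s + κ * (α * |Real.log β|) + β ^ s := by linarith
        _ = _ := by ring
    calc _ ≤ K * (((1 + c + κ) / Real.log 2 + 1 + κ) * (α * |Real.log β| + β ^ s)) := by
          gcongr
      _ = _ := by ring
  · rintro ⟨ζ, l⟩ t ht q y hq hy
    refine (hvs l ζ t ht q y hq hy).trans ?_
    have h1 : (q / ϱ + 1) * (k l * β ^ (1 - ε)) ≤ (q / ϱ + 1) * μ := by
      gcongr; exact hkμ l
    have h2 : k l ≤ κ + κ * C₀ + C₀ := by
      have := mul_nonneg hκ0 hC₀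
      linarith [hkκ l]
    have h3 := hk0 l
    gcongr
  · intro l t ht
    refine (hvw l _ (hw l) t ht).trans ?_
    gcongr
    exact hkκ l

end Superposition

end WavepacketSuperposition

end

/-! ### The main theorem: passage from small `β` to all admissible `β`. -/

theorem mainTheorem1 {d J N : ℕ}
    -- the evolution equation
    (A : LinearPart d J) (hA : A.Admissible)
    (B : Nonlinearity d J) (Cχ : ℝ) (hB : B.Admissible A Cχ)
    -- the radius `R` and the time interval `[0, τs]`, `τs < 1 / C_F`
    (R : ℝ) (hR : 0 < R) (τs : ℝ) (hτs : 0 < τs) (hτs' : τs * lipConst B Cχ R < 1) :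
    -- the solution operator is defined on the ball `‖h‖ ≤ R`
    (∀ ϱ : ℝ, 0 < ϱ → ∀ g : L1 d J, ‖g‖ ≤ R →
      (∃ u, IsSolution A B ϱ τs R g u) ∧
      ∀ u u', IsSolution A B ϱ τs R g u → IsSolution A B ϱ τs R g u' →
        Set.EqOn u u' (Set.Icc 0 τs)) ∧
    -- the superposition principle
    ∀ (S : Fin N → Fin J × Wave d), Function.Injective S →
      (∀ l, (S l).2 ∉ A.bandCrossing ∧ -(S l).2 ∉ A.bandCrossing) →
      outputKSpectrum B S ∩ A.bandCrossing = ∅ →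
      UniversallyResonanceInvariant A B S →
      (∀ l₁ l₂, l₁ ≠ l₂ →
        gradient (A.freq (S l₁).1 1) (S l₁).2 ≠ gradient (A.freq (S l₂).1 1) (S l₂).2) →
    ∀ (Ψ : Wave d → ℝ), IsCutoff Ψ →
    ∀ (ε s β₀ : ℝ), 0 < ε → ε < 1 → 0 < s → 0 < β₀ →
    ∀ (h : Fin N → ℝ → Wave d → L1 d J),
      (∀ l, IsParticleWavepacket A Ψ ε s β₀ (S l).1 (S l).2 (h l)) →
      (∀ l β, 0 < β → β < β₀ → ∀ r : Wave d, N * ‖h l β r‖ ≤ R) →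
    ∀ C₀ : ℝ, ∃ C : ℝ, 0 < C ∧
      ∀ β ϱ : ℝ, 0 < β → β < β₀ → β ≤ 1 / 2 → 0 < ϱ → ϱ ≤ 1 / 2 → β ^ 2 / ϱ ≤ C₀ →
      ∀ r : Fin N → Wave d, ∀ τ ∈ Set.Icc 0 τs,
        ‖solutionOperator A B ϱ τs R (∑ l, h l β (r l)) τ
            - ∑ l, solutionOperator A B ϱ τs R (h l β (r l)) τ‖
          ≤ C * (ϱ / β ^ (1 + ε) * |Real.log β| + β ^ s) ∧
        (1 - ε ≤ s →
          ‖solutionOperator A B ϱ τs R (∑ l, h l β (r l)) τ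
              - ∑ l, solutionOperator A B ϱ τs R (h l β (r l)) τ‖
            ≤ C * (ϱ / β ^ (1 + ε) * |Real.log β|)) := by

  refine ⟨fun ϱ _ g hg => ⟨exists_isSolution hA hB hR hτs hτs' ϱ hg,
    fun u u' hu hu' => hu.eqOn hA hB hR hu'⟩, ?_⟩
  intro S _ hk hout hS hv Ψ hΨ ε s β₀ hε hε1 hs _ h hh hhR C₀
  have hl2 : 0 < Real.log 2 := Real.log_pos (by norm_num)
  have hev : ∃ K, 0 ≤ K ∧ ∀ᶠ β in nhdsWithin (0 : ℝ) (Set.Ioi 0), ∀ ϱ : ℝ, β < β₀ → β ≤ 1 / 2 →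
      0 < ϱ → ϱ ≤ 1 → β ^ 2 ≤ |C₀| * ϱ → ∀ r : Fin N → Wave d, ∀ τ ∈ Set.Icc 0 τs,
        ‖solutionOperator A B ϱ τs R (∑ l, h l β (r l)) τ
            - ∑ l, solutionOperator A B ϱ τs R (h l β (r l)) τ‖
          ≤ K * (ϱ * β ^ (-1 - ε) * |Real.log β| + β ^ s) := by
    -- A single packet satisfies the identity without error, while its norm bound would leave no
    -- margin for the remainder.
    by_cases hN : N = 1
    · subst hN
      exact ⟨0, le_rfl, Filter.Eventually.of_forall fun β ϱ _ _ _ _ _ r τ _ => by simp⟩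
    · exact eventually_superposition_estimate hA hB hR hτs hτs' hk hout hS hv hΨ hε hε1 hs
        (abs_nonneg C₀) hh hhR hN
  obtain ⟨K, hK, hev⟩ := hev
  -- The threshold below which the asymptotic estimate holds; it depends neither on `ϱ` nor on the
  -- positions.
  obtain ⟨β₁, hβ₁, hev⟩ := mem_nhdsGT_iff_exists_Ioo_subset.1 hev
  rw [Set.mem_Ioi] at hβ₁
  set M := (2 * R + N * (2 * R)) * |C₀| / (Real.log 2 * β₁ ^ (1 - ε)) with hM
  have hβ₁ε : 0 < β₁ ^ (1 - ε) := Real.rpow_pos_of_pos hβ₁ _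
  have hM0 : 0 ≤ M := by positivity
  refine ⟨K * (1 + |C₀| / Real.log 2) + M + 1, by positivity,
    fun β ϱ hβ hβ₀ hβ2 hϱ hϱ2 hβϱ r τ hτ => ?_⟩
  have hβϱ' : β ^ 2 ≤ |C₀| * ϱ := ((div_le_iff₀ hϱ).1 hβϱ).trans (by gcongr; exact le_abs_self _)
  rw [div_rpow_eq hβ]
  have hlog := log_two_le_abs_log hβ hβ2
  have hα := rpow_one_sub_le (ε := ε) hβ hβϱ'
  have hα0 : 0 < ϱ * β ^ (-1 - ε) := mul_pos hϱ (Real.rpow_pos_of_pos hβ _)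
  set α := ϱ * β ^ (-1 - ε)
  have hβs : 0 < β ^ s := Real.rpow_pos_of_pos hβ _
  have hX0 : 0 ≤ α * |Real.log β| := by positivity
  have hαX : |C₀| * α ≤ |C₀| / Real.log 2 * (α * |Real.log β|) := by
    calc |C₀| * α ≤ |C₀| * α * (|Real.log β| / Real.log 2) :=
          le_mul_of_one_le_right (by positivity) ((one_le_div hl2).2 hlog)
      _ = _ := by ring
  set X := α * |Real.log β|
  set D := ‖solutionOperator A B ϱ τs R (∑ l, h l β (r l)) τ
    - ∑ l, solutionOperator A B ϱ τs R (h l β (r l)) τ‖ with hD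
  have hCX : 0 ≤ K * (|C₀| / Real.log 2) * X := by positivity
  have hMX : 0 ≤ M * X := by positivity
  rcases lt_or_ge β β₁ with hlt | hge
  · have key : D ≤ K * (X + β ^ s) :=
      hev ⟨hβ, hlt⟩ ϱ hβ₀ hβ2 hϱ (by linarith) hβϱ' r τ hτ
    refine ⟨key.trans (mul_le_mul_of_nonneg_right ?_ (by positivity)), fun hsε => key.trans ?_⟩
    · have : 0 ≤ K * (|C₀| / Real.log 2) := by positivity
      linarith
    -- For `s ≥ 1 - ε` the remainder is at most `β^{1-ε}`, which the main term dominates.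
    · have h1 : β ^ s ≤ |C₀| / Real.log 2 * X :=
        ((Real.rpow_le_rpow_of_exponent_ge hβ (by linarith) hsε).trans hα).trans hαX
      calc K * (X + β ^ s) ≤ K * (X + |C₀| / Real.log 2 * X) := by gcongr
        _ ≤ (K * (1 + |C₀| / Real.log 2) + M + 1) * X := by linarith
  -- For `β ≥ β₁` the solutions are bounded by `2R`, while `X` is bounded below by a multiple of
  -- `β₁^{1-ε}`; the constant `M` is the quotient of these two bounds.
  · have hu := (isSolution_solutionOperator hA hB hR hτs hτs' ϱ
      (norm_sum_le_of_forall_card_mul_le hR.le fun l => hhR l β hβ hβ₀ (r l))).bound τ hτ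
    have hw : ∀ l, ‖solutionOperator A B ϱ τs R (h l β (r l)) τ‖ ≤ 2 * R := fun l =>
      (isSolution_solutionOperator hA hB hR hτs hτs' ϱ
        (norm_le_of_card_mul_le l (hhR l β hβ hβ₀ (r l)))).bound τ hτ
    have h1 : D ≤ 2 * R + N * (2 * R) := by
      refine (norm_sub_le _ _).trans (add_le_add hu ?_)
      refine (norm_sum_le_of_le _ fun l _ => hw l).trans_eq ?_
      rw [Finset.sum_const, Finset.card_univ, Fintype.card_fin, nsmul_eq_mul]
    have h2 : β₁ ^ (1 - ε) ≤ |C₀| / Real.log 2 * X :=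
      ((Real.rpow_le_rpow hβ₁.le hge (by linarith)).trans hα).trans hαX
    have h3 : D ≤ M * X := by
      refine h1.trans ?_
      calc 2 * R + N * (2 * R) = (2 * R + N * (2 * R)) / β₁ ^ (1 - ε) * β₁ ^ (1 - ε) := by
            field_simp
        _ ≤ (2 * R + N * (2 * R)) / β₁ ^ (1 - ε) * (|C₀| / Real.log 2 * X) := by gcongr
        _ = M * X := by rw [hM]; field_simp
    have h4 : D ≤ (K * (1 + |C₀| / Real.log 2) + M + 1) * X := by
      have : 0 ≤ K * X := by positivity
      linarith
    refine ⟨h4.trans (mul_le_mul_of_nonneg_left (by linarith) (by positivity)), fun _ => h4⟩
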